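/- Consider two independent sources $c=1,2$, where source $c$ generates packets according to a Poisson process of rate $\lambda_c>0$, and put $\lambda=\lambda_1+\lambda_2$. The packets are sent to a sink through a single server without waiting room. Their service times are i.i.d. copies of a nonnegative random variable $S$ with an arbitrary distribution, independent of the generation times; put $L_\lambda=\mathbb{E}[e^{-\lambda S}]$ and $L'_\lambda=\mathbb{E}[Se^{-\lambda S}]$. The policy is source-agnostic preemptive: every arriving packet enters service immediately and discards the packet in the system, if any, regardless of its source. Let $t_{1,i}$ and $t'_{1,i}$ be the generation time and the delivery time of the $i$th delivered packet of source 1. The age of information (AoI) of source 1 at time $t$ is $\delta_1(t)=t-t_{1,N_1(t)}$ with $N_1(t)=\max\{i: t'_{1,i}\le t\}$ (an arbitrary constant time stamp being used before the first delivery), and the peak AoI, i.e. the AoI immediately before the $i$th delivery, is $A_{1,i}=(t'_{1,i}-t'_{1,i-1})+(t'_{1,i-1}-t_{1,i-1})$ for $i\ge 2$. Then the average AoI of source 1, i.e. the mean of the stationary (limiting) distribution of $\delta_1(t)$ and also the almost sure limit of $\frac1\tau\int_0^\tau\delta_1(t)\,\mathrm{d}t$ as $\tau\to\infty$, and the average peak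 AoI of source 1, i.e. $\mathbb{E}[A_{1,i}]$ for every $i\ge2$ and also the almost sure limit of $\frac1n\sum_{i=2}^{n+1}A_{1,i}$ as $n\to\infty$, are $$\hat\Delta_1=\frac{1}{\lambda_1L_\lambda},\qquad \hat A_1=\frac{1+\lambda_1L'_\lambda}{\lambda_1L_\lambda}.$$ -/

import Mathlib

open MeasureTheory ProbabilityTheory Filter Topology

noncomputable section

namespace MG11

/-- The random input of a multi-source M/G/1/1 queueing system on the probability space `(Ω, P)`.
`X c n` is the time between the `n`-th and the `(n+1)`-th packet generation of source `c` (for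
`n = 0`, the time from the origin to the first generation), and `S c n` is the service time of the
packet with index `n` of source `c`, indices starting from `0`. The interarrival times of source `c`
are exponential with parameter `rate c`, so that each source generates packets according to a
Poisson process of rate `rate c`; the service times are nonnegative with the general
distribution `σ`; and all these variables are independent, within and across the sources. -/
structure IsInput {ι Ω : Type*} [MeasurableSpace Ω] (P : Measure Ω) (rate : ι → ℝ)
    (σ : Measure ℝ) (X S : ι → ℕ → Ω → ℝ) : Prop where
  rate_pos : ∀ c, 0 < rate c
  interarrival : ∀ c n, HasLaw (X c n) (expMeasure (rate c)) P
  service : ∀ c n, HasLaw (S c n) σ P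
  service_nonneg : σ (Set.Iio 0) = 0
  indep : iIndepFun (Sum.elim (fun p : ι × ℕ => X p.1 p.2) (fun p : ι × ℕ => S p.1 p.2)) P

section SamplePath

/-! Sample-path quantities: here `x c n` and `s c n` are realizations of the interarrival and
service times. A packet is a pair `(c, n)` of a source and an index `n`. -/

variable {ι : Type*} (x s : ι → ℕ → ℝ)

/-- Generation time (which is also the arrival time at the server) of the packet `(c, n)`. -/
def arrivalTime (c : ι) (n : ℕ) : ℝ := ∑ k ∈ Finset.range (n + 1), x c k

/-- The source-agnostic preemptive policy: the system holds one packet, and an arriving packet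
always enters service at once, discarding the packet in the system, if any, whatever its source.
Hence the packet `(c, n)` is delivered exactly when its service is completed before the arrival of
every packet, of any source, that is generated after it. -/
def Delivered (c : ι) (n : ℕ) : Prop :=
  ∀ (c' : ι) (m : ℕ), arrivalTime x c n < arrivalTime x c' m →
    arrivalTime x c n + s c n < arrivalTime x c' m

/-- The index, among all packets of source `c`, of the `i`-th delivered packet of source `c`, for
`i ≥ 1`. -/
def deliveredIndex (c : ι) (i : ℕ) : ℕ := Nat.nth (Delivered x s c) (i - 1)

/-- `t_{c,i}`: the generation time of the `i`-th delivered packet of source `c` for `i ≥ 1`. For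
`i = 0` it is the initial time stamp `u₀`, which the sink holds before the first delivery. -/
def genTime (u₀ : ℝ) (c : ι) (i : ℕ) : ℝ :=
  if i = 0 then u₀ else arrivalTime x c (deliveredIndex x s c i)

/-- `t'_{c,i}`: the time at which the `i`-th delivered packet of source `c` arrives at the sink,
for `i ≥ 1`. -/
def deliveryTime (c : ι) (i : ℕ) : ℝ :=
  arrivalTime x c (deliveredIndex x s c i) + s c (deliveredIndex x s c i)

/-- `N_c(τ) = max {i ≥ 1 | t'_{c,i} ≤ τ}`, the index of the most recently received packet of source
`c` at time `τ`, and `0` if no packet has been received. -/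
def lastReceived (c : ι) (τ : ℝ) : ℕ := sSup {i : ℕ | 1 ≤ i ∧ deliveryTime x s c i ≤ τ}

/-- The age of information `δ_c(τ) = τ - U_c(τ)`, with `U_c(τ) = t_{c,N_c(τ)}`. -/
def aoi (u₀ : ℝ) (c : ι) (τ : ℝ) : ℝ := τ - genTime x s u₀ c (lastReceived x s c τ)

/-- The interdeparture time `Y_{c,i} = t'_{c,i+1} - t'_{c,i}`, for `i ≥ 1`. -/
def interdeparture (c : ι) (i : ℕ) : ℝ := deliveryTime x s c (i + 1) - deliveryTime x s c i

/-- The system time `T_{c,i} = t'_{c,i} - t_{c,i}`, for `i ≥ 1`. -/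
def systemTime (c : ι) (i : ℕ) : ℝ :=
  deliveryTime x s c i - arrivalTime x c (deliveredIndex x s c i)

/-- The peak AoI concerning the `i`-th delivered packet, i.e. the value of the AoI immediately
before its reception: `A_{c,i} = Y_{c,i-1} + T_{c,i-1}`, for `i ≥ 2`. -/
def peakAoI (c : ι) (i : ℕ) : ℝ := interdeparture x s c (i - 1) + systemTime x s c (i - 1)

end SamplePath

/-- `a` is the average AoI of source `c`: for every initial time stamp `u₀`, the AoI at time `t`
converges in distribution, as `t → ∞`, to a stationary AoI with finite mean `a`, and almost surely
the time average of the AoI over `[0, τ]` tends to `a` as `τ → ∞`. -/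
def IsAverageAoI {ι Ω : Type*} [MeasurableSpace Ω] (P : Measure Ω) [IsProbabilityMeasure P]
    (X S : ι → ℕ → Ω → ℝ) (c : ι) (a : ℝ) : Prop :=
  ∀ u₀ : ℝ,
    (∃ ν : ProbabilityMeasure ℝ,
      TendstoInDistribution
        (fun (t : ℝ) ω => aoi (fun c n => X c n ω) (fun c n => S c n ω) u₀ c t)
        atTop (fun y : ℝ => y) (fun _ => P) (ν : Measure ℝ) ∧
      Integrable (fun y : ℝ => y) (ν : Measure ℝ) ∧ ∫ y, y ∂(ν : Measure ℝ) = a) ∧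
    ∀ᵐ ω ∂P,
      (∀ τ : ℝ, 0 ≤ τ → IntervalIntegrable
        (fun t => aoi (fun c n => X c n ω) (fun c n => S c n ω) u₀ c t) volume 0 τ) ∧
      Tendsto (fun τ : ℝ =>
        (∫ t in (0 : ℝ)..τ, aoi (fun c n => X c n ω) (fun c n => S c n ω) u₀ c t) / τ)
        atTop (𝓝 a)

/-- `a` is the average peak AoI of source `c`: almost surely infinitely many packets of source `c`
are delivered, each peak AoI `A_{c,i}`, `i ≥ 2`, is integrable with mean `a`, and almost surely
the empirical average of the peaks tends to `a`. -/
def IsAveragePeakAoI {ι Ω : Type*} [MeasurableSpace Ω] (P : Measure Ω)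
    (X S : ι → ℕ → Ω → ℝ) (c : ι) (a : ℝ) : Prop :=
  (∀ᵐ ω ∂P, {n | Delivered (fun c n => X c n ω) (fun c n => S c n ω) c n}.Infinite) ∧
  (∀ i : ℕ, 2 ≤ i →
    Integrable (fun ω => peakAoI (fun c n => X c n ω) (fun c n => S c n ω) c i) P ∧
    ∫ ω, peakAoI (fun c n => X c n ω) (fun c n => S c n ω) c i ∂P = a) ∧
  ∀ᵐ ω ∂P, Tendsto (fun n : ℕ =>
    (∑ i ∈ Finset.range n, peakAoI (fun c n => X c n ω) (fun c n => S c n ω) c (i + 2)) / n)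
    atTop (𝓝 a)

/-- `L_r = E[e^{-rS}]` for a service time `S` with distribution `σ`. -/
def laplaceL (σ : Measure ℝ) (r : ℝ) : ℝ := ∫ y, Real.exp (-r * y) ∂σ

/-- `L'_r = E[S e^{-rS}]` for a service time `S` with distribution `σ`. -/
def laplaceL' (σ : Measure ℝ) (r : ℝ) : ℝ := ∫ y, y * Real.exp (-r * y) ∂σ

end MG11

end

set_option linter.unusedSectionVars false

/-! Everything is read off from the steps of source 1 (index `0`): the gap X_{n+1} after packet n,
its service time S_n, and whether the packet is delivered. Delivery means S_n < X_{n+1} together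
with the absence of source-2 points in (t_n, t_n + S_n]. Given source 1, the intervals of packets
with S_n < X_{n+1} are disjoint, so the Poisson void probabilities multiply
(`seqLaw_forall_notMem_Ioc`). Hence the steps are i.i.d. (`pathLaw_steps`, `iIndepFun_step`,
`map_step`), with delivery probability E[e^{-λ₁S} e^{-λ₂S}] = L_λ.

Peaks. Call a step's `busy` part S_n if the packet is delivered and X_{n+1} otherwise. A peak is the
gap after a delivered packet plus the busy parts of the following steps up to the next delivered
one. A Wald-type identity (`lintegral_tsum_count`) makes the expected sum of F over such a block
equal to E[F]/L_λ. With E[gap; delivered] = L'_λ + L_λ/λ₁ and E[busy] = (1 - L_λ)/λ₁ this gives the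
mean peak; the almost sure limit follows by telescoping and the strong law.

Stationary AoI. The age at t is at least y exactly when no packet generated after t - y is delivered
by t (`le_aoi_iff`). By memorylessness the input seen from t - y on has the original law
(`measurePreserving_shiftPath`), so P(δ₁(t) ≥ y) = P(first delivery time > y) as soon as y ≤ t and y
≤ t - u₀. The limit law is therefore that of the first delivery time, of mean 1/λ₁ + (1 - L_λ)/(λ₁
L_λ).

Time average. The age Z_n found by packet n is a sum of gaps reset at each delivery, and the area
under the age during step n is Z_n · busy_n + X_{n+1}²/2. The Z_n are dependent, but Z_n is
independent of step n; a strong law for orthogonal variables yields the averages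
(`ae_tendsto_avg_resetSum_mul`), and monotonicity fills in the times between generations.

All of this is done on a canonical product space and transferred through the law of the input
(`IsInput.map_inputPath`). No moment of S is required, since s e^{-rs} is bounded and delivered
service times are dominated by gaps. -/

namespace MG11

/-! ### Strong law for orthogonal random variables. -/

section StrongLaws

variable {Ω : Type*} [MeasurableSpace Ω] {P : Measure Ω}

/-- Nonnegative random variables with summable means tend to `0` almost surely. -/
theorem ae_tendsto_zero_of_summable_integral {f : ℕ → Ω → ℝ} (hf : ∀ n, Integrable (f n) P)
    (h0 : ∀ n ω, 0 ≤ f n ω) {c : ℕ → ℝ} (hc : Summable c) (hfc : ∀ n, ∫ ω, f n ω ∂P ≤ c n) :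
    ∀ᵐ ω ∂P, Tendsto (fun n => f n ω) atTop (𝓝 0) := by
  have h1 : ∫⁻ ω, ∑' n, ENNReal.ofReal (f n ω) ∂P ≠ ⊤ := by
    rw [lintegral_tsum fun n => (hf n).1.aemeasurable.ennreal_ofReal]
    refine ne_top_of_le_ne_top hc.tsum_ofReal_ne_top (ENNReal.tsum_le_tsum fun n => ?_)
    rw [← ofReal_integral_eq_lintegral_ofReal (hf n) (ae_of_all _ (h0 n))]
    exact ENNReal.ofReal_le_ofReal (hfc n)
  have h2 := ae_lt_top' (AEMeasurable.tsum fun n => (hf n).1.aemeasurable.ennreal_ofReal) h1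
  filter_upwards [h2] with ω hω
  have h3 := ENNReal.tendsto_atTop_zero_of_tsum_ne_top hω.ne
  have h4 := (ENNReal.tendsto_toReal ENNReal.zero_ne_top).comp h3
  simpa [Function.comp_def, ENNReal.toReal_ofReal (h0 _ ω)] using h4

/-- A deterministic bound behind the method of subsequences: between consecutive squares the
partial sums are controlled by the squares of the increments. -/
theorem abs_avg_le_of_sqrt (y : ℕ → ℝ) (N : ℕ) (hN : 0 < N) :
    |(∑ n ∈ Finset.range N, y n) / N| ≤
      √(((∑ n ∈ Finset.range (N.sqrt ^ 2), y n) / (N.sqrt : ℝ) ^ 2) ^ 2) +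
      √((2 * N.sqrt + 1) * (∑ n ∈ Finset.Ico (N.sqrt ^ 2) ((N.sqrt + 1) ^ 2), y n ^ 2) /
        (N.sqrt : ℝ) ^ 4) := by
  set k := N.sqrt with hk
  have hk0 : 0 < k := Nat.sqrt_pos.2 hN
  have hkN : k ^ 2 ≤ N := Nat.sqrt_le' N
  have hNk : N < (k + 1) ^ 2 := Nat.lt_succ_sqrt' N
  have hkR : (0 : ℝ) < (k : ℝ) ^ 2 := by positivity
  have hkNR : (k : ℝ) ^ 2 ≤ N := by exact_mod_cast hkN
  rw [← Finset.sum_range_add_sum_Ico _ hkN, Real.sqrt_sq_eq_abs, abs_div, abs_div,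
    abs_of_pos hkR, Nat.abs_cast]
  set A := ∑ n ∈ Finset.range (k ^ 2), y n
  set B := ∑ n ∈ Finset.Ico (k ^ 2) N, y n
  have hB : B ^ 2 ≤ (2 * k + 1) * ∑ n ∈ Finset.Ico (k ^ 2) ((k + 1) ^ 2), y n ^ 2 := by
    calc B ^ 2 ≤ (Finset.Ico (k ^ 2) N).card * ∑ n ∈ Finset.Ico (k ^ 2) N, y n ^ 2 :=
          sq_sum_le_card_mul_sum_sq
      _ ≤ _ := by
          refine mul_le_mul ?_ ?_ (Finset.sum_nonneg fun _ _ => sq_nonneg _) (by positivity)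
          · rw [Nat.card_Ico]
            have : N - k ^ 2 ≤ 2 * k + 1 := by
              rw [Nat.sub_le_iff_le_add]; nlinarith
            exact_mod_cast this
          · exact Finset.sum_le_sum_of_subset_of_nonneg
              (Finset.Ico_subset_Ico_right hNk.le) fun _ _ _ => sq_nonneg _
  have h4 : (k : ℝ) ^ 4 = ((k : ℝ) ^ 2) ^ 2 := by ring
  rw [h4, Real.sqrt_div' _ (by positivity), Real.sqrt_sq hkR.le, ← add_div]
  refine div_le_div₀ (by positivity) ?_ hkR hkNR
  exact (abs_add_le _ _).trans (by gcongr; exact Real.abs_le_sqrt hB)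

/-- Strong law of large numbers for orthogonal random variables that are bounded in `L²`. -/
theorem ae_tendsto_avg_of_orthogonal {Y : ℕ → Ω → ℝ} (hY : ∀ n, MemLp (Y n) 2 P) {C : ℝ}
    (hC : ∀ n, ∫ ω, Y n ω ^ 2 ∂P ≤ C) (horth : ∀ m n, m < n → ∫ ω, Y m ω * Y n ω ∂P = 0) :
    ∀ᵐ ω ∂P, Tendsto (fun N : ℕ => (∑ n ∈ Finset.range N, Y n ω) / N) atTop (𝓝 0) := by
  have hint : ∀ m n, Integrable (fun ω => Y m ω * Y n ω) P := fun m n =>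
    (hY m).integrable_mul (hY n)
  have hsq : ∀ n, Integrable (fun ω => Y n ω ^ 2) P := fun n => (hY n).integrable_sq
  have hC0 : 0 ≤ C := (integral_nonneg fun ω => sq_nonneg (Y 0 ω)).trans (hC 0)
  have hM : ∀ N : ℕ, ∫ ω, (∑ n ∈ Finset.range N, Y n ω) ^ 2 ∂P ≤ N * C := by
    intro N
    have h1 : ∀ ω, (∑ n ∈ Finset.range N, Y n ω) ^ 2 =
        ∑ m ∈ Finset.range N, ∑ n ∈ Finset.range N, Y m ω * Y n ω := fun ω => by
      rw [sq, Finset.sum_mul_sum]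
    simp_rw [h1]
    rw [integral_finsetSum _ fun m _ => integrable_finsetSum _ fun n _ => hint m n]
    have h2 : ∀ m ∈ Finset.range N, ∫ ω, ∑ n ∈ Finset.range N, Y m ω * Y n ω ∂P ≤ C := by
      intro m hm
      rw [integral_finsetSum _ fun n _ => hint m n, Finset.sum_eq_single_of_mem m hm]
      · simpa [sq] using hC m
      · intro n _ hn
        rcases lt_or_gt_of_ne hn with h | h
        · simpa [mul_comm] using horth n m h
        · exact horth m n h
    simpa using Finset.sum_le_sum h2
  have hMint : ∀ N : ℕ, Integrable (fun ω => (∑ n ∈ Finset.range N, Y n ω) ^ 2) P := fun N =>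
    (memLp_finsetSum _ fun n _ => hY n).integrable_sq
  -- The common bound 9C/k² serves both subsequences: the averages at k² have second moment at most
  -- C/k², and the block term has mean at most (2k+1)²C/k⁴, where 2k+1 ≤ 3k.
  have hsum : Summable fun k : ℕ => 9 * C * (1 / (k : ℝ) ^ 2) :=
    (Real.summable_one_div_nat_pow.2 one_lt_two).mul_left _
  have hA := ae_tendsto_zero_of_summable_integral (P := P)
    (f := fun k ω => ((∑ n ∈ Finset.range (k ^ 2), Y n ω) / (k : ℝ) ^ 2) ^ 2)
    (fun k => by simpa [div_pow] using (hMint (k ^ 2)).div_const _)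
    (fun k ω => sq_nonneg _) hsum (fun k => by
      simp_rw [div_pow]
      rw [integral_div]
      rcases Nat.eq_zero_or_pos k with rfl | hk
      · simp
      have hk' : (0 : ℝ) < k := by exact_mod_cast hk
      rw [div_le_iff₀ (by positivity)]
      refine (hM _).trans (le_of_sub_nonneg ?_)
      have : 9 * C * (1 / (k : ℝ) ^ 2) * ((k : ℝ) ^ 2) ^ 2 - ((k ^ 2 : ℕ) : ℝ) * C =
        8 * C * (k : ℝ) ^ 2 := by push_cast; field_simp; ring
      rw [this]; positivity)
  have hB := ae_tendsto_zero_of_summable_integral (P := P)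
    (f := fun k ω => (2 * (k : ℝ) + 1) *
      (∑ n ∈ Finset.Ico (k ^ 2) ((k + 1) ^ 2), Y n ω ^ 2) / (k : ℝ) ^ 4)
    (fun k => ((integrable_finsetSum _ fun n _ => hsq n).const_mul _).div_const _)
    (fun k ω => div_nonneg (mul_nonneg (by positivity)
      (Finset.sum_nonneg fun _ _ => sq_nonneg _)) (by positivity)) hsum (fun k => by
      rw [integral_div, integral_const_mul, integral_finsetSum _ fun n _ => hsq n]
      rcases Nat.eq_zero_or_pos k with rfl | hk
      · simp
      have hk' : (1 : ℝ) ≤ k := by exact_mod_cast hk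
      have hk0 : (0 : ℝ) < k := by linarith
      have h1 : ∑ n ∈ Finset.Ico (k ^ 2) ((k + 1) ^ 2), ∫ ω, Y n ω ^ 2 ∂P ≤ (2 * k + 1) * C := by
        refine (Finset.sum_le_sum fun n _ => hC n).trans ?_
        rw [Finset.sum_const, Nat.card_Ico, nsmul_eq_mul]
        have : (k + 1) ^ 2 - k ^ 2 = 2 * k + 1 := by
          rw [Nat.sub_eq_iff_eq_add (by gcongr; omega)]; ring
        rw [this]; push_cast; rfl
      rw [div_le_iff₀ (by positivity)]
      calc (2 * (k : ℝ) + 1) * ∑ n ∈ Finset.Ico (k ^ 2) ((k + 1) ^ 2), ∫ ω, Y n ω ^ 2 ∂P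
          ≤ (2 * (k : ℝ) + 1) * ((2 * k + 1) * C) := by gcongr
        _ ≤ (3 * k) * ((3 * k) * C) := by gcongr <;> linarith
        _ = 9 * C * (1 / (k : ℝ) ^ 2) * (k : ℝ) ^ 4 := by field_simp; ring)
  have hsqrt : Tendsto Nat.sqrt atTop atTop :=
    tendsto_atTop_atTop.2 fun b => ⟨b * b, fun a ha => Nat.le_sqrt.2 ha⟩
  filter_upwards [hA, hB] with ω h1 h2
  have h3 := (Real.continuous_sqrt.tendsto 0).comp (h1.comp hsqrt)
  have h4 := (Real.continuous_sqrt.tendsto 0).comp (h2.comp hsqrt)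
  have h5 := h3.add h4
  rw [Real.sqrt_zero, add_zero] at h5
  refine squeeze_zero_norm' ?_ h5
  filter_upwards [eventually_gt_atTop 0] with N hN
  exact abs_avg_le_of_sqrt (fun n => Y n ω) N hN

end StrongLaws

/-! ### Visits to a set and reset sums driven by an i.i.d. sequence. -/

section IIDSequence

open scoped Classical in
/-- The reset process driven by the sequence `w`: it grows by `x (w n)` in step `n`, after having
been reset to `0` if `w n ∈ D`. -/
noncomputable def resetSum {E : Type*} (D : Set E) (x : E → ℝ) (w : ℕ → E) : ℕ → ℝ
  | 0 => 0
  | n + 1 => (if w n ∈ D then 0 else resetSum D x w n) + x (w n)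

variable {Ω E : Type*} [MeasurableSpace Ω] [MeasurableSpace E] {P : Measure Ω}
  [IsProbabilityMeasure P] {κ : Measure E} {W : ℕ → Ω → E}

/-- The `σ`-algebra generated by `W k`, `k < n`. -/
abbrev past (W : ℕ → Ω → E) (n : ℕ) : MeasurableSpace Ω :=
  ⨆ k ∈ Set.Iio n, MeasurableSpace.comap (W k) inferInstance

theorem past_le (hW : ∀ n, Measurable (W n)) (n : ℕ) :
    past W n ≤ (inferInstance : MeasurableSpace Ω) :=
  iSup₂_le fun k _ => (hW k).comap_le

theorem past_mono {m n : ℕ} (h : m ≤ n) : past W m ≤ past W n :=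
  iSup₂_le fun k hk => le_iSup₂_of_le (f := fun k (_ : k ∈ Set.Iio n) =>
    MeasurableSpace.comap (W k) inferInstance) k (lt_of_lt_of_le hk h) le_rfl

theorem measurable_past (n k : ℕ) (h : k < n) : Measurable[past W n] (W k) := by
  rw [measurable_iff_comap_le]
  exact le_iSup₂_of_le (f := fun k (_ : k ∈ Set.Iio n) =>
    MeasurableSpace.comap (W k) inferInstance) k h le_rfl

theorem indep_past (hW : ∀ n, Measurable (W n)) (hi : iIndepFun W P) (n : ℕ) :
    Indep (past W n) (MeasurableSpace.comap (W n) inferInstance) P := by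
  have := indep_iSup_of_disjoint (fun k => (hW k).comap_le) hi.iIndep
    (S := Set.Iio n) (T := {n}) (by simp)
  simpa only [Set.mem_singleton_iff, iSup_iSup_eq_left] using this

/-- Every factorisation of an expectation over a step and its history rests on this: the history
before index n, however complicated, is a function of strictly earlier terms. -/
theorem indepFun_past {β γ : Type*} [MeasurableSpace β] [MeasurableSpace γ]
    (hW : ∀ n, Measurable (W n)) (hi : iIndepFun W P) {n : ℕ}
    {Z : Ω → β} (hZ : Measurable[past W n] Z) {g : E → γ} (hg : Measurable g) :
    IndepFun Z (fun ω => g (W n ω)) P := by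
  rw [IndepFun_iff_Indep]
  refine indep_of_indep_of_le (indep_past hW hi n) hZ.comap_le ?_
  exact (hg.comp (comap_measurable (W n))).comap_le

theorem ae_tendsto_avg_of_iid (hW : ∀ n, Measurable (W n)) (hi : iIndepFun W P)
    (hl : ∀ n, P.map (W n) = κ) {f : E → ℝ} (hf : Measurable f) (hfi : Integrable f κ) :
    ∀ᵐ ω ∂P, Tendsto (fun N : ℕ => (∑ n ∈ Finset.range N, f (W n ω)) / N) atTop
      (𝓝 (∫ e, f e ∂κ)) := by
  have h0 : ∫ e, f e ∂κ = ∫ ω, f (W 0 ω) ∂P := by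
    rw [← hl 0, integral_map (hW 0).aemeasurable hf.aestronglyMeasurable]
  rw [h0]
  refine strong_law_ae_real (fun n ω => f (W n ω)) ?_ ?_ ?_
  · exact (integrable_map_measure hf.aestronglyMeasurable (hW 0).aemeasurable).1
      (by rw [hl 0]; exact hfi)
  · intro m n hmn
    exact (hi.indepFun hmn).comp hf hf
  · intro n
    exact (IdentDistrib.mk (hW n).aemeasurable (hW 0).aemeasurable (by rw [hl, hl])).comp hf

theorem integral_comp_law (hW : ∀ n, Measurable (W n)) (hl : ∀ n, P.map (W n) = κ) (n : ℕ)
    {f : E → ℝ} (hf : Measurable f) : ∫ ω, f (W n ω) ∂P = ∫ e, f e ∂κ := by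
  rw [← hl n, integral_map (hW n).aemeasurable hf.aestronglyMeasurable]

theorem memLp_comp_law (hW : ∀ n, Measurable (W n)) (hl : ∀ n, P.map (W n) = κ) (n : ℕ)
    {f : E → ℝ} (hf : MemLp f 2 κ) : MemLp (fun ω => f (W n ω)) 2 P := by
  rw [← hl n] at hf
  exact hf.comp_of_map (hW n).aemeasurable

open scoped Classical in
/-- Almost surely, `W` visits `D` with asymptotic frequency `κ D`. -/
theorem ae_tendsto_count (hW : ∀ n, Measurable (W n)) (hi : iIndepFun W P)
    (hl : ∀ n, P.map (W n) = κ) {D : Set E} (hD : MeasurableSet D) :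
    ∀ᵐ ω ∂P, Tendsto (fun N : ℕ => (Nat.count (fun n => W n ω ∈ D) N : ℝ) / N) atTop
      (𝓝 (κ.real D)) := by
  have : IsProbabilityMeasure κ := by
    rw [← hl 0]; exact Measure.isProbabilityMeasure_map (hW 0).aemeasurable
  have h := ae_tendsto_avg_of_iid hW hi hl (f := D.indicator 1) (measurable_one.indicator hD)
    ((integrable_const (1 : ℝ)).indicator hD)
  rw [integral_indicator_one hD] at h
  filter_upwards [h] with ω hω
  convert hω using 3 with N
  rw [Nat.count_eq_card_filter_range, Finset.card_filter]
  push_cast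
  exact Finset.sum_congr rfl fun n _ => by simp [Set.indicator_apply]

/-- Finitely many visits would force the asymptotic frequency to be 0. -/
theorem ae_infinite_visits (hW : ∀ n, Measurable (W n)) (hi : iIndepFun W P)
    (hl : ∀ n, P.map (W n) = κ) {D : Set E} (hD : MeasurableSet D) (h0 : 0 < κ.real D) :
    ∀ᵐ ω ∂P, {n | W n ω ∈ D}.Infinite := by
  classical
  filter_upwards [ae_tendsto_count hW hi hl hD] with ω hω hfin
  have h1 : ∀ N, (Nat.count (fun n => W n ω ∈ D) N : ℝ) ≤ hfin.toFinset.card := by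
    intro N
    rw [Nat.count_eq_card_filter_range]
    exact_mod_cast Finset.card_le_card fun n hn => by simpa using (Finset.mem_filter.1 hn).2
  have h2 : Tendsto (fun N : ℕ => (Nat.count (fun n => W n ω ∈ D) N : ℝ) / N) atTop (𝓝 0) := by
    refine squeeze_zero (fun N => by positivity) (fun N => ?_)
      (tendsto_const_div_atTop_nhds_zero_nat (hfin.toFinset.card : ℝ))
    exact div_le_div_of_nonneg_right (h1 N) N.cast_nonneg
  exact h0.ne (tendsto_nhds_unique h2 hω)

open scoped Classical in
theorem measurable_count_past {D : Set E} (hD : MeasurableSet D) (n : ℕ) :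
    Measurable[past W n] (fun ω => Nat.count (fun k => W k ω ∈ D) n) := by
  simp_rw [Nat.count_eq_card_filter_range, Finset.card_filter]
  refine Finset.measurable_fun_sum _ fun k hk => ?_
  exact Measurable.ite (measurable_past n k (Finset.mem_range.1 hk) hD) measurable_const
    measurable_const

open scoped Classical in
/-- The expected sum of `F (W n)` over the indices `n` that are preceded by exactly `j` visits
to `D`. -/
theorem lintegral_tsum_count (hW : ∀ n, Measurable (W n)) (hi : iIndepFun W P)
    (hl : ∀ n, P.map (W n) = κ) {D : Set E} (hD : MeasurableSet D) (h0 : 0 < κ.real D)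
    {F : E → ENNReal} (hF : Measurable F) (j : ℕ) :
    ∫⁻ ω, ∑' n, (if Nat.count (fun k => W k ω ∈ D) n = j then F (W n ω) else 0) ∂P =
      (∫⁻ e, F e ∂κ) / κ D := by
  have : IsProbabilityMeasure κ := by
    rw [← hl 0]; exact Measure.isProbabilityMeasure_map (hW 0).aemeasurable
  have hD0 : κ D ≠ 0 := fun h => by simp [Measure.real, h] at h0
  set A : ℕ → Set Ω := fun n => {ω | Nat.count (fun k => W k ω ∈ D) n = j}
  have hAp : ∀ n, MeasurableSet[past W n] (A n) := fun n =>
    measurable_count_past hD n (measurableSet_singleton j)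
  have hA : ∀ n, MeasurableSet (A n) := fun n => past_le hW n _ (hAp n)
  -- The event "exactly j visits before n" belongs to the past of n, so it decouples from `W n`. The
  -- remaining factor, the sum of the `P (A n)`, does not depend on F; it is evaluated below with F
  -- the indicator of D.
  have key : ∀ {F : E → ENNReal}, Measurable F →
      ∫⁻ ω, ∑' n, (if Nat.count (fun k => W k ω ∈ D) n = j then F (W n ω) else 0) ∂P =
      (∫⁻ e, F e ∂κ) * ∑' n, P (A n) := by
    intro F hF
    have hm : ∀ n, AEMeasurable (fun ω => if Nat.count (fun k => W k ω ∈ D) n = j then F (W n ω)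
        else 0) P := fun n =>
      (Measurable.ite (hA n) (hF.comp (hW n)) measurable_const).aemeasurable
    rw [lintegral_tsum hm, ← ENNReal.tsum_mul_left]
    congr 1
    ext n
    set I : Ω → ENNReal := fun ω => if Nat.count (fun k => W k ω ∈ D) n = j then 1 else 0 with hI
    have hIm : Measurable[past W n] I := Measurable.ite (hAp n) measurable_const measurable_const
    have hI' : Measurable I := hIm.mono (past_le hW n) le_rfl
    have hIA : ∫⁻ ω, I ω ∂P = P (A n) := by
      rw [← lintegral_indicator_one (hA n)]
      exact lintegral_congr fun ω => by simp [hI, A, Set.indicator_apply]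
    have h1 : ∀ ω, (if Nat.count (fun k => W k ω ∈ D) n = j then F (W n ω) else 0) =
        I ω * F (W n ω) := fun ω => by simp [hI]
    have hFm : Measurable fun ω => F (W n ω) := hF.comp (hW n)
    simp_rw [h1]
    rw [lintegral_mul_eq_lintegral_mul_lintegral_of_indepFun'' hI'.aemeasurable hFm.aemeasurable
      (indepFun_past hW hi hIm hF), hIA, mul_comm, ← hl n, lintegral_map hF (hW n)]
  have h1 := key (F := D.indicator 1) (measurable_one.indicator hD)
  rw [lintegral_indicator_one hD] at h1
  -- For F the indicator of D only one index survives, the j-th visit (counted from 0), so the sum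
  -- is 1 almost surely.
  have h2 : ∫⁻ ω, ∑' n, (if Nat.count (fun k => W k ω ∈ D) n = j then
      D.indicator (1 : E → ENNReal) (W n ω) else 0) ∂P = 1 := by
    rw [← measure_univ (μ := P), ← lintegral_one]
    refine lintegral_congr_ae ?_
    filter_upwards [ae_infinite_visits hW hi hl hD h0] with ω hω
    rw [tsum_eq_single (Nat.nth (fun k => W k ω ∈ D) j)]
    · rw [if_pos (Nat.count_nth_of_infinite hω j), Set.indicator_of_mem]
      · rfl
      · exact Nat.nth_mem_of_infinite hω j
    · intro n hn
      split_ifs with hc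
      · rw [Set.indicator_of_notMem]
        intro hd
        refine hn ?_
        rw [← hc]
        exact (Nat.nth_count (p := fun k => W k ω ∈ D) hd).symm
      · rfl
  rw [key hF, div_eq_mul_inv]
  congr 1
  rw [h2] at h1
  exact ENNReal.eq_inv_of_mul_eq_one_left (by rw [mul_comm]; exact h1.symm)

/-! ### The reset process: second moments and ergodic averages. -/

section Reset

variable {D : Set E} {x g : E → ℝ}

theorem measurable_resetSum_past (hD : MeasurableSet D) (hx : Measurable x) (n : ℕ) :
    Measurable[past W n] (fun ω => resetSum D x (fun k => W k ω) n) := by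
  induction n with
  | zero => exact measurable_const
  | succ n ih =>
    have h1 : Measurable[past W (n + 1)] (W n) := measurable_past _ _ n.lt_succ_self
    exact (Measurable.ite (h1 hD) measurable_const (ih.mono (past_mono n.le_succ) le_rfl)).add
      (hx.comp h1)

theorem measurable_resetSum (hW : ∀ n, Measurable (W n)) (hD : MeasurableSet D)
    (hx : Measurable x) (n : ℕ) :
    Measurable (fun ω => resetSum D x (fun k => W k ω) n) :=
  (measurable_resetSum_past hD hx n).mono (past_le hW n) le_rfl

theorem memLp_resetSum (hW : ∀ n, Measurable (W n)) (hl : ∀ n, P.map (W n) = κ)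
    (hD : MeasurableSet D) (hx : Measurable x) (hx2 : MemLp x 2 κ) (n : ℕ) :
    MemLp (fun ω => resetSum D x (fun k => W k ω) n) 2 P := by
  induction n with
  | zero => exact MemLp.zero
  | succ n ih =>
    refine MemLp.add ?_ (memLp_comp_law hW hl n hx2)
    refine ih.mono ?_ (ae_of_all _ fun ω => ?_)
    · exact (Measurable.ite (hW n hD) measurable_const
        (measurable_resetSum hW hD hx n)).aestronglyMeasurable
    · dsimp only
      split_ifs <;> simp

/-- The reset process is bounded in `L²`. -/
theorem exists_integral_sq_resetSum_le (hW : ∀ n, Measurable (W n)) (hi : iIndepFun W P)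
    (hl : ∀ n, P.map (W n) = κ) (hD : MeasurableSet D) (h0 : 0 < κ.real D) (hx : Measurable x)
    (hx2 : MemLp x 2 κ) :
    ∃ C, ∀ n, ∫ ω, resetSum D x (fun k => W k ω) n ^ 2 ∂P ≤ C := by
  have : IsProbabilityMeasure κ := by
    rw [← hl 0]; exact Measure.isProbabilityMeasure_map (hW 0).aemeasurable
  set p := κ.real D with hp
  have hp1 : p ≤ 1 := measureReal_le_one
  set b := ∫ e, x e ^ 2 ∂κ with hb
  have hb0 : 0 ≤ b := integral_nonneg fun _ => sq_nonneg _
  -- The constant is the fixed point of C = (1+p)(1-p)C + (1+1/p)b. This recursion comes from (Z+x)²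
  -- ≤ (1+p)Z² + (1+1/p)x² and the survival probability 1-p of Z.
  refine ⟨(1 + 1 / p) * b / p ^ 2, fun n => ?_⟩
  induction n with
  | zero => simp only [resetSum]; simp; positivity
  | succ n ih =>
    set Z : Ω → ℝ := fun ω => resetSum D x (fun k => W k ω) n with hZ
    have hZ2 : Integrable (fun ω => Z ω ^ 2) P := (memLp_resetSum hW hl hD hx hx2 n).integrable_sq
    have hxi : Integrable (fun ω => x (W n ω) ^ 2) P := (memLp_comp_law hW hl n hx2).integrable_sq
    have hind : Integrable (fun ω => Z ω ^ 2 * Dᶜ.indicator (1 : E → ℝ) (W n ω)) P := by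
      refine hZ2.mono ?_ (ae_of_all _ fun ω => ?_)
      · exact (((measurable_resetSum hW hD hx n).pow_const 2).mul
          ((measurable_one.indicator hD.compl).comp (hW n))).aestronglyMeasurable
      · rw [norm_mul]
        refine mul_le_of_le_one_right (norm_nonneg _) ?_
        by_cases h : W n ω ∈ D <;> simp [h]
    have h1 : ∫ ω, resetSum D x (fun k => W k ω) (n + 1) ^ 2 ∂P ≤
        ∫ ω, ((1 + p) * (Z ω ^ 2 * Dᶜ.indicator (1 : E → ℝ) (W n ω)) +
          (1 + 1 / p) * x (W n ω) ^ 2) ∂P := by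
      refine integral_mono (memLp_resetSum hW hl hD hx hx2 (n + 1)).integrable_sq
        ((hind.const_mul _).add (hxi.const_mul _)) fun ω => ?_
      simp only [resetSum]
      by_cases h : W n ω ∈ D
      · simp only [h, if_true, zero_add, Set.mem_compl_iff, not_true_eq_false, not_false_eq_true,
          Set.indicator_of_notMem, mul_zero]
        have : (1 + 1 / p) * x (W n ω) ^ 2 - x (W n ω) ^ 2 = 1 / p * x (W n ω) ^ 2 := by ring
        have h3 : 0 ≤ 1 / p * x (W n ω) ^ 2 := by positivity
        linarith
      · simp only [h, if_false, Set.mem_compl_iff, not_false_eq_true, Set.indicator_of_mem,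
          Pi.one_apply, mul_one]
        change (Z ω + x (W n ω)) ^ 2 ≤ _
        have h3 : (1 + p) * Z ω ^ 2 + (1 + 1 / p) * x (W n ω) ^ 2 - (Z ω + x (W n ω)) ^ 2 =
            1 / p * (p * Z ω - x (W n ω)) ^ 2 := by field_simp; ring
        have h4 : 0 ≤ 1 / p * (p * Z ω - x (W n ω)) ^ 2 := by positivity
        linarith
    refine h1.trans ?_
    rw [integral_add (hind.const_mul _) (hxi.const_mul _), integral_const_mul, integral_const_mul,
      integral_comp_law hW hl n (hx.pow_const 2), ← hb]
    have h2 : ∫ ω, Z ω ^ 2 * Dᶜ.indicator (1 : E → ℝ) (W n ω) ∂P =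
        (∫ ω, Z ω ^ 2 ∂P) * (1 - p) := by
      rw [IndepFun.integral_fun_mul_eq_mul_integral
        (indepFun_past hW hi ((measurable_resetSum_past hD hx n).pow_const 2)
          (measurable_one.indicator hD.compl)) hZ2.1
        ((measurable_one.indicator hD.compl).comp (hW n)).aestronglyMeasurable,
        integral_comp_law hW hl n (f := Dᶜ.indicator 1) (measurable_one.indicator hD.compl),
        integral_indicator_one hD.compl, probReal_compl_eq_one_sub hD]
    rw [h2]
    have h3 : (1 + p) * ((∫ ω, Z ω ^ 2 ∂P) * (1 - p)) ≤
        (1 + p) * (((1 + 1 / p) * b / p ^ 2) * (1 - p)) := by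
      have : 0 ≤ 1 - p := by linarith
      gcongr
    refine (add_le_add_left h3 _).trans (le_of_eq ?_)
    field_simp
    ring

/-- The products are orthogonal: for m < n, the m-th product and Z_n belong to the past of n, while
`g (W n)` is centred and independent of that past. -/
theorem ae_tendsto_avg_resetSum_mul_centered (hW : ∀ n, Measurable (W n)) (hi : iIndepFun W P)
    (hl : ∀ n, P.map (W n) = κ) (hD : MeasurableSet D) (h0 : 0 < κ.real D) (hx : Measurable x)
    (hx2 : MemLp x 2 κ) (hg : Measurable g) (hg2 : MemLp g 2 κ) (hg0 : ∫ e, g e ∂κ = 0) :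
    ∀ᵐ ω ∂P, Tendsto (fun N : ℕ => (∑ n ∈ Finset.range N,
      resetSum D x (fun k => W k ω) n * g (W n ω)) / N) atTop (𝓝 0) := by
  obtain ⟨C, hC⟩ := exists_integral_sq_resetSum_le hW hi hl hD h0 hx hx2
  set Z : ℕ → Ω → ℝ := fun n ω => resetSum D x (fun k => W k ω) n with hZ
  have hZm : ∀ n, Measurable (Z n) := measurable_resetSum hW hD hx
  have hZL : ∀ n, MemLp (Z n) 2 P := memLp_resetSum hW hl hD hx hx2
  have hgL : ∀ n, MemLp (fun ω => g (W n ω)) 2 P := fun n => memLp_comp_law hW hl n hg2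
  have hsq : ∀ n, IndepFun (fun ω => Z n ω ^ 2) (fun ω => g (W n ω) ^ 2) P := fun n =>
    indepFun_past hW hi ((measurable_resetSum_past hD hx n).pow_const 2) (hg.pow_const 2)
  have hprod : ∀ n, MemLp (fun ω => Z n ω * g (W n ω)) 2 P := fun n => by
    have hm : AEStronglyMeasurable (fun ω => Z n ω * g (W n ω)) P :=
      ((hZm n).mul (hg.comp (hW n))).aestronglyMeasurable
    rw [memLp_two_iff_integrable_sq hm]
    simp_rw [mul_pow]
    exact (hsq n).integrable_mul (hZL n).integrable_sq (hgL n).integrable_sq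
  refine ae_tendsto_avg_of_orthogonal (C := C * ∫ e, g e ^ 2 ∂κ) hprod (fun n => ?_) ?_
  · simp_rw [mul_pow]
    rw [(hsq n).integral_fun_mul_eq_mul_integral (hZL n).integrable_sq.1 (hgL n).integrable_sq.1,
      integral_comp_law hW hl n (hg.pow_const 2)]
    exact mul_le_mul_of_nonneg_right (hC n) (integral_nonneg fun _ => sq_nonneg _)
  · intro m n hmn
    have h1 : Measurable[past W n] fun ω => Z m ω * g (W m ω) * Z n ω := by
      refine Measurable.mul (Measurable.mul ?_ (hg.comp (measurable_past n m hmn)))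
        (measurable_resetSum_past hD hx n)
      exact (measurable_resetSum_past hD hx m).mono (past_mono hmn.le) le_rfl
    have h2 := (indepFun_past hW hi h1 hg).integral_fun_mul_eq_mul_integral
      (h1.mono (past_le hW n) le_rfl).aestronglyMeasurable
      (hg.comp (hW n)).aestronglyMeasurable
    simp_rw [← mul_assoc]
    rw [h2, integral_comp_law hW hl n hg, hg0, mul_zero]

/-- Ergodic average of the reset process, weighted by a function of the next step. -/
theorem ae_tendsto_avg_resetSum_mul (hW : ∀ n, Measurable (W n)) (hi : iIndepFun W P)
    (hl : ∀ n, P.map (W n) = κ) (hD : MeasurableSet D) (h0 : 0 < κ.real D) (hx : Measurable x)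
    (hx2 : MemLp x 2 κ) (hg : Measurable g) (hg2 : MemLp g 2 κ) :
    ∀ᵐ ω ∂P, Tendsto (fun N : ℕ => (∑ n ∈ Finset.range N,
      resetSum D x (fun k => W k ω) n * g (W n ω)) / N) atTop
      (𝓝 ((∫ e, g e ∂κ) * (∫ e, x e ∂κ) / κ.real D)) := by
  have : IsProbabilityMeasure κ := by
    rw [← hl 0]; exact Measure.isProbabilityMeasure_map (hW 0).aemeasurable
  have hxi : Integrable x κ := hx2.integrable one_le_two
  have hgi : Integrable g κ := hg2.integrable one_le_two
  have hDm : Measurable (D.indicator (1 : E → ℝ)) := measurable_one.indicator hD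
  have hDL : MemLp (D.indicator (1 : E → ℝ)) 2 κ := (memLp_const (1 : ℝ)).indicator hD
  have hDi : Integrable (D.indicator (1 : E → ℝ)) κ := hDL.integrable one_le_two
  set p := κ.real D with hp
  obtain ⟨C, hC⟩ := exists_integral_sq_resetSum_le hW hi hl hD h0 hx hx2
  have hC0 : 0 ≤ C := (integral_nonneg fun ω => sq_nonneg _).trans (hC 0)
  -- Squared, because the second moments C/N² are summable while the first moments need not be.
  have hZ0 : ∀ᵐ ω ∂P, Tendsto (fun N : ℕ => (resetSum D x (fun k => W k ω) N / N) ^ 2) atTop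
      (𝓝 0) := by
    refine ae_tendsto_zero_of_summable_integral (c := fun N => C * (1 / (N : ℝ) ^ 2))
      (fun N => ?_) (fun N ω => sq_nonneg _)
      ((Real.summable_one_div_nat_pow.2 one_lt_two).mul_left _) fun N => ?_
    · simpa [div_pow] using (memLp_resetSum hW hl hD hx hx2 N).integrable_sq.div_const ((N : ℝ) ^ 2)
    · simp_rw [div_pow]
      rw [integral_div, mul_one_div]
      exact div_le_div_of_nonneg_right (hC N) (by positivity)
  have hA := ae_tendsto_avg_resetSum_mul_centered hW hi hl hD h0 hx hx2
    (hg.sub_const (∫ e, g e ∂κ)) (hg2.sub (memLp_const (∫ e, g e ∂κ)))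
    (by simp [integral_sub hgi (integrable_const _)])
  have hB := ae_tendsto_avg_resetSum_mul_centered hW hi hl hD h0 hx hx2
    (hDm.sub_const p) (hDL.sub (memLp_const p))
    (by simp [integral_sub hDi (integrable_const _), integral_indicator_one hD, hp])
  classical
  filter_upwards [hZ0, hA, hB, ae_tendsto_avg_of_iid hW hi hl hx hxi] with ω h1 h2 h3 h4
  set Z := resetSum D x (fun k => W k ω) with hZ
  have h1' : Tendsto (fun N : ℕ => Z N / N) atTop (𝓝 0) := by
    have := (Real.continuous_sqrt.tendsto 0).comp h1
    rw [Real.sqrt_zero] at this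
    rw [tendsto_zero_iff_abs_tendsto_zero]
    simpa [Function.comp_def, Real.sqrt_sq_eq_abs] using this
  -- Summing the recursion Z_{n+1} - Z_n = x(W_n) - 1_D(W_n) Z_n expresses the average of Z through
  -- sums whose averages are already known; this identifies the limit E[x]/p.
  have hrec : ∀ N, ∑ n ∈ Finset.range N, Z n * (D.indicator (1 : E → ℝ) (W n ω) - p) =
      ∑ n ∈ Finset.range N, x (W n ω) - Z N - p * ∑ n ∈ Finset.range N, Z n := by
    intro N
    induction N with
    | zero => simp [hZ, resetSum]
    | succ N ih =>
      rw [Finset.sum_range_succ, ih, Finset.sum_range_succ, Finset.sum_range_succ]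
      have : Z (N + 1) = (if W N ω ∈ D then 0 else Z N) + x (W N ω) := rfl
      rw [this]
      by_cases h : W N ω ∈ D <;> simp [h] <;> ring
  have h5 : Tendsto (fun N : ℕ => (∑ n ∈ Finset.range N, Z n) / N) atTop
      (𝓝 ((∫ e, x e ∂κ) / p)) := by
    have := ((h4.sub h1').sub h3).div_const p
    rw [sub_zero, sub_zero] at this
    refine this.congr fun N => ?_
    rw [hrec N]
    field_simp
    ring
  have h6 := (h5.const_mul (∫ e, g e ∂κ)).add h2
  rw [add_zero, ← mul_div_assoc] at h6
  refine h6.congr fun N => ?_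
  simp_rw [mul_sub, Finset.sum_sub_distrib, ← Finset.sum_mul]
  ring

end Reset

end IIDSequence

/-! ### The exponential distribution: memorylessness and moments. -/

section Exponential

variable {r : ℝ} [hr : Fact (0 < r)]

instance : IsProbabilityMeasure (expMeasure r) := isProbabilityMeasure_expMeasure hr.out

theorem measurable_exponentialPDF : Measurable (exponentialPDF r) :=
  (measurable_exponentialPDFReal r).ennreal_ofReal

theorem lintegral_expMeasure {g : ℝ → ENNReal} (hg : Measurable g) :
    ∫⁻ x, g x ∂(expMeasure r) = ∫⁻ x, exponentialPDF r x * g x := by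
  change ∫⁻ x, g x ∂(volume.withDensity (exponentialPDF r)) = _
  rw [lintegral_withDensity_eq_lintegral_mul _ measurable_exponentialPDF hg]
  rfl

theorem ae_pos_expMeasure : ∀ᵐ x ∂(expMeasure r), 0 < x := by
  change ∀ᵐ x ∂(volume.withDensity (exponentialPDF r)), 0 < x
  rw [ae_withDensity_iff measurable_exponentialPDF]
  filter_upwards [measure_eq_zero_iff_ae_notMem.1 (Real.volume_singleton (a := 0))] with x hx h
  by_contra h0
  exact h (exponentialPDF_of_neg (lt_of_le_of_ne (not_lt.1 h0) hx))

/-- The memoryless property of the exponential distribution. -/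
theorem lintegral_expMeasure_memoryless {w : ℝ} (hw : 0 ≤ w) {g : ℝ → ENNReal}
    (hg : Measurable g) :
    ∫⁻ x, (if w < x then g (x - w) else 0) ∂(expMeasure r) =
      ENNReal.ofReal (Real.exp (-r * w)) * ∫⁻ x, g x ∂(expMeasure r) := by
  have hm : Measurable fun x => if w < x then g (x - w) else 0 :=
    Measurable.ite measurableSet_Ioi (by fun_prop) measurable_const
  rw [lintegral_expMeasure hm, lintegral_expMeasure hg,
    ← lintegral_const_mul _ (f := fun x => exponentialPDF r x * g x)
      (measurable_exponentialPDF.mul hg),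
    ← lintegral_add_right_eq_self (fun x => exponentialPDF r x * _) w]
  refine lintegral_congr_ae ?_
  filter_upwards [measure_eq_zero_iff_ae_notMem.1 (Real.volume_singleton (a := 0))] with x hx
  rcases lt_or_gt_of_ne hx with h | h
  · rw [if_neg (by linarith), exponentialPDF_of_neg h]
    simp
  · rw [if_pos (by linarith), add_sub_cancel_right, exponentialPDF_of_nonneg h.le,
      exponentialPDF_of_nonneg (by linarith), ← mul_assoc,
      ← ENNReal.ofReal_mul (Real.exp_pos _).le]
    congr 2
    rw [show -(r * (x + w)) = -r * w + -(r * x) by ring, Real.exp_add]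
    ring

theorem integral_pow_expMeasure (k : ℕ) :
    ∫ x, x ^ k ∂(expMeasure r) = k.factorial / r ^ k := by
  have hr0 : 0 < r := hr.out
  change ∫ x, x ^ k ∂(volume.withDensity (exponentialPDF r)) = _
  rw [integral_withDensity_eq_integral_toReal_smul measurable_exponentialPDF
    (ae_of_all _ fun x => ENNReal.ofReal_lt_top)]
  have h1 : ∀ x : ℝ, (exponentialPDF r x).toReal • x ^ k =
      (Set.Ici (0 : ℝ)).indicator (fun x => r * (x ^ ((k + 1 : ℝ) - 1) * Real.exp (-(r * x)))) x := by
    intro x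
    by_cases hx : 0 ≤ x
    · rw [Set.indicator_of_mem (Set.mem_Ici.2 hx), exponentialPDF_of_nonneg hx,
        ENNReal.toReal_ofReal (by positivity), add_sub_cancel_right, Real.rpow_natCast, smul_eq_mul]
      ring
    · rw [Set.indicator_of_notMem (by simpa using hx), exponentialPDF_of_neg (not_le.1 hx)]
      simp
  simp_rw [h1]
  rw [integral_indicator measurableSet_Ici, integral_Ici_eq_integral_Ioi, integral_const_mul,
    Real.integral_rpow_mul_exp_neg_mul_Ioi (by positivity) hr0, Real.Gamma_nat_eq_factorial,
    ← Nat.cast_add_one, Real.rpow_natCast, div_pow, one_pow, pow_succ]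
  field_simp

theorem integrable_pow_expMeasure (k : ℕ) : Integrable (fun x => x ^ k) (expMeasure r) := by
  -- The integral of a non-integrable function is 0 by convention, whereas this moment has been
  -- computed to be nonzero.
  refine not_imp_comm.1 integral_undef ?_
  rw [integral_pow_expMeasure]
  have := hr.out
  positivity

theorem memLp_two_expMeasure : MemLp (fun x => x) 2 (expMeasure r) :=
  (memLp_two_iff_integrable_sq aestronglyMeasurable_id).2 (integrable_pow_expMeasure 2)

theorem integral_expMeasure : ∫ x, x ∂(expMeasure r) = 1 / r := by
  simpa using integral_pow_expMeasure (r := r) 1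

theorem integrable_expMeasure : Integrable (fun x => x) (expMeasure r) := by
  simpa using integrable_pow_expMeasure (r := r) 1

theorem lintegral_ofReal_expMeasure :
    ∫⁻ x, ENNReal.ofReal x ∂(expMeasure r) = ENNReal.ofReal (1 / r) := by
  rw [← integral_expMeasure, ofReal_integral_eq_lintegral_ofReal integrable_expMeasure]
  filter_upwards [ae_pos_expMeasure] with x hx using hx.le

end Exponential

/-! ### Marked Poisson sequences: restarting at a fixed level and void probabilities. -/

section MarkedSequence

/-- Sequence obtained by putting `a` in front of `y`. -/
def consSeq {α : Type*} (a : α) (y : ℕ → α) : ℕ → α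
  | 0 => a
  | n + 1 => y n

/-- The `n`-th point of the point process with the gaps `(y k).1`. -/
def pointTime (y : ℕ → ℝ × ℝ) (n : ℕ) : ℝ := ∑ k ∈ Finset.range (n + 1), (y k).1

/-- The number of points of `y` up to the level `w` is `m`, in the sense of first passage. -/
def Cross (w : ℝ) (m : ℕ) (y : ℕ → ℝ × ℝ) : Prop :=
  (∀ k < m, pointTime y k ≤ w) ∧ w < pointTime y m

/-- The marked sequence that remains after the level `w`, if the first `m` points are removed. -/
def residual (w : ℝ) (m : ℕ) (y : ℕ → ℝ × ℝ) : ℕ → ℝ × ℝ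
  | 0 => (pointTime y m - w, (y m).2)
  | k + 1 => y (m + (k + 1))

theorem measurable_consSeq {α : Type*} [MeasurableSpace α] :
    Measurable (fun p : α × (ℕ → α) => consSeq p.1 p.2) := by
  refine measurable_pi_iff.2 fun n => ?_
  cases n with
  | zero => exact measurable_fst
  | succ n => exact (measurable_pi_apply n).comp measurable_snd

@[fun_prop]
theorem measurable_pointTime (n : ℕ) : Measurable fun y => pointTime y n := by
  unfold pointTime; fun_prop

theorem measurableSet_cross (w : ℝ) (m : ℕ) : MeasurableSet {y | Cross w m y} := by
  have : {y | Cross w m y} = (⋂ k ∈ Finset.range m, {y | pointTime y k ≤ w}) ∩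
      {y | w < pointTime y m} := by
    ext y; simp [Cross]
  rw [this]
  exact (Finset.measurableSet_biInter _ fun k _ => measurableSet_le (by fun_prop) (by fun_prop)).inter
    (measurableSet_lt (by fun_prop) (by fun_prop))

theorem measurable_residual (w : ℝ) (m : ℕ) : Measurable (residual w m) := by
  refine measurable_pi_iff.2 fun k => ?_
  cases k with
  | zero =>
    exact ((measurable_pointTime m).sub_const w).prodMk (measurable_snd.comp (measurable_pi_apply m))
  | succ k => exact measurable_pi_apply _

theorem pointTime_zero (y : ℕ → ℝ × ℝ) : pointTime y 0 = (y 0).1 := by simp [pointTime]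

theorem pointTime_succ (y : ℕ → ℝ × ℝ) (n : ℕ) :
    pointTime y (n + 1) = pointTime y n + (y (n + 1)).1 := by
  simp [pointTime, Finset.sum_range_succ]

theorem pointTime_consSeq_succ (a : ℝ × ℝ) (y : ℕ → ℝ × ℝ) (n : ℕ) :
    pointTime (consSeq a y) (n + 1) = a.1 + pointTime y n := by
  rw [pointTime, Finset.sum_range_succ', add_comm]
  rfl

theorem pointTime_residual (w : ℝ) (m : ℕ) (y : ℕ → ℝ × ℝ) (k : ℕ) :
    pointTime (residual w m y) k = pointTime y (m + k) - w := by
  induction k with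
  | zero => rw [pointTime_zero]; rfl
  | succ k ih => rw [pointTime_succ, ih, ← add_assoc, pointTime_succ]; simp only [residual]; ring_nf

theorem residual_snd (w : ℝ) (m : ℕ) (y : ℕ → ℝ × ℝ) (k : ℕ) :
    (residual w m y k).2 = (y (m + k)).2 := by
  cases k <;> rfl

theorem cross_consSeq_succ (w : ℝ) (m : ℕ) (a : ℝ × ℝ) (y : ℕ → ℝ × ℝ) :
    Cross w (m + 1) (consSeq a y) ↔ a.1 ≤ w ∧ Cross (w - a.1) m y := by
  simp only [Cross, pointTime_consSeq_succ, ← and_assoc]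
  refine and_congr ⟨fun h => ⟨?_, fun k hk => ?_⟩, fun h k hk => ?_⟩ (by constructor <;> intro h <;> linarith)
  · simpa [pointTime_zero, consSeq] using h 0 m.succ_pos
  · have := h (k + 1) (by omega)
    rw [pointTime_consSeq_succ] at this
    linarith
  · cases k with
    | zero => simpa [pointTime_zero, consSeq] using h.1
    | succ k =>
      have := h.2 k (by omega)
      rw [pointTime_consSeq_succ]
      linarith

theorem residual_consSeq_succ (w : ℝ) (m : ℕ) (a : ℝ × ℝ) (y : ℕ → ℝ × ℝ) :
    residual w (m + 1) (consSeq a y) = residual (w - a.1) m y := by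
  funext k
  cases k with
  | zero => simp only [residual, pointTime_consSeq_succ]; refine Prod.ext ?_ rfl; simp; ring
  | succ k =>
    simp only [residual]
    rw [show m + 1 + (k + 1) = (m + (k + 1)) + 1 by ring]
    rfl

/-- The law of the sequence of (gap, mark) pairs of a Poisson process of rate `r` with independent
marks of law `σ`. -/
noncomputable def seqLaw (r : ℝ) (σ : Measure ℝ) : Measure (ℕ → ℝ × ℝ) :=
  Measure.infinitePi fun _ => (expMeasure r).prod σ

variable {r : ℝ} [hr : Fact (0 < r)] {σ : Measure ℝ} [IsProbabilityMeasure σ]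

instance : IsProbabilityMeasure (seqLaw r σ) := by unfold seqLaw; infer_instance

theorem map_consSeq_infinitePi {α : Type*} [MeasurableSpace α] (μ : Measure α)
    [IsProbabilityMeasure μ] :
    (μ.prod (Measure.infinitePi fun _ : ℕ => μ)).map (fun p => consSeq p.1 p.2) =
      Measure.infinitePi fun _ : ℕ => μ := by
  classical
  refine Measure.eq_infinitePi _ fun s t ht => ?_
  obtain ⟨N, hN⟩ := s.exists_nat_subset_range
  -- Padding with the whole space turns the finite index set into an initial segment, from which
  -- index 0 can be split off.
  set t' : ℕ → Set α := fun n => if n ∈ s then t n else Set.univ with ht'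
  have ht'm : ∀ n, MeasurableSet (t' n) := fun n => by
    simp only [ht']; split_ifs <;> [exact ht n; exact .univ]
  have h1 : (s : Set ℕ).pi t = (Finset.range (N + 1) : Set ℕ).pi t' := by
    ext y
    simp only [Set.mem_pi, Finset.mem_coe, ht', Finset.mem_range]
    refine ⟨fun h n _ => ?_, fun h n hn => ?_⟩
    · split_ifs with hn
      · exact h n hn
      · trivial
    · have := h n ((Finset.mem_range.1 (hN hn)).trans N.lt_succ_self)
      rwa [if_pos hn] at this
  have h2 : ∏ n ∈ s, μ (t n) = ∏ n ∈ Finset.range (N + 1), μ (t' n) := by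
    have hs : s ⊆ Finset.range (N + 1) := hN.trans (Finset.range_subset_range.2 N.le_succ)
    rw [← Finset.prod_subset hs fun n _ hn => by simp [ht', hn]]
    exact Finset.prod_congr rfl fun n hn => by simp [ht', hn]
  have h3 : (fun p : α × (ℕ → α) => consSeq p.1 p.2) ⁻¹' ((Finset.range (N + 1) : Set ℕ).pi t') =
      t' 0 ×ˢ ((Finset.range N : Set ℕ).pi fun n => t' (n + 1)) := by
    ext ⟨a, y⟩
    simp only [Set.mem_preimage, Set.mem_pi, Finset.mem_coe, Finset.mem_range, Set.mem_prod]
    refine ⟨fun h => ⟨h 0 N.succ_pos, fun n hn => h (n + 1) (by omega)⟩, fun h n hn => ?_⟩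
    cases n with
    | zero => exact h.1
    | succ n => exact h.2 n (by omega)
  rw [h1, h2, Measure.map_apply measurable_consSeq
    (MeasurableSet.pi (Finset.countable_toSet _) fun n _ => ht'm n), h3, Measure.prod_prod,
    Measure.infinitePi_pi _ fun n _ => ht'm (n + 1), Finset.prod_range_succ', mul_comm]

/-- Conditioning on the first pair; it drives the induction on the crossing index. -/
theorem seqLaw_apply_consSeq {B : Set (ℕ → ℝ × ℝ)} (hB : MeasurableSet B) :
    seqLaw r σ B = ∫⁻ a, seqLaw r σ {y | consSeq a y ∈ B} ∂((expMeasure r).prod σ) := by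
  conv_lhs => rw [seqLaw, ← map_consSeq_infinitePi, Measure.map_apply measurable_consSeq hB,
    Measure.prod_apply (measurable_consSeq hB)]
  rfl

theorem measurable_seqLaw_consSeq {B : Set (ℕ → ℝ × ℝ)} (hB : MeasurableSet B) :
    Measurable fun a => seqLaw r σ {y | consSeq a y ∈ B} :=
  measurable_measure_prodMk_left (measurable_consSeq hB)

/-- With no point up to w, only the first gap is altered by passing to the residual sequence. For a
fixed mark and fixed later pairs this is the memoryless property of that gap. -/
theorem seqLaw_cross_zero_inter {w : ℝ} (hw : 0 ≤ w) {A : Set (ℕ → ℝ × ℝ)} (hA : MeasurableSet A) :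
    seqLaw r σ {y | Cross w 0 y ∧ residual w 0 y ∈ A} =
      ENNReal.ofReal (Real.exp (-r * w)) * seqLaw r σ A := by
  have hB : MeasurableSet {y | Cross w 0 y ∧ residual w 0 y ∈ A} :=
    (measurableSet_cross w 0).inter (measurable_residual w 0 hA)
  have h1 : ∀ (a : ℝ × ℝ) (y : ℕ → ℝ × ℝ), residual w 0 (consSeq a y) =
      consSeq (a.1 - w, a.2) y := by
    intro a y
    funext k
    cases k with
    | zero => simp [residual, consSeq, pointTime_zero]
    | succ k => simp [residual, consSeq]
  have h2 : ∀ (a : ℝ × ℝ) (y : ℕ → ℝ × ℝ), Cross w 0 (consSeq a y) ↔ w < a.1 := by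
    intro a y; simp [Cross, pointTime_zero, consSeq]
  have hA' := measurable_seqLaw_consSeq (r := r) (σ := σ) hA
  have h3 : ∀ a : ℝ × ℝ, seqLaw r σ {y | consSeq a y ∈ {y | Cross w 0 y ∧ residual w 0 y ∈ A}} =
      if w < a.1 then seqLaw r σ {y | consSeq (a.1 - w, a.2) y ∈ A} else 0 := by
    intro a
    split_ifs with h <;> simp [h1, h2, h]
  have hm : Measurable fun a : ℝ × ℝ =>
      if w < a.1 then seqLaw r σ {y | consSeq (a.1 - w, a.2) y ∈ A} else 0 :=
    Measurable.ite (measurableSet_lt measurable_const measurable_fst)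
      (hA'.comp ((measurable_fst.sub_const w).prodMk measurable_snd)) measurable_const
  rw [seqLaw_apply_consSeq hB, seqLaw_apply_consSeq hA]
  simp_rw [h3]
  rw [lintegral_prod_symm _ hm.aemeasurable, lintegral_prod_symm _ hA'.aemeasurable,
    ← lintegral_const_mul _ hA'.lintegral_prod_left']
  refine lintegral_congr fun s => ?_
  exact lintegral_expMeasure_memoryless hw
    (g := fun x => seqLaw r σ {y | consSeq (x, s) y ∈ A}) (hA'.comp (by fun_prop))

/-- The number of points up to the level `w` is independent of what comes after `w`, and the latter
has the law of the whole sequence. -/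
theorem seqLaw_cross_inter (m : ℕ) {w : ℝ} (hw : 0 ≤ w) {A : Set (ℕ → ℝ × ℝ)}
    (hA : MeasurableSet A) :
    seqLaw r σ {y | Cross w m y ∧ residual w m y ∈ A} =
      seqLaw r σ {y | Cross w m y} * seqLaw r σ A := by
  induction m generalizing w with
  | zero =>
    rw [seqLaw_cross_zero_inter hw hA]
    have := seqLaw_cross_zero_inter (r := r) (σ := σ) hw MeasurableSet.univ
    simp only [Set.mem_univ, and_true, measure_univ, mul_one] at this
    rw [this]
  | succ m ih =>
    have hB : MeasurableSet {y | Cross w (m + 1) y ∧ residual w (m + 1) y ∈ A} :=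
      (measurableSet_cross w _).inter (measurable_residual w _ hA)
    rw [seqLaw_apply_consSeq hB, seqLaw_apply_consSeq (measurableSet_cross w (m + 1)),
      ← lintegral_mul_const' _ _ (measure_ne_top _ _)]
    -- After a first gap a ≤ w, crossing w at index m+1 is crossing w - a at index m with the same
    -- residual. If a > w, both sides vanish.
    refine lintegral_congr fun a => ?_
    simp only [Set.mem_ofPred_eq, cross_consSeq_succ, residual_consSeq_succ]
    by_cases h : a.1 ≤ w
    · simpa [h] using ih (sub_nonneg.2 h)
    · simp [h]

/-- Positive gaps, nonnegative marks, and no accumulation of points. -/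
def GoodSeq (y : ℕ → ℝ × ℝ) : Prop :=
  (∀ n, 0 < (y n).1 ∧ 0 ≤ (y n).2) ∧ Tendsto (pointTime y) atTop atTop

theorem GoodSeq.strictMono {y : ℕ → ℝ × ℝ} (hy : GoodSeq y) : StrictMono (pointTime y) :=
  strictMono_nat_of_lt_succ fun n => by rw [pointTime_succ]; linarith [(hy.1 (n + 1)).1]

theorem GoodSeq.pos {y : ℕ → ℝ × ℝ} (hy : GoodSeq y) (n : ℕ) : 0 < pointTime y n :=
  ((hy.1 0).1.trans_eq (pointTime_zero y).symm).trans_le (hy.strictMono.monotone n.zero_le)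

theorem GoodSeq.exists_cross {y : ℕ → ℝ × ℝ} (hy : GoodSeq y) (w : ℝ) : ∃ m, Cross w m y := by
  classical
  have h : ∃ m, w < pointTime y m := (hy.2.eventually_gt_atTop w).exists
  exact ⟨Nat.find h, fun k hk => not_lt.1 (Nat.find_min h hk), Nat.find_spec h⟩

theorem Cross.unique {w : ℝ} {m n : ℕ} {y : ℕ → ℝ × ℝ} (hm : Cross w m y) (hn : Cross w n y) :
    m = n := by
  rcases lt_trichotomy m n with h | h | h
  · exact absurd (hn.1 m h) (not_le.2 hm.2)
  · exact h
  · exact absurd (hm.1 n h) (not_le.2 hn.2)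

theorem map_eval_seqLaw (n : ℕ) : (seqLaw r σ).map (fun y => y n) = (expMeasure r).prod σ :=
  Measure.infinitePi_map_eval _ n

theorem ae_tendsto_pointTime_div :
    ∀ᵐ y : ℕ → ℝ × ℝ ∂(seqLaw r σ),
      Tendsto (fun N : ℕ => (∑ n ∈ Finset.range N, (y n).1) / (N : ℝ)) atTop (𝓝 (1 / r)) := by
  have hi : iIndepFun (fun n (y : ℕ → ℝ × ℝ) => y n) (seqLaw r σ) :=
    iIndepFun_infinitePi (P := fun _ => (expMeasure r).prod σ) (X := fun _ a => a)
      fun _ => measurable_id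
  have h := ae_tendsto_avg_of_iid (fun n => measurable_pi_apply n) hi map_eval_seqLaw
    (f := fun a : ℝ × ℝ => a.1) measurable_fst
    (integrable_expMeasure.comp_fst σ)
  have h1 : ∫ a, a.1 ∂((expMeasure r).prod σ) = 1 / r := by
    rw [integral_fun_fst (fun x => x), integral_expMeasure, probReal_univ, one_smul]
  rwa [h1] at h

theorem ae_goodSeq (hσ : σ (Set.Iio 0) = 0) : ∀ᵐ y ∂(seqLaw r σ), GoodSeq y := by
  have h1 : ∀ᵐ a ∂((expMeasure r).prod σ), 0 < a.1 ∧ 0 ≤ a.2 := by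
    have h2 : ∀ᵐ s ∂σ, 0 ≤ s := by
      rw [ae_iff]; simpa [Set.Iio] using hσ
    filter_upwards [Measure.quasiMeasurePreserving_fst.ae ae_pos_expMeasure,
      Measure.quasiMeasurePreserving_snd.ae h2] with a h3 h4 using ⟨h3, h4⟩
  have h2 : ∀ᵐ y ∂(seqLaw r σ), ∀ n, 0 < (y n).1 ∧ 0 ≤ (y n).2 := by
    refine ae_all_iff.2 fun n => ?_
    have h3 : ∀ᵐ a ∂((seqLaw r σ).map fun y => y n), 0 < a.1 ∧ 0 ≤ a.2 := by
      rwa [map_eval_seqLaw]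
    exact ae_of_ae_map (measurable_pi_apply n).aemeasurable h3
  filter_upwards [h2, ae_tendsto_pointTime_div (r := r) (σ := σ)] with y h3 h4
  refine ⟨h3, ?_⟩
  have h5 : Tendsto (fun N : ℕ => ∑ n ∈ Finset.range N, (y n).1) atTop atTop := by
    refine (h4.pos_mul_atTop (one_div_pos.2 hr.out) tendsto_natCast_atTop_atTop).congr' ?_
    filter_upwards [eventually_gt_atTop 0] with N hN
    have : (N : ℝ) ≠ 0 := by positivity
    field_simp
  exact h5.comp (tendsto_add_atTop_nat 1)

open scoped Classical in
/-- The marked sequence seen from the level `w` on. -/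
noncomputable def shiftSeq (w : ℝ) (y : ℕ → ℝ × ℝ) : ℕ → ℝ × ℝ :=
  if h : ∃ m, Cross w m y then residual w h.choose y else y

theorem Cross.shiftSeq_eq {w : ℝ} {m : ℕ} {y : ℕ → ℝ × ℝ} (h : Cross w m y) :
    shiftSeq w y = residual w m y := by
  have h' : ∃ m, Cross w m y := ⟨m, h⟩
  rw [shiftSeq, dif_pos h', h'.choose_spec.unique h]

/-- `shiftSeq` is defined by choice, so its measurability is not visible; splitting by the crossing
index exhibits preimages as countable unions of measurable sets, plus a part on which no crossing
exists (a null set under `seqLaw`). -/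
theorem shiftSeq_preimage (w : ℝ) (A : Set (ℕ → ℝ × ℝ)) :
    shiftSeq w ⁻¹' A = (⋃ m, {y | Cross w m y ∧ residual w m y ∈ A}) ∪
      ((⋃ m, {y | Cross w m y})ᶜ ∩ A) := by
  ext y
  simp only [Set.mem_preimage, Set.mem_union, Set.mem_iUnion, Set.mem_ofPred_eq, Set.mem_inter_iff,
    Set.mem_compl_iff]
  by_cases h : ∃ m, Cross w m y
  · obtain ⟨m, hm⟩ := h
    rw [hm.shiftSeq_eq]
    refine ⟨fun h => Or.inl ⟨m, hm, h⟩, ?_⟩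
    rintro (⟨n, hn, h⟩ | ⟨h, -⟩)
    · rwa [hm.unique hn]
    · exact absurd ⟨m, hm⟩ h
  · rw [shiftSeq, dif_neg h]
    refine ⟨fun h' => Or.inr ⟨h, h'⟩, ?_⟩
    rintro (⟨n, hn, -⟩ | ⟨-, h⟩)
    · exact absurd ⟨n, hn⟩ h
    · exact h

/-- The restart property at a fixed time: for each crossing index the residual is independent of the
crossing and has the original law, and the crossing probabilities sum to 1 because almost surely the
level is crossed. -/
theorem measurePreserving_shiftSeq (hσ : σ (Set.Iio 0) = 0) {w : ℝ} (hw : 0 ≤ w) :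
    MeasurePreserving (shiftSeq w) (seqLaw r σ) (seqLaw r σ) := by
  have hU : MeasurableSet (⋃ m, {y | Cross w m y}) := .iUnion fun m => measurableSet_cross w m
  have hAm : ∀ {A : Set (ℕ → ℝ × ℝ)}, MeasurableSet A → ∀ m,
      MeasurableSet {y | Cross w m y ∧ residual w m y ∈ A} := fun hA m =>
    (measurableSet_cross w m).inter (measurable_residual w m hA)
  have hdisj : ∀ A : Set (ℕ → ℝ × ℝ), Pairwise (Function.onFun Disjoint
      fun m => {y | Cross w m y ∧ residual w m y ∈ A}) := fun A m n hmn =>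
    Set.disjoint_left.2 fun y hm hn => hmn (hm.1.unique hn.1)
  have hm : Measurable (shiftSeq w) := fun A hA => by
    rw [shiftSeq_preimage]
    exact (MeasurableSet.iUnion (hAm hA)).union (hU.compl.inter hA)
  have hnull : seqLaw r σ (⋃ m, {y | Cross w m y})ᶜ = 0 := by
    rw [measure_eq_zero_iff_ae_notMem]
    filter_upwards [ae_goodSeq hσ] with y hy h
    exact h (Set.mem_iUnion.2 (hy.exists_cross w))
  have key : ∀ {A : Set (ℕ → ℝ × ℝ)}, MeasurableSet A →
      seqLaw r σ (⋃ m, {y | Cross w m y ∧ residual w m y ∈ A}) =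
      (∑' m, seqLaw r σ {y | Cross w m y}) * seqLaw r σ A := fun hA => by
    rw [measure_iUnion (hdisj _) (hAm hA), ← ENNReal.tsum_mul_right]
    exact tsum_congr fun m => seqLaw_cross_inter m hw hA
  have hone : ∑' m, seqLaw r σ {y | Cross w m y} = 1 := by
    have h := key MeasurableSet.univ
    simp only [Set.mem_univ, and_true, measure_univ, mul_one] at h
    rw [← h]
    exact (prob_compl_eq_zero_iff hU).1 hnull
  refine ⟨hm, Measure.ext fun A hA => ?_⟩
  rw [Measure.map_apply hm hA, shiftSeq_preimage, measure_congr
    (union_ae_eq_left_of_ae_eq_empty (ae_eq_empty.2 ?_)), key hA, hone, one_mul]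
  exact measure_mono_null Set.inter_subset_left hnull

/-- Void probabilities of a Poisson process for consecutive intervals. -/
theorem seqLaw_forall_notMem_Ioc (hσ : σ (Set.Iio 0) = 0) (N : ℕ) {a b : ℕ → ℝ} (h0 : 0 ≤ a 0)
    (hab : ∀ n, a n ≤ b n) (hba : ∀ n, b n ≤ a (n + 1)) :
    seqLaw r σ {y | ∀ n < N, ∀ m, pointTime y m ∉ Set.Ioc (a n) (b n)} =
      ∏ n ∈ Finset.range N, ENNReal.ofReal (Real.exp (-r * (b n - a n))) := by
  have hE : ∀ (N : ℕ) (a b : ℕ → ℝ),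
      MeasurableSet {y | ∀ n < N, ∀ m, pointTime y m ∉ Set.Ioc (a n) (b n)} := by
    intro N a b
    simp only [Set.ofPred_forall]
    exact .iInter fun n => .iInter fun _ => .iInter fun m =>
      (measurable_pointTime m measurableSet_Ioc).compl
  induction N generalizing a b with
  | zero => simp
  | succ N ih =>
    have hmono : Monotone a := monotone_nat_of_le_succ fun n => (hab n).trans (hba n)
    have hd : 0 ≤ b 0 - a 0 := sub_nonneg.2 (hab 0)
    set E := {y : ℕ → ℝ × ℝ | ∀ n < N, ∀ m,
      pointTime y m ∉ Set.Ioc (a (n + 1) - b 0) (b (n + 1) - b 0)}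
    -- Restart at `a 0`. The first interval is empty exactly when the restarted process has no point
    -- up to `b 0 - a 0`; the residual beyond that level carries the remaining N intervals,
    -- translated by `b 0`.
    have h1 : {y | ∀ n < N + 1, ∀ m, pointTime y m ∉ Set.Ioc (a n) (b n)} =ᵐ[seqLaw r σ]
        shiftSeq (a 0) ⁻¹' {y | Cross (b 0 - a 0) 0 y ∧ residual (b 0 - a 0) 0 y ∈ E} := by
      have hg := (measurePreserving_shiftSeq (r := r) hσ h0).quasiMeasurePreserving.ae
        (ae_goodSeq (r := r) hσ)
      rw [eventuallyEq_set]
      filter_upwards [ae_goodSeq hσ, hg] with y hy hy'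
      obtain ⟨M, hM⟩ := hy.exists_cross (a 0)
      simp only [Set.mem_preimage, Set.mem_ofPred_eq, E, pointTime_residual, Cross, hM.shiftSeq_eq,
        Nat.not_lt_zero, IsEmpty.forall_iff, implies_true, true_and, add_zero, zero_add,
        Set.mem_Ioc, not_and, not_le]
      refine ⟨fun h => ⟨?_, fun n hn m h1 => ?_⟩, fun h n hn m h1 => ?_⟩
      · have := h 0 N.succ_pos M hM.2
        linarith
      · have := h (n + 1) (by omega) (M + m) (by linarith)
        linarith
      · have hMm : M ≤ m := by
          by_contra hlt
          exact absurd (hM.1 m (not_le.1 hlt)) (not_le.2 ((hmono n.zero_le).trans_lt h1))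
        obtain ⟨k, rfl⟩ := Nat.exists_eq_add_of_le hMm
        cases n with
        | zero =>
          have := hy.strictMono.monotone hMm
          linarith [h.1]
        | succ n =>
          have := h.2 n (by omega) k (by linarith)
          linarith
    have hF : MeasurableSet {y | Cross (b 0 - a 0) 0 y ∧ residual (b 0 - a 0) 0 y ∈ E} :=
      (measurableSet_cross _ _).inter (measurable_residual _ _ (hE N _ _))
    rw [measure_congr h1, (measurePreserving_shiftSeq hσ h0).measure_preimage
      hF.nullMeasurableSet,
      seqLaw_cross_zero_inter hd (hE N _ _), ih (a := fun n => a (n + 1) - b 0)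
        (b := fun n => b (n + 1) - b 0) (by simpa using hba 0) (fun n => by simpa using hab (n + 1))
        (fun n => by simpa using hba (n + 1)), Finset.prod_range_succ', mul_comm]
    simp

end MarkedSequence

/-! ### Deterministic analysis of sample paths. -/

section SamplePath

variable {ι : Type*}

/-- Interarrival time after the packet `(c, n)`, its service time, and whether it is delivered. -/
def step (x s : ι → ℕ → ℝ) (c : ι) (n : ℕ) : (ℝ × ℝ) × Prop :=
  ((x c (n + 1), s c n), Delivered x s c n)

/-- The steps at which the packet is delivered. -/
def deliveredSet : Set ((ℝ × ℝ) × Prop) := {e | e.2}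

/-- Sample paths on which the packets of source `c` are generated at increasing times without
accumulation, and infinitely many of them are delivered. -/
structure Regular (x s : ι → ℕ → ℝ) (c : ι) : Prop where
  pos : ∀ n, 0 < x c n
  nonneg : ∀ n, 0 ≤ s c n
  tendsto : Tendsto (arrivalTime x c) atTop atTop
  infinite : {n | Delivered x s c n}.Infinite

variable {x s : ι → ℕ → ℝ} {c : ι}

theorem step_mem_deliveredSet {n : ℕ} : step x s c n ∈ deliveredSet ↔ Delivered x s c n := Iff.rfl

theorem arrivalTime_zero : arrivalTime x c 0 = x c 0 := by simp [arrivalTime]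

theorem arrivalTime_succ (n : ℕ) : arrivalTime x c (n + 1) = arrivalTime x c n + x c (n + 1) := by
  simp [arrivalTime, Finset.sum_range_succ]

namespace Regular

variable (h : Regular x s c)
include h

theorem strictMono : StrictMono (arrivalTime x c) :=
  strictMono_nat_of_lt_succ fun n => by rw [arrivalTime_succ]; linarith [h.pos (n + 1)]

theorem delivery_lt {m n : ℕ} (hm : Delivered x s c m) (hmn : m < n) :
    arrivalTime x c m + s c m < arrivalTime x c n := hm c n (h.strictMono hmn)

theorem delivery_lt_delivery {m n : ℕ} (hm : Delivered x s c m) (hmn : m < n) :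
    arrivalTime x c m + s c m < arrivalTime x c n + s c n :=
  (h.delivery_lt hm hmn).trans_le (le_add_of_nonneg_right (h.nonneg n))

theorem delivered_nth (i : ℕ) : Delivered x s c (Nat.nth (Delivered x s c) i) :=
  Nat.nth_mem_of_infinite h.infinite i

theorem bddAbove_delivered (τ : ℝ) :
    BddAbove {n | Delivered x s c n ∧ arrivalTime x c n + s c n ≤ τ} := by
  obtain ⟨M, hM⟩ := (h.tendsto.eventually_gt_atTop τ).exists
  refine ⟨M, fun n hn => ?_⟩
  by_contra hlt
  linarith [h.strictMono (not_le.1 hlt), hn.2, h.nonneg n]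

/-- The most recently delivered packet at time `τ`, if there is one. -/
theorem none_or_exists_last (τ : ℝ) :
    (∀ n, Delivered x s c n → τ < arrivalTime x c n + s c n) ∨
    ∃ n, Delivered x s c n ∧ arrivalTime x c n + s c n ≤ τ ∧
      ∀ m, n < m → Delivered x s c m → τ < arrivalTime x c m + s c m := by
  by_cases hne : {n | Delivered x s c n ∧ arrivalTime x c n + s c n ≤ τ}.Nonempty
  · right
    have hmem := Nat.sSup_mem hne (h.bddAbove_delivered τ)
    refine ⟨_, hmem.1, hmem.2, fun m hm hd => ?_⟩
    by_contra hle
    exact absurd (le_csSup (h.bddAbove_delivered τ) ⟨hd, not_lt.1 hle⟩) (not_le.2 hm)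
  · left
    intro n hn
    by_contra hle
    exact hne ⟨n, hn, not_lt.1 hle⟩

theorem aoi_eq_of_none (u₀ : ℝ) {τ : ℝ}
    (hτ : ∀ n, Delivered x s c n → τ < arrivalTime x c n + s c n) : aoi x s u₀ c τ = τ - u₀ := by
  have : {i : ℕ | 1 ≤ i ∧ deliveryTime x s c i ≤ τ} = ∅ := by
    ext i
    simp only [Set.mem_ofPred_eq, Set.mem_empty_iff_false, iff_false, not_and, not_le]
    exact fun _ => hτ _ (h.delivered_nth _)
  -- `sSup ∅ = 0` in ℕ, and index 0 is the one carrying the initial stamp.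
  simp [aoi, lastReceived, this, genTime]

theorem aoi_eq_of_last (u₀ : ℝ) {τ : ℝ} {n : ℕ} (hn : Delivered x s c n)
    (hτ : arrivalTime x c n + s c n ≤ τ)
    (hl : ∀ m, n < m → Delivered x s c m → τ < arrivalTime x c m + s c m) :
    aoi x s u₀ c τ = τ - arrivalTime x c n := by
  classical
  have hnth : Nat.nth (Delivered x s c) (Nat.count (Delivered x s c) n) = n := Nat.nth_count hn
  -- Deliveries are numbered from 1 but `Nat.nth` and `Nat.count` from 0, hence the shift by one.
  have hg : IsGreatest {i : ℕ | 1 ≤ i ∧ deliveryTime x s c i ≤ τ}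
      (Nat.count (Delivered x s c) n + 1) := by
    refine ⟨⟨by omega, ?_⟩, fun i hi => ?_⟩
    · simpa [deliveryTime, deliveredIndex, hnth] using hτ
    · by_contra hlt
      have h1 : Nat.count (Delivered x s c) n < i - 1 := by omega
      have h2 := (Nat.nth_lt_nth h.infinite).2 h1
      rw [hnth] at h2
      exact absurd hi.2 (not_le.2 (hl _ h2 (h.delivered_nth _)))
  have hlast : lastReceived x s c τ = Nat.count (Delivered x s c) n + 1 := hg.csSup_eq
  rw [aoi, hlast, genTime, if_neg (by omega), deliveredIndex, Nat.add_sub_cancel, hnth]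

/-- Deliveries of one source occur in order of generation, so the freshest received stamp dominates
all others; the hypothesis on y makes the initial stamp harmless. In this form the event involves
only packets generated after τ - y. -/
theorem le_aoi_iff {u₀ τ y : ℝ} (hy : y ≤ τ - u₀) :
    y ≤ aoi x s u₀ c τ ↔
      ∀ n, Delivered x s c n → arrivalTime x c n + s c n ≤ τ → arrivalTime x c n ≤ τ - y := by
  rcases h.none_or_exists_last τ with h1 | ⟨n, hn, hτ, hl⟩
  · rw [h.aoi_eq_of_none u₀ h1]
    exact ⟨fun _ n hn hle => absurd hle (not_le.2 (h1 n hn)), fun _ => hy⟩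
  · rw [h.aoi_eq_of_last u₀ hn hτ hl]
    refine ⟨fun h1 m hm hle => ?_, fun h1 => by linarith [h1 n hn hτ]⟩
    have : m ≤ n := by
      by_contra hlt
      exact absurd hle (not_le.2 (hl m (not_le.1 hlt) hm))
    linarith [h.strictMono.monotone this]

theorem neg_abs_le_aoi (u₀ : ℝ) {τ : ℝ} (hτ : 0 ≤ τ) : -|u₀| ≤ aoi x s u₀ c τ := by
  rw [h.le_aoi_iff (by linarith [le_abs_self u₀])]
  intro n _ hle
  linarith [abs_nonneg u₀, h.nonneg n]

theorem lt_deliveryTime_one_iff (y : ℝ) :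
    y < deliveryTime x s c 1 ↔ ∀ n, Delivered x s c n → y < arrivalTime x c n + s c n := by
  refine ⟨fun hy n hn => hy.trans_le ?_, fun hy => hy _ (h.delivered_nth 0)⟩
  have h0 : deliveredIndex x s c 1 ≤ n := by
    rw [deliveredIndex, Nat.sub_self, Nat.nth_zero]
    exact Nat.sInf_le hn
  rcases h0.eq_or_lt with h1 | h1
  · rw [← h1]; rfl
  · exact (h.delivery_lt_delivery (h.delivered_nth 0) h1).le

/-! ### The time integral of the AoI -/

/-- The reset sum is the age found by packet N: gaps accumulate from the generation of the last
delivered packet before N. -/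
theorem resetSum_eq {n N : ℕ} (hn : Delivered x s c n) (hnN : n < N)
    (hl : ∀ m, n < m → m < N → ¬ Delivered x s c m) :
    resetSum deliveredSet (fun e => e.1.1) (step x s c) N =
      arrivalTime x c N - arrivalTime x c n := by
  induction N, hnN using Nat.le_induction with
  | base =>
    simp only [resetSum]
    rw [if_pos (step_mem_deliveredSet.2 hn), arrivalTime_succ]
    simp [step]
  | succ N hN ih =>
    simp only [resetSum]
    have hN' : step x s c N ∉ deliveredSet := hl N hN N.lt_succ_self
    rw [if_neg hN', ih fun m h1 h2 => hl m h1 (by omega),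
      arrivalTime_succ]
    simp only [step]
    ring

theorem exists_last_lt {N : ℕ} (hN : ∃ n < N, Delivered x s c n) :
    ∃ n < N, Delivered x s c n ∧ ∀ m, n < m → m < N → ¬ Delivered x s c m := by
  classical
  obtain ⟨n, hn, hd⟩ := hN
  refine ⟨Nat.findGreatest (Delivered x s c) (N - 1), ?_, ?_, fun m h1 h2 => ?_⟩
  · have := Nat.findGreatest_le (P := Delivered x s c) (N - 1)
    omega
  · exact Nat.findGreatest_spec (P := Delivered x s c) (m := n) (by omega) hd
  · exact Nat.findGreatest_is_greatest h1 (by omega)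

/-- Earlier delivered packets were received before packet N arrived, since it would have preempted
them, and later packets do not exist yet. Only packet N itself can change the age in this interval.
-/
theorem aoi_of_mem_Ico (u₀ : ℝ) {N : ℕ} (hN : ∃ n < N, Delivered x s c n) {τ : ℝ}
    (h1 : arrivalTime x c N ≤ τ) (h2 : τ < arrivalTime x c (N + 1)) :
    aoi x s u₀ c τ = τ - arrivalTime x c N +
      (open scoped Classical in if Delivered x s c N ∧ arrivalTime x c N + s c N ≤ τ then 0 else
        resetSum deliveredSet (fun e => e.1.1) (step x s c) N) := by
  classical
  have hlater : ∀ m, N < m → Delivered x s c m → τ < arrivalTime x c m + s c m := fun m hm _ => by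
    have := h.strictMono.monotone (Nat.succ_le_of_lt hm)
    rw [Nat.succ_eq_add_one] at this
    linarith [h.nonneg m]
  split_ifs with hd
  · rw [h.aoi_eq_of_last u₀ hd.1 hd.2 hlater, add_zero]
  · obtain ⟨n, hnN, hn, hl⟩ := h.exists_last_lt hN
    rw [h.resetSum_eq hn hnN hl, h.aoi_eq_of_last u₀ hn ((h.delivery_lt hn hnN).le.trans h1)]
    · ring
    · intro m hm hdm
      rcases lt_trichotomy m N with hmN | rfl | hmN
      · exact absurd hdm (hl m hm hmN)
      · exact not_le.1 fun hle => hd ⟨hdm, hle⟩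
      · exact hlater m hmN hdm

theorem bddAbove_received (τ : ℝ) : BddAbove {i : ℕ | 1 ≤ i ∧ deliveryTime x s c i ≤ τ} := by
  obtain ⟨M, hM⟩ := h.bddAbove_delivered τ
  refine ⟨M + 1, fun i hi => ?_⟩
  have h1 : Nat.nth (Delivered x s c) (i - 1) ≤ M := hM ⟨h.delivered_nth _, hi.2⟩
  have h2 : i - 1 ≤ Nat.nth (Delivered x s c) (i - 1) := (Nat.nth_strictMono h.infinite).le_apply
  omega

theorem monotone_lastReceived : Monotone (lastReceived x s c) := by
  intro τ τ' hττ
  rcases {i : ℕ | 1 ≤ i ∧ deliveryTime x s c i ≤ τ}.eq_empty_or_nonempty with h0 | h0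
  · simp [lastReceived, h0]
  · exact csSup_le_csSup (h.bddAbove_received τ') h0 fun i hi => ⟨hi.1, hi.2.trans hττ⟩

theorem intervalIntegrable_aoi (u₀ a b : ℝ) :
    IntervalIntegrable (fun τ => aoi x s u₀ c τ) volume a b := by
  refine (intervalIntegral.intervalIntegrable_id).sub ?_
  have hm : Measurable fun τ => genTime x s u₀ c (lastReceived x s c τ) :=
    (measurable_from_nat (f := genTime x s u₀ c)).comp h.monotone_lastReceived.measurable
  rw [intervalIntegrable_iff]
  refine Measure.integrableOn_of_bounded (M := ∑ i ∈ Finset.range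
    (lastReceived x s c (max a b) + 1), |genTime x s u₀ c i|) (by simp) hm.aestronglyMeasurable ?_
  refine (ae_restrict_iff' measurableSet_uIoc).2 (ae_of_all _ fun τ hτ => ?_)
  have h1 : lastReceived x s c τ ≤ lastReceived x s c (max a b) :=
    h.monotone_lastReceived hτ.2
  exact Finset.single_le_sum (f := fun i => |genTime x s u₀ c i|) (fun _ _ => abs_nonneg _)
    (Finset.mem_range.2 (Nat.lt_succ_of_le h1))

open scoped Classical in
/-- The area under the AoI curve between two successive generations of packets of source `c`. -/
theorem integral_aoi_step (u₀ : ℝ) {N : ℕ} (hN : ∃ n < N, Delivered x s c n) :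
    ∫ τ in arrivalTime x c N..arrivalTime x c (N + 1), aoi x s u₀ c τ =
      resetSum deliveredSet (fun e => e.1.1) (step x s c) N *
        (if Delivered x s c N then s c N else x c (N + 1)) + x c (N + 1) ^ 2 / 2 := by
  set T := arrivalTime x c N with hT
  set Z := resetSum deliveredSet (fun e => e.1.1) (step x s c) N with hZ
  have hT1 : arrivalTime x c (N + 1) = T + x c (N + 1) := arrivalTime_succ N
  have hpos := h.pos (N + 1)
  -- The age is τ - T + Z until T + b and τ - T afterwards. For an undelivered packet b is the whole
  -- gap and the second piece is empty.
  set b := if Delivered x s c N then s c N else x c (N + 1) with hb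
  have hb0 : 0 ≤ b := by rw [hb]; split_ifs; exacts [h.nonneg N, hpos.le]
  have hbx : b ≤ x c (N + 1) := by
    rw [hb]; split_ifs with hd
    · have := h.delivery_lt hd N.lt_succ_self
      rw [Nat.succ_eq_add_one, hT1] at this
      linarith
    · exact le_rfl
  have hint : ∀ u v w : ℝ, ∫ τ in u..v, (τ - w) = ((v - w) ^ 2 - (u - w) ^ 2) / 2 := by
    intro u v w
    rw [intervalIntegral.integral_sub intervalIntegral.intervalIntegrable_id (by simp),
      integral_id, intervalIntegral.integral_const, smul_eq_mul]
    ring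
  have h1 : ∫ τ in T..T + b, aoi x s u₀ c τ = ∫ τ in T..T + b, (τ - (T - Z)) := by
    refine intervalIntegral.integral_congr_Ioo_of_le (by linarith) fun τ hτ => ?_
    have := h.aoi_of_mem_Ico u₀ hN (τ := τ) hτ.1.le (by rw [hT1]; linarith [hτ.2])
    rw [this, if_neg]
    · ring
    · rintro ⟨hd, hle⟩
      rw [hb, if_pos hd] at hτ
      linarith [hτ.2]
  have h2 : ∫ τ in T + b..T + x c (N + 1), aoi x s u₀ c τ =
      ∫ τ in T + b..T + x c (N + 1), (τ - T) := by
    refine intervalIntegral.integral_congr_Ioo_of_le (by linarith) fun τ hτ => ?_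
    have := h.aoi_of_mem_Ico u₀ hN (τ := τ) (by linarith [hτ.1]) (by rw [hT1]; linarith [hτ.2])
    rw [this, if_pos, add_zero]
    by_cases hd : Delivered x s c N
    · rw [hb, if_pos hd] at hτ
      exact ⟨hd, hτ.1.le⟩
    · rw [hb, if_neg hd] at hτ
      linarith [hτ.1, hτ.2]
  rw [hT1, ← intervalIntegral.integral_add_adjacent_intervals (h.intervalIntegrable_aoi u₀ _ (T + b))
    (h.intervalIntegrable_aoi u₀ _ _), h1, h2, hint, hint]
  ring

/-! ### Peaks and deliveries as sums over the packets -/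

theorem peakAoI_eq (j : ℕ) : peakAoI x s c (j + 2) =
    arrivalTime x c (Nat.nth (Delivered x s c) (j + 1)) + s c (Nat.nth (Delivered x s c) (j + 1)) -
      arrivalTime x c (Nat.nth (Delivered x s c) j) := by
  simp only [peakAoI, interdeparture, systemTime, deliveryTime, deliveredIndex]
  norm_num
  ring

theorem sum_Ico_gap {a b : ℕ} (hab : a ≤ b) :
    ∑ n ∈ Finset.Ico a b, x c (n + 1) = arrivalTime x c b - arrivalTime x c a := by
  induction b, hab using Nat.le_induction with
  | base => simp
  | succ b hb ih => rw [Finset.sum_Ico_succ_top hb, ih, arrivalTime_succ]; ring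

open scoped Classical in
-- The indices preceded by exactly j deliveries form a block ending at the j-th delivered packet.
-- All but the last contribute gaps, which telescope, and the last contributes its service time.
theorem tsum_count_eq {a j : ℕ} (hab : a ≤ Nat.nth (Delivered x s c) j)
    (ha : ∀ n, Nat.count (fun k => step x s c k ∈ deliveredSet) n = j ↔
      a ≤ n ∧ n ≤ Nat.nth (Delivered x s c) j) :
    ∑' n, (if Nat.count (fun k => step x s c k ∈ deliveredSet) n = j then
      (if (step x s c n).2 then ENNReal.ofReal (step x s c n).1.2
        else ENNReal.ofReal (step x s c n).1.1) else 0) =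
    ENNReal.ofReal (arrivalTime x c (Nat.nth (Delivered x s c) j) +
      s c (Nat.nth (Delivered x s c) j) - arrivalTime x c a) := by
  set b := Nat.nth (Delivered x s c) j with hb
  have hbD : Delivered x s c b := h.delivered_nth j
  rw [tsum_eq_sum (s := Finset.Ico a (b + 1)), Finset.sum_Ico_succ_top hab]
  · have h1 : ∀ n ∈ Finset.Ico a b, (if Nat.count (fun k => step x s c k ∈ deliveredSet) n = j then
        (if (step x s c n).2 then ENNReal.ofReal (step x s c n).1.2
          else ENNReal.ofReal (step x s c n).1.1) else 0) = ENNReal.ofReal (x c (n + 1)) := by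
      intro n hn
      rw [Finset.mem_Ico] at hn
      have hc := (ha n).2 ⟨hn.1, hn.2.le⟩
      rw [if_pos hc, if_neg]
      · rfl
      · intro hd
        have h2 : Nat.nth (Delivered x s c) j = n := by
          rw [← hc]
          exact Nat.nth_count (p := fun k => step x s c k ∈ deliveredSet) hd
        omega
    rw [Finset.sum_congr rfl h1, ← ENNReal.ofReal_sum_of_nonneg fun n _ => (h.pos _).le,
      h.sum_Ico_gap hab, if_pos ((ha b).2 ⟨hab, le_rfl⟩),
      if_pos (show (step x s c b).2 from hbD),
      show (step x s c b).1.2 = s c b from rfl,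
      ← ENNReal.ofReal_add (sub_nonneg.2 (h.strictMono.monotone hab)) (h.nonneg b)]
    congr 1
    ring
  · intro n hn
    rw [if_neg]
    rw [ha n]
    simp only [Finset.mem_Ico, not_and, not_lt] at hn ⊢
    intro h1
    have := hn h1
    omega

open scoped Classical in
theorem count_eq_iff (j n : ℕ) : Nat.count (fun k => step x s c k ∈ deliveredSet) n = j + 1 ↔
    Nat.nth (Delivered x s c) j + 1 ≤ n ∧ n ≤ Nat.nth (Delivered x s c) (j + 1) := by
  have h1 := Nat.count_le_iff_le_nth (p := fun k => step x s c k ∈ deliveredSet) h.infinite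
    (a := n) (b := j + 1)
  have h2 := Nat.count_le_iff_le_nth (p := fun k => step x s c k ∈ deliveredSet) h.infinite
    (a := n) (b := j)
  change _ ↔ n ≤ Nat.nth (Delivered x s c) (j + 1) at h1
  change _ ↔ n ≤ Nat.nth (Delivered x s c) j at h2
  omega

open scoped Classical in
theorem count_eq_zero_iff (n : ℕ) : Nat.count (fun k => step x s c k ∈ deliveredSet) n = 0 ↔
    0 ≤ n ∧ n ≤ Nat.nth (Delivered x s c) 0 := by
  have h1 := Nat.count_le_iff_le_nth (p := fun k => step x s c k ∈ deliveredSet) h.infinite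
    (a := n) (b := 0)
  change _ ↔ n ≤ Nat.nth (Delivered x s c) 0 at h1
  omega

open scoped Classical in
theorem ofReal_deliveryTime_one : ENNReal.ofReal (deliveryTime x s c 1) = ENNReal.ofReal (x c 0) +
    ∑' n, (if Nat.count (fun k => step x s c k ∈ deliveredSet) n = 0 then
      (if (step x s c n).2 then ENNReal.ofReal (step x s c n).1.2
        else ENNReal.ofReal (step x s c n).1.1) else 0) := by
  rw [h.tsum_count_eq (Nat.zero_le _) h.count_eq_zero_iff, ← ENNReal.ofReal_add (h.pos 0).le,
    arrivalTime_zero]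
  · congr 1
    simp only [deliveryTime, deliveredIndex]
    ring
  · linarith [h.strictMono.monotone (Nat.zero_le (Nat.nth (Delivered x s c) 0)),
      h.nonneg (Nat.nth (Delivered x s c) 0)]

open scoped Classical in
-- The first sum reduces to the gap after the earlier delivered packet, the second is the block from
-- the next packet to the following delivery. Both have the shape whose expectation
-- `lintegral_tsum_count` computes.
theorem ofReal_peakAoI (j : ℕ) : ENNReal.ofReal (peakAoI x s c (j + 2)) =
    ∑' n, (if Nat.count (fun k => step x s c k ∈ deliveredSet) n = j then
      (if (step x s c n).2 then ENNReal.ofReal (step x s c n).1.1 else 0) else 0) +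
    ∑' n, (if Nat.count (fun k => step x s c k ∈ deliveredSet) n = j + 1 then
      (if (step x s c n).2 then ENNReal.ofReal (step x s c n).1.2
        else ENNReal.ofReal (step x s c n).1.1) else 0) := by
  set a := Nat.nth (Delivered x s c) j with ha
  have hab : a + 1 ≤ Nat.nth (Delivered x s c) (j + 1) :=
    (Nat.nth_lt_nth h.infinite).2 j.lt_succ_self
  have haD : Delivered x s c a := h.delivered_nth j
  rw [h.tsum_count_eq hab (h.count_eq_iff j), tsum_eq_single a, if_pos,
    if_pos (show (step x s c a).2 from haD), ← ENNReal.ofReal_add, h.peakAoI_eq, arrivalTime_succ]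
  · congr 1
    simp only [step]
    ring
  · exact (h.pos _).le
  · linarith [h.strictMono.monotone hab, h.nonneg (Nat.nth (Delivered x s c) (j + 1))]
  · exact Nat.count_nth_of_infinite (p := fun k => step x s c k ∈ deliveredSet) h.infinite j
  · intro n hn
    split_ifs with hc hd
    · refine absurd ?_ hn
      rw [ha, ← hc]
      exact (Nat.nth_count (p := fun k => step x s c k ∈ deliveredSet) hd).symm
    · rfl
    · rfl

open scoped Classical in
theorem sum_range_nth (f : ℕ → ℝ) (n : ℕ) :
    ∑ k ∈ Finset.range (Nat.nth (Delivered x s c) n), (if Delivered x s c k then f k else 0) =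
      ∑ i ∈ Finset.range n, f (Nat.nth (Delivered x s c) i) := by
  induction n with
  | zero =>
    rw [Finset.sum_range_zero, Finset.sum_eq_zero]
    intro k hk
    rw [if_neg fun hd => ?_]
    rw [Finset.mem_range, Nat.nth_zero] at hk
    exact absurd (Nat.sInf_le hd) (not_le.2 hk)
  | succ n ih =>
    rw [Finset.sum_range_succ, ← ih, ← Finset.sum_filter, ← Finset.sum_filter,
      Nat.filter_range_nth_eq_insert_of_infinite h.infinite, Finset.sum_insert (by simp), add_comm]

open scoped Classical in
theorem sum_peakAoI (n : ℕ) : ∑ i ∈ Finset.range n, peakAoI x s c (i + 2) =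
    arrivalTime x c (Nat.nth (Delivered x s c) n) +
      ∑ k ∈ Finset.range (Nat.nth (Delivered x s c) (n + 1)),
        (if Delivered x s c k then s c k else 0) -
      (arrivalTime x c (Nat.nth (Delivered x s c) 0) + s c (Nat.nth (Delivered x s c) 0)) := by
  rw [h.sum_range_nth]
  induction n with
  | zero => simp
  | succ n ih =>
    rw [Finset.sum_range_succ, ih, h.peakAoI_eq, Finset.sum_range_succ _ (n + 1)]
    ring

end Regular

end SamplePath

/-! ### Independence of the pairs formed by a mark and the next gap. -/

section GapMarkPairs

variable {r : ℝ} [hr : Fact (0 < r)] {σ : Measure ℝ} [IsProbabilityMeasure σ]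

/-- The gap after the `n`-th point together with the mark of the `n`-th point. -/
def gapMark (n : ℕ) (y : ℕ → ℝ × ℝ) : ℝ × ℝ := ((y (n + 1)).1, (y n).2)

@[fun_prop]
theorem measurable_gapMark (n : ℕ) : Measurable (gapMark n) := by unfold gapMark; fun_prop

/-- The gap constraint of index n sits on coordinate n+1 and the mark constraint on coordinate n.
Gaps and marks are independent within each coordinate, so this offset does not spoil the product. -/
theorem seqLaw_gapMark_box (F : Finset ℕ) {A B : ℕ → Set ℝ} (hA : ∀ n, MeasurableSet (A n))
    (hB : ∀ n, MeasurableSet (B n)) :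
    seqLaw r σ (⋂ n ∈ F, gapMark n ⁻¹' (A n ×ˢ B n)) = ∏ n ∈ F, expMeasure r (A n) * σ (B n) := by
  classical
  obtain ⟨N, hN⟩ := F.exists_nat_subset_range
  set A' : ℕ → Set ℝ := fun n => if n ∈ F then A n else Set.univ with hA'
  set B' : ℕ → Set ℝ := fun n => if n ∈ F then B n else Set.univ with hB'
  have hAm : ∀ n, MeasurableSet (A' n) := fun n => by
    simp only [hA']; split_ifs <;> [exact hA n; exact .univ]
  have hBm : ∀ n, MeasurableSet (B' n) := fun n => by
    simp only [hB']; split_ifs <;> [exact hB n; exact .univ]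
  set A'' : ℕ → Set ℝ := fun n => Nat.casesOn n Set.univ A' with hA''
  have hAm' : ∀ n, MeasurableSet (A'' n) := fun n => by
    cases n <;> [exact .univ; exact hAm _]
  have h1 : (⋂ n ∈ F, gapMark n ⁻¹' (A n ×ˢ B n)) =
      (Finset.range (N + 1) : Set ℕ).pi fun n => A'' n ×ˢ B' n := by
    ext y
    simp only [Set.mem_iInter, Set.mem_preimage, gapMark, Set.mem_prod, Set.mem_pi,
      Finset.mem_coe, Finset.mem_range]
    refine ⟨fun h n _ => ⟨?_, ?_⟩, fun h n hn => ?_⟩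
    · cases n with
      | zero => trivial
      | succ n =>
        change _ ∈ A' n
        simp only [hA']
        split_ifs with hn
        exacts [(h n hn).1, trivial]
    · simp only [hB']
      split_ifs with hn
      exacts [(h n hn).2, trivial]
    · have hnN := Finset.mem_range.1 (hN hn)
      have h2 : (y (n + 1)).1 ∈ A' n := (h (n + 1) (by omega)).1
      have h3 := (h n (by omega)).2
      simp only [hA', hB', if_pos hn] at h2 h3
      exact ⟨h2, h3⟩
  have h2 : ∏ n ∈ F, expMeasure r (A n) * σ (B n) =
      ∏ n ∈ Finset.range N, expMeasure r (A' n) * σ (B' n) := by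
    rw [← Finset.prod_subset hN fun n _ hn => by simp [hA', hB', hn]]
    exact Finset.prod_congr rfl fun n hn => by simp [hA', hB', hn]
  have hBN : B' N = Set.univ := by
    simp only [hB']
    rw [if_neg]
    intro hn
    exact absurd (Finset.mem_range.1 (hN hn)) (lt_irrefl N)
  rw [h1, h2, seqLaw, Measure.infinitePi_pi _ fun n _ => (hAm' n).prod (hBm n)]
  simp_rw [Measure.prod_prod]
  rw [Finset.prod_mul_distrib, Finset.prod_mul_distrib, Finset.prod_range_succ',
    Finset.prod_range_succ (fun n => σ (B' n)), hBN, measure_univ, mul_one]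
  simp [hA'']

theorem map_gapMark_seqLaw (n : ℕ) :
    (seqLaw r σ).map (gapMark n) = (expMeasure r).prod σ := by
  refine (Measure.prod_eq fun s t hs ht => ?_).symm
  rw [Measure.map_apply (measurable_gapMark n) (hs.prod ht)]
  simpa using seqLaw_gapMark_box (r := r) (σ := σ) {n} (A := fun _ => s) (B := fun _ => t)
    (fun _ => hs) fun _ => ht

theorem iIndepFun_gapMark : iIndepFun gapMark (seqLaw r σ) := by
  have hgen : ∀ n : ℕ, MeasurableSpace.comap (gapMark n) inferInstance =
      MeasurableSpace.generateFrom (Set.preimage (gapMark n) ''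
        Set.image2 (· ×ˢ ·) {s : Set ℝ | MeasurableSet s} {t : Set ℝ | MeasurableSet t}) := by
    intro n
    rw [← MeasurableSpace.comap_generateFrom, generateFrom_prod]
  refine iIndepSets.iIndep (fun n => (measurable_gapMark n).comap_le) _ (fun n => ?_) hgen ?_
  · rintro _ ⟨s, hs, rfl⟩ _ ⟨t, ht, rfl⟩ hne
    refine ⟨s ∩ t, isPiSystem_prod s hs t ht ?_, rfl⟩
    obtain ⟨y, hy⟩ := hne
    exact ⟨gapMark n y, hy⟩
  · rw [iIndepSets_iff]
    intro F f hf
    have hf' : ∀ n ∈ F, ∃ A B : Set ℝ, MeasurableSet A ∧ MeasurableSet B ∧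
        f n = gapMark n ⁻¹' (A ×ˢ B) := by
      intro n hn
      obtain ⟨_, ⟨A, hA, B, hB, rfl⟩, h⟩ := hf n hn
      exact ⟨A, B, hA, hB, h.symm⟩
    classical
    choose! A B hA hB hfe using hf'
    set A' : ℕ → Set ℝ := fun n => if n ∈ F then A n else Set.univ with hA'
    set B' : ℕ → Set ℝ := fun n => if n ∈ F then B n else Set.univ with hB'
    have hAm : ∀ n, MeasurableSet (A' n) := fun n => by
      simp only [hA']; split_ifs with h <;> [exact hA n h; exact .univ]
    have hBm : ∀ n, MeasurableSet (B' n) := fun n => by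
      simp only [hB']; split_ifs with h <;> [exact hB n h; exact .univ]
    have hfe' : ∀ n ∈ F, f n = gapMark n ⁻¹' (A' n ×ˢ B' n) := fun n hn => by
      simp only [hA', hB', if_pos hn, hfe n hn]
    have h1 : (⋂ n ∈ F, f n) = ⋂ n ∈ F, gapMark n ⁻¹' (A' n ×ˢ B' n) :=
      Set.iInter₂_congr hfe'
    rw [h1, seqLaw_gapMark_box F hAm hBm]
    refine Finset.prod_congr rfl fun n hn => ?_
    rw [hfe' n hn]
    simpa using (seqLaw_gapMark_box (r := r) (σ := σ) {n} hAm hBm).symm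

end GapMarkPairs

/-! ### The canonical two-source space; the steps of source 1 are i.i.d. -/

section CanonicalSpace

/-- The space of pairs of marked sequences, one for each source. -/
abbrev Path : Type := (ℕ → ℝ × ℝ) × (ℕ → ℝ × ℝ)

/-- The interarrival times on the canonical space. -/
def gap (ω : Path) (c : Fin 2) (n : ℕ) : ℝ := (![ω.1, ω.2] c n).1

/-- The service times on the canonical space. -/
def svc (ω : Path) (c : Fin 2) (n : ℕ) : ℝ := (![ω.1, ω.2] c n).2

/-- The law of the input on the canonical space. -/
noncomputable def pathLaw (r₁ r₂ : ℝ) (σ : Measure ℝ) : Measure Path :=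
  (seqLaw r₁ σ).prod (seqLaw r₂ σ)

variable {r₁ r₂ : ℝ} [hr₁ : Fact (0 < r₁)] [hr₂ : Fact (0 < r₂)] {σ : Measure ℝ}
  [IsProbabilityMeasure σ]

instance : IsProbabilityMeasure (pathLaw r₁ r₂ σ) := by unfold pathLaw; infer_instance

theorem arrivalTime_gap_zero (ω : Path) (n : ℕ) : arrivalTime (gap ω) 0 n = pointTime ω.1 n := rfl

theorem arrivalTime_gap_one (ω : Path) (n : ℕ) : arrivalTime (gap ω) 1 n = pointTime ω.2 n := rfl

theorem svc_zero (ω : Path) (n : ℕ) : svc ω 0 n = (ω.1 n).2 := rfl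

theorem gap_zero (ω : Path) (n : ℕ) : gap ω 0 n = (ω.1 n).1 := rfl

/-- Among packets of the same source, only the next one can be the first to preempt. -/
theorem delivered_iff {ω : Path} (hω : GoodSeq ω.1) (n : ℕ) :
    Delivered (gap ω) (svc ω) 0 n ↔ (ω.1 n).2 < (ω.1 (n + 1)).1 ∧
      ∀ m, pointTime ω.2 m ∉ Set.Ioc (pointTime ω.1 n) (pointTime ω.1 n + (ω.1 n).2) := by
  rw [Delivered, Fin.forall_fin_two]
  simp only [arrivalTime_gap_zero, arrivalTime_gap_one, svc_zero]
  refine and_congr ⟨fun h => ?_, fun h m hm => ?_⟩ ?_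
  · have := h (n + 1) (hω.strictMono n.lt_succ_self)
    rw [pointTime_succ] at this
    linarith
  · have := hω.strictMono.monotone (Nat.succ_le_of_lt (hω.strictMono.lt_iff_lt.1 hm))
    rw [Nat.succ_eq_add_one, pointTime_succ] at this
    linarith
  · simp only [Set.mem_Ioc, not_and, not_le]

theorem measurable_arrivalTime_gap (c : Fin 2) (n : ℕ) :
    Measurable fun ω => arrivalTime (gap ω) c n := by
  fin_cases c
  · exact (measurable_pointTime n).comp measurable_fst
  · exact (measurable_pointTime n).comp measurable_snd

theorem measurable_svc_zero (n : ℕ) : Measurable fun ω => svc ω 0 n := by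
  simp only [svc_zero]; fun_prop

theorem measurableSet_delivered (n : ℕ) :
    MeasurableSet {ω : Path | Delivered (gap ω) (svc ω) 0 n} := by
  simp only [Delivered, Set.ofPred_forall]
  refine .iInter fun c => .iInter fun m => ?_
  have h1 := measurable_arrivalTime_gap 0 n
  have h2 := measurable_arrivalTime_gap c m
  exact (measurableSet_lt h1 h2).imp (measurableSet_lt (h1.add (measurable_svc_zero n)) h2)

theorem measurable_step (n : ℕ) :
    Measurable fun ω : Path => step (gap ω) (svc ω) 0 n := by
  refine Measurable.prodMk ((measurable_gapMark n).comp measurable_fst) ?_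
  exact measurableSet_setOfPred.1 (measurableSet_delivered n)

theorem ae_goodSeq_fst (hσ : σ (Set.Iio 0) = 0) : ∀ᵐ ω ∂(pathLaw r₁ r₂ σ), GoodSeq ω.1 :=
  Measure.quasiMeasurePreserving_fst.ae (ae_goodSeq hσ)

theorem ae_goodSeq_snd (hσ : σ (Set.Iio 0) = 0) : ∀ᵐ ω ∂(pathLaw r₁ r₂ σ), GoodSeq ω.2 :=
  Measure.quasiMeasurePreserving_snd.ae (ae_goodSeq hσ)

open scoped Classical in
/-- The conditional probability that a packet with gap `a.1` and service time `a.2` is delivered. -/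
noncomputable def deliveryProb (r₂ : ℝ) (a : ℝ × ℝ) : ENNReal :=
  if a.2 < a.1 then ENNReal.ofReal (Real.exp (-r₂ * a.2)) else 0

theorem measurable_deliveryProb : Measurable (deliveryProb r₂) :=
  Measurable.ite (measurableSet_lt measurable_snd measurable_fst) (by fun_prop) measurable_const

open scoped Classical in
/-- The weight of the event that the gap-mark pair is in `A` and, if `b`, the packet is
delivered. -/
noncomputable def stepWeight (r₂ : ℝ) (A : Set (ℝ × ℝ)) (b : Prop) (a : ℝ × ℝ) : ENNReal :=
  A.indicator (fun a => if b then deliveryProb r₂ a else 1) a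

theorem measurable_stepWeight {A : Set (ℝ × ℝ)} (hA : MeasurableSet A) (b : Prop) :
    Measurable (stepWeight r₂ A b) := by
  classical
  refine Measurable.indicator ?_ hA
  by_cases h : b
  · simpa [h] using measurable_deliveryProb
  · simp [h]

/-- The event that the step is in `A` and, if `b`, the packet is delivered. -/
def stepEvent (A : Set (ℝ × ℝ)) (b : Prop) : Set ((ℝ × ℝ) × Prop) := {e | e.1 ∈ A ∧ (b → e.2)}

theorem measurableSet_stepEvent {A : Set (ℝ × ℝ)} (hA : MeasurableSet A) (b : Prop) :
    MeasurableSet (stepEvent A b) :=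
  (measurable_fst hA).inter ((MeasurableSet.const b).imp (measurableSet_setOfPred.2 measurable_snd))

/-- Given source 1, the required deliveries are void events of source 2 on consecutive disjoint
intervals, so their conditional probability is a product over the packets. Each factor depends on
one gap-mark pair only, and these pairs are independent. -/
theorem pathLaw_steps (hσ : σ (Set.Iio 0) = 0) (F : Finset ℕ) {A : ℕ → Set (ℝ × ℝ)}
    (hA : ∀ n, MeasurableSet (A n)) (b : ℕ → Prop) :
    pathLaw r₁ r₂ σ (⋂ n ∈ F, (fun ω => step (gap ω) (svc ω) 0 n) ⁻¹' stepEvent (A n) (b n)) =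
      ∏ n ∈ F, ∫⁻ a, stepWeight r₂ (A n) (b n) a ∂((expMeasure r₁).prod σ) := by
  classical
  have hB : MeasurableSet
      (⋂ n ∈ F, (fun ω => step (gap ω) (svc ω) 0 n) ⁻¹' stepEvent (A n) (b n)) :=
    Finset.measurableSet_biInter _ fun n _ =>
      measurable_step n (measurableSet_stepEvent (hA n) (b n))
  have hmeas : ∀ n, Measurable fun y => stepWeight r₂ (A n) (b n) (gapMark n y) := fun n =>
    (measurable_stepWeight (hA n) _).comp (measurable_gapMark n)
  have hind : iIndepFun (fun n y => stepWeight r₂ (A n) (b n) (gapMark n y)) (seqLaw r₁ σ) :=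
    iIndepFun_gapMark.comp _ fun n => measurable_stepWeight (hA n) _
  have hprod : ∫⁻ y, ∏ n ∈ F, stepWeight r₂ (A n) (b n) (gapMark n y) ∂(seqLaw r₁ σ) =
      ∏ n ∈ F, ∫⁻ a, stepWeight r₂ (A n) (b n) a ∂((expMeasure r₁).prod σ) := by
    rw [lintegral_prod_eq_prod_lintegral_of_indepFun F _ hind hmeas]
    refine Finset.prod_congr rfl fun n _ => ?_
    rw [← map_gapMark_seqLaw (r := r₁) (σ := σ) n,
      lintegral_map (measurable_stepWeight (hA n) _) (measurable_gapMark n)]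
  rw [← hprod, pathLaw, Measure.prod_apply hB]
  refine lintegral_congr_ae ?_
  filter_upwards [ae_goodSeq hσ] with y hy
  -- If source 1 alone already violates a requirement, both sides are 0. Otherwise S_n < X_{n+1} for
  -- every required packet, which is what orders the intervals.
  by_cases hzero : ∃ n ∈ F, gapMark n y ∉ A n ∨ (b n ∧ ¬ (y n).2 < (y (n + 1)).1)
  · obtain ⟨n, hn, h⟩ := hzero
    rw [Finset.prod_eq_zero hn]
    · refine measure_mono_null (t := ∅) (fun z hz => ?_) measure_empty
      have h1 := Set.mem_iInter₂.1 hz n hn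
      rcases h with h | ⟨h2, h3⟩
      · exact h h1.1
      · exact h3 ((delivered_iff (ω := (y, z)) hy n).1 (h1.2 h2)).1
    · rcases h with h | ⟨h2, h3⟩
      · simp [stepWeight, h]
      · simp [stepWeight, h2, deliveryProb, gapMark, h3]
  · push Not at hzero
    obtain ⟨N, hN⟩ := F.exists_nat_subset_range
    -- A packet without a delivery requirement receives an interval of length 0, which imposes
    -- nothing and contributes the factor 1.
    set d : ℕ → ℝ := fun n => if n ∈ F ∧ b n then (y n).2 else 0 with hd
    have hset : Prod.mk y ⁻¹' (⋂ n ∈ F, (fun ω => step (gap ω) (svc ω) 0 n) ⁻¹'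
        stepEvent (A n) (b n)) = {z | ∀ n < N, ∀ m, pointTime z m ∉
          Set.Ioc (pointTime y n) (pointTime y n + d n)} := by
      ext z
      simp only [Set.mem_preimage, Set.mem_iInter, stepEvent, Set.mem_ofPred_eq]
      refine ⟨fun h n _ m => ?_, fun h n hn => ⟨(hzero n hn).1, fun hbn => ?_⟩⟩
      · by_cases hn : n ∈ F ∧ b n
        · simp only [hd, if_pos hn]
          exact ((delivered_iff (ω := (y, z)) hy n).1 ((h n hn.1).2 hn.2)).2 m
        · simp [hd, if_neg hn]
      · refine (delivered_iff (ω := (y, z)) hy n).2 ⟨(hzero n hn).2 hbn, fun m => ?_⟩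
        have := h n (Finset.mem_range.1 (hN hn)) m
        simpa only [hd, if_pos (And.intro hn hbn)] using this
    rw [hset, seqLaw_forall_notMem_Ioc hσ N (hy.pos 0).le, ← Finset.prod_subset hN]
    · refine Finset.prod_congr rfl fun n hn => ?_
      have h1 := hzero n hn
      by_cases hbn : b n
      · have h2 : (gapMark n y).2 < (gapMark n y).1 := h1.2 hbn
        simp only [stepWeight, Set.indicator_of_mem h1.1, hbn, if_true, deliveryProb, if_pos h2,
          hd, hn, and_self, add_sub_cancel_left]
        rfl
      · simp [stepWeight, Set.indicator_of_mem h1.1, hbn, hd]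
    · intro n _ hn
      simp [hd, hn]
    · intro n
      have := (hy.1 n).2
      simp only [hd]
      split_ifs <;> linarith
    · intro n
      rw [pointTime_succ]
      have := (hy.1 (n + 1)).1
      simp only [hd]
      split_ifs with h
      · linarith [(hzero n h.1).2 h.2]
      · linarith

/-- The `π`-system of the events `stepEvent A b`. -/
def stepEvents : Set (Set ((ℝ × ℝ) × Prop)) := {U | ∃ A b, MeasurableSet A ∧ U = stepEvent A b}

theorem isPiSystem_stepEvents : IsPiSystem stepEvents := by
  rintro _ ⟨A, b, hA, rfl⟩ _ ⟨A', b', hA', rfl⟩ -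
  -- The implication form is closed under intersection: (b → e) and (b' → e) together say (b ∨ b') →
  -- e.
  refine ⟨A ∩ A', b ∨ b', hA.inter hA', ?_⟩
  ext e
  simp only [stepEvent, Set.mem_inter_iff, Set.mem_ofPred_eq]
  tauto

theorem generateFrom_stepEvents :
    MeasurableSpace.generateFrom stepEvents =
      (inferInstance : MeasurableSpace ((ℝ × ℝ) × Prop)) := by
  refine le_antisymm (MeasurableSpace.generateFrom_le ?_) ?_
  · rintro _ ⟨A, b, hA, rfl⟩
    exact measurableSet_stepEvent hA b
  · have h1 : Measurable[MeasurableSpace.generateFrom stepEvents]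
        (fun e : (ℝ × ℝ) × Prop => e.1) := fun A hA => by
      refine MeasurableSpace.measurableSet_generateFrom ⟨A, False, hA, ?_⟩
      ext e
      simp [stepEvent]
    have h2 : Measurable[MeasurableSpace.generateFrom stepEvents]
        (fun e : (ℝ × ℝ) × Prop => e.2) := by
      refine (@measurableSet_setOfPred _ (MeasurableSpace.generateFrom stepEvents) _).1 ?_
      refine MeasurableSpace.measurableSet_generateFrom ⟨Set.univ, True, .univ, ?_⟩
      ext e
      simp [stepEvent]
    exact sup_le h1.comap_le h2.comap_le

/-- The steps of source `1` are independent. -/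
theorem iIndepFun_step (hσ : σ (Set.Iio 0) = 0) :
    iIndepFun (fun n (ω : Path) => step (gap ω) (svc ω) 0 n) (pathLaw r₁ r₂ σ) := by
  set W : ℕ → Path → (ℝ × ℝ) × Prop := fun n ω => step (gap ω) (svc ω) 0 n with hW
  have hgen : ∀ n : ℕ, MeasurableSpace.comap (W n) inferInstance =
      MeasurableSpace.generateFrom (Set.preimage (W n) '' stepEvents) := by
    intro n
    rw [← MeasurableSpace.comap_generateFrom, generateFrom_stepEvents]
  refine iIndepSets.iIndep (fun n => (measurable_step n).comap_le) _ (fun n => ?_) hgen ?_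
  · rintro _ ⟨s, hs, rfl⟩ _ ⟨t, ht, rfl⟩ hne
    refine ⟨s ∩ t, isPiSystem_stepEvents s hs t ht ?_, rfl⟩
    obtain ⟨y, hy⟩ := hne
    exact ⟨W n y, hy⟩
  · rw [iIndepSets_iff]
    intro F f hf
    have hf' : ∀ n ∈ F, ∃ (A : Set (ℝ × ℝ)) (b : Prop), MeasurableSet A ∧
        f n = W n ⁻¹' stepEvent A b := by
      intro n hn
      obtain ⟨_, ⟨A, b, hA, rfl⟩, h⟩ := hf n hn
      exact ⟨A, b, hA, h.symm⟩
    classical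
    choose! A b hA hfe using hf'
    set A' : ℕ → Set (ℝ × ℝ) := fun n => if n ∈ F then A n else Set.univ with hA'
    have hAm : ∀ n, MeasurableSet (A' n) := fun n => by
      simp only [hA']; split_ifs with h <;> [exact hA n h; exact .univ]
    have hfe' : ∀ n ∈ F, f n = W n ⁻¹' stepEvent (A' n) (b n) := fun n hn => by
      simp only [hA', if_pos hn, hfe n hn]
    have h1 : (⋂ n ∈ F, f n) = ⋂ n ∈ F, W n ⁻¹' stepEvent (A' n) (b n) :=
      Set.iInter₂_congr hfe'
    rw [h1, pathLaw_steps hσ F hAm b]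
    refine Finset.prod_congr rfl fun n hn => ?_
    rw [hfe' n hn]
    simpa using (pathLaw_steps (r₁ := r₁) (r₂ := r₂) hσ {n} hAm b).symm

/-- The common law of the steps of source `1`. -/
noncomputable def stepLaw (r₁ r₂ : ℝ) (σ : Measure ℝ) : Measure ((ℝ × ℝ) × Prop) :=
  (pathLaw r₁ r₂ σ).map fun ω => step (gap ω) (svc ω) 0 0

instance : IsProbabilityMeasure (stepLaw r₁ r₂ σ) :=
  Measure.isProbabilityMeasure_map (measurable_step 0).aemeasurable

theorem map_step_stepEvent (hσ : σ (Set.Iio 0) = 0) (n : ℕ) {A : Set (ℝ × ℝ)}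
    (hA : MeasurableSet A) (b : Prop) :
    (pathLaw r₁ r₂ σ).map (fun ω => step (gap ω) (svc ω) 0 n) (stepEvent A b) =
      ∫⁻ a, stepWeight r₂ A b a ∂((expMeasure r₁).prod σ) := by
  rw [Measure.map_apply (measurable_step n) (measurableSet_stepEvent hA b)]
  simpa using pathLaw_steps (r₁ := r₁) (r₂ := r₂) hσ {n} (fun _ => hA) (fun _ => b)

theorem map_step (hσ : σ (Set.Iio 0) = 0) (n : ℕ) :
    (pathLaw r₁ r₂ σ).map (fun ω => step (gap ω) (svc ω) 0 n) = stepLaw r₁ r₂ σ := by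
  have : IsProbabilityMeasure
      ((pathLaw r₁ r₂ σ).map (fun ω => step (gap ω) (svc ω) 0 n)) :=
    Measure.isProbabilityMeasure_map (measurable_step n).aemeasurable
  refine ext_of_generate_finite _ generateFrom_stepEvents.symm isPiSystem_stepEvents ?_ (by simp)
  rintro _ ⟨A, b, hA, rfl⟩
  rw [stepLaw, map_step_stepEvent hσ n hA, map_step_stepEvent hσ 0 hA]

theorem map_fst_stepLaw (hσ : σ (Set.Iio 0) = 0) :
    (stepLaw r₁ r₂ σ).map Prod.fst = (expMeasure r₁).prod σ := by
  ext A hA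
  have h := map_step_stepEvent (r₁ := r₁) (r₂ := r₂) hσ 0 hA False
  rw [Measure.map_apply measurable_fst hA]
  have h1 : Prod.fst ⁻¹' A = stepEvent A False := by ext e; simp [stepEvent]
  rw [h1, stepLaw, h, ← lintegral_indicator_one hA]
  exact lintegral_congr fun a => by simp [stepWeight]; rfl

theorem measurableSet_deliveredSet : MeasurableSet deliveredSet :=
  measurableSet_setOfPred.2 measurable_snd

theorem map_fst_restrict_stepLaw (hσ : σ (Set.Iio 0) = 0) :
    ((stepLaw r₁ r₂ σ).restrict deliveredSet).map Prod.fst =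
      ((expMeasure r₁).prod σ).withDensity (deliveryProb r₂) := by
  ext A hA
  have h := map_step_stepEvent (r₁ := r₁) (r₂ := r₂) hσ 0 hA True
  have h1 : Prod.fst ⁻¹' A ∩ deliveredSet = stepEvent A True := by
    ext e; simp [stepEvent, deliveredSet]
  rw [Measure.map_apply measurable_fst hA, Measure.restrict_apply (measurable_fst hA), h1, stepLaw,
    h, withDensity_apply _ hA, ← lintegral_indicator hA]
  exact lintegral_congr fun a => by simp [stepWeight]

open scoped Classical in
-- The service time is integrated last, so that memorylessness of the gap can be applied at a fixed
-- level s.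
theorem lintegral_stepLaw_delivered (hσ : σ (Set.Iio 0) = 0) {g : ℝ × ℝ → ENNReal}
    (hg : Measurable g) :
    ∫⁻ e, (if e.2 then g e.1 else 0) ∂(stepLaw r₁ r₂ σ) =
      ∫⁻ s, ENNReal.ofReal (Real.exp (-r₂ * s)) *
        ∫⁻ x, (if s < x then g (x, s) else 0) ∂(expMeasure r₁) ∂σ := by
  have hm := measurable_deliveryProb (r₂ := r₂)
  have hmg : Measurable fun a => deliveryProb r₂ a * g a := hm.mul hg
  have h1 : ∫⁻ e, (if e.2 then g e.1 else 0) ∂(stepLaw r₁ r₂ σ) =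
      ∫⁻ e in deliveredSet, g e.1 ∂(stepLaw r₁ r₂ σ) := by
    rw [← lintegral_indicator measurableSet_deliveredSet]
    exact lintegral_congr fun e => by simp [Set.indicator_apply, deliveredSet]
  rw [h1, ← lintegral_map hg measurable_fst, map_fst_restrict_stepLaw hσ,
    lintegral_withDensity_eq_lintegral_mul _ hm hg]
  change ∫⁻ a, deliveryProb r₂ a * g a ∂_ = _
  rw [lintegral_prod_symm _ hmg.aemeasurable]
  refine lintegral_congr fun s => ?_
  have hgs : Measurable fun x => if s < x then g (x, s) else 0 :=
    Measurable.ite measurableSet_Ioi (by fun_prop) measurable_const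
  rw [← lintegral_const_mul _ hgs]
  refine lintegral_congr fun x => ?_
  simp only [deliveryProb]
  split_ifs <;> simp

end CanonicalSpace

/-! ### Integrability and positivity of the Laplace quantities. -/

section Laplace

variable {σ : Measure ℝ} [IsProbabilityMeasure σ]

theorem ae_nonneg_of_Iio (hσ : σ (Set.Iio 0) = 0) : ∀ᵐ s ∂σ, 0 ≤ s := by
  rw [ae_iff]; simpa [Set.Iio] using hσ

theorem integrable_exp_neg_mul (hσ : σ (Set.Iio 0) = 0) {r : ℝ} (hr : 0 < r) :
    Integrable (fun s => Real.exp (-r * s)) σ := by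
  refine (integrable_const (1 : ℝ)).mono' (by fun_prop) ?_
  filter_upwards [ae_nonneg_of_Iio hσ] with s hs
  rw [Real.norm_eq_abs, Real.abs_exp, Real.exp_le_one_iff]
  nlinarith

/-- The integrand is bounded by 1/r because e^{rs} ≥ 1 + rs; no moment of the service time enters.
-/
theorem integrable_mul_exp_neg_mul (hσ : σ (Set.Iio 0) = 0) {r : ℝ} (hr : 0 < r) :
    Integrable (fun s => s * Real.exp (-r * s)) σ := by
  refine (integrable_const (1 / r)).mono' (by fun_prop) ?_
  filter_upwards [ae_nonneg_of_Iio hσ] with s hs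
  rw [Real.norm_eq_abs, abs_of_nonneg (by positivity), neg_mul, Real.exp_neg, ← div_eq_mul_inv,
    div_le_div_iff₀ (Real.exp_pos _) hr]
  linarith [Real.add_one_le_exp (r * s)]

theorem laplaceL_pos (hσ : σ (Set.Iio 0) = 0) {r : ℝ} (hr : 0 < r) : 0 < laplaceL σ r := by
  rw [laplaceL, integral_pos_iff_support_of_nonneg (fun s => (Real.exp_pos _).le)
    (integrable_exp_neg_mul hσ hr)]
  have : (Function.support fun s => Real.exp (-r * s)) = Set.univ := by
    ext s; simp [Real.exp_ne_zero]
  rw [this]; simp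

theorem laplaceL_le_one (hσ : σ (Set.Iio 0) = 0) {r : ℝ} (hr : 0 < r) : laplaceL σ r ≤ 1 := by
  have h := integral_mono_ae (integrable_exp_neg_mul hσ hr) (integrable_const (1 : ℝ)) (by
    filter_upwards [ae_nonneg_of_Iio hσ] with s hs
    rw [Real.exp_le_one_iff]
    nlinarith)
  simpa [laplaceL] using h

theorem laplaceL'_nonneg (hσ : σ (Set.Iio 0) = 0) {r : ℝ} : 0 ≤ laplaceL' σ r := by
  refine integral_nonneg_of_ae ?_
  filter_upwards [ae_nonneg_of_Iio hσ] with s hs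
  exact mul_nonneg hs (Real.exp_pos _).le

theorem lintegral_exp_neg_mul (hσ : σ (Set.Iio 0) = 0) {r : ℝ} (hr : 0 < r) :
    ∫⁻ s, ENNReal.ofReal (Real.exp (-r * s)) ∂σ = ENNReal.ofReal (laplaceL σ r) := by
  rw [laplaceL, ofReal_integral_eq_lintegral_ofReal (integrable_exp_neg_mul hσ hr)
    (ae_of_all _ fun s => (Real.exp_pos _).le)]

theorem lintegral_mul_exp_neg_mul (hσ : σ (Set.Iio 0) = 0) {r : ℝ} (hr : 0 < r) :
    ∫⁻ s, ENNReal.ofReal (s * Real.exp (-r * s)) ∂σ = ENNReal.ofReal (laplaceL' σ r) := by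
  rw [laplaceL', ofReal_integral_eq_lintegral_ofReal (integrable_mul_exp_neg_mul hσ hr)]
  filter_upwards [ae_nonneg_of_Iio hσ] with s hs
  exact mul_nonneg hs (Real.exp_pos _).le

end Laplace

theorem integrable_and_integral_eq {α : Type*} [MeasurableSpace α] {μ : Measure α} {f : α → ℝ}
    (hf : AEMeasurable f μ) (h0 : ∀ᵐ ω ∂μ, 0 ≤ f ω) {a : ℝ} (ha : 0 ≤ a)
    (h : ∫⁻ ω, ENNReal.ofReal (f ω) ∂μ = ENNReal.ofReal a) :
    Integrable f μ ∧ ∫ ω, f ω ∂μ = a := by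
  refine ⟨⟨hf.aestronglyMeasurable, ?_⟩, ?_⟩
  · rw [hasFiniteIntegral_iff_ofReal h0, h]
    exact ENNReal.ofReal_lt_top
  · rw [integral_eq_lintegral_of_nonneg_ae h0 hf.aestronglyMeasurable, h, ENNReal.toReal_ofReal ha]

/-! ### Moments of a single step. -/

section StepMoments

variable {r₁ r₂ : ℝ} [hr₁ : Fact (0 < r₁)] [hr₂ : Fact (0 < r₂)] {σ : Measure ℝ}
  [IsProbabilityMeasure σ]

theorem stepLaw_deliveredSet (hσ : σ (Set.Iio 0) = 0) :
    stepLaw r₁ r₂ σ deliveredSet = ENNReal.ofReal (laplaceL σ (r₁ + r₂)) := by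
  classical
  have h := lintegral_stepLaw_delivered (r₁ := r₁) (r₂ := r₂) hσ (g := fun _ => 1) measurable_const
  rw [← lintegral_indicator_one measurableSet_deliveredSet,
    ← lintegral_exp_neg_mul hσ (add_pos hr₁.out hr₂.out)]
  refine Eq.trans (lintegral_congr fun e => by simp [Set.indicator_apply, deliveredSet]) (h.trans ?_)
  refine lintegral_congr_ae ?_
  filter_upwards [ae_nonneg_of_Iio hσ] with s hs
  have := lintegral_expMeasure_memoryless (r := r₁) hs (g := fun _ => 1) measurable_const
  rw [this, lintegral_one, measure_univ, mul_one, ← ENNReal.ofReal_mul (Real.exp_pos _).le,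
    ← Real.exp_add]
  ring_nf

theorem stepLaw_real_deliveredSet (hσ : σ (Set.Iio 0) = 0) :
    (stepLaw r₁ r₂ σ).real deliveredSet = laplaceL σ (r₁ + r₂) := by
  rw [Measure.real, stepLaw_deliveredSet hσ,
    ENNReal.toReal_ofReal (laplaceL_pos hσ (add_pos hr₁.out hr₂.out)).le]

open scoped Classical in
theorem lintegral_service_delivered (hσ : σ (Set.Iio 0) = 0) :
    ∫⁻ e, (if e.2 then ENNReal.ofReal e.1.2 else 0) ∂(stepLaw r₁ r₂ σ) =
      ENNReal.ofReal (laplaceL' σ (r₁ + r₂)) := by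
  rw [lintegral_stepLaw_delivered hσ (g := fun a => ENNReal.ofReal a.2) (by fun_prop),
    ← lintegral_mul_exp_neg_mul hσ (add_pos hr₁.out hr₂.out)]
  refine lintegral_congr_ae ?_
  filter_upwards [ae_nonneg_of_Iio hσ] with s hs
  have := lintegral_expMeasure_memoryless (r := r₁) hs (g := fun _ => ENNReal.ofReal s)
    measurable_const
  rw [this, lintegral_const, measure_univ, mul_one, ← ENNReal.ofReal_mul (Real.exp_pos _).le,
    ← ENNReal.ofReal_mul (Real.exp_pos _).le, ← mul_assoc, ← Real.exp_add]
  ring_nf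

open scoped Classical in
-- On delivery the gap exceeds s, and its excess over s is a fresh exponential of mean 1/r₁.
theorem lintegral_gap_delivered (hσ : σ (Set.Iio 0) = 0) :
    ∫⁻ e, (if e.2 then ENNReal.ofReal e.1.1 else 0) ∂(stepLaw r₁ r₂ σ) =
      ENNReal.ofReal (laplaceL' σ (r₁ + r₂) + laplaceL σ (r₁ + r₂) / r₁) := by
  have hr := add_pos hr₁.out hr₂.out
  rw [lintegral_stepLaw_delivered hσ (g := fun a => ENNReal.ofReal a.1) (by fun_prop),
    ENNReal.ofReal_add (laplaceL'_nonneg hσ) (div_nonneg (laplaceL_pos hσ hr).le hr₁.out.le),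
    div_eq_mul_one_div, ENNReal.ofReal_mul (laplaceL_pos hσ hr).le,
    ← lintegral_mul_exp_neg_mul hσ hr, ← lintegral_exp_neg_mul hσ hr,
    ← lintegral_mul_const _ (by fun_prop), ← lintegral_add_left (by fun_prop)]
  refine lintegral_congr_ae ?_
  filter_upwards [ae_nonneg_of_Iio hσ] with s hs
  have h1 := lintegral_expMeasure_memoryless (r := r₁) hs (g := fun u => ENNReal.ofReal (u + s))
    (by fun_prop)
  simp only [sub_add_cancel] at h1
  have h2 : ∫⁻ u, ENNReal.ofReal (u + s) ∂(expMeasure r₁) =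
      ENNReal.ofReal (1 / r₁) + ENNReal.ofReal s := by
    rw [← lintegral_ofReal_expMeasure]
    have : ∫⁻ _, ENNReal.ofReal s ∂(expMeasure r₁) = ENNReal.ofReal s := by simp
    conv_rhs => rw [← this]
    rw [← lintegral_add_left (by fun_prop)]
    refine lintegral_congr_ae ?_
    filter_upwards [ae_pos_expMeasure] with u hu
    rw [ENNReal.ofReal_add hu.le hs]
  have h3 : Real.exp (-(r₁ + r₂) * s) = Real.exp (-r₂ * s) * Real.exp (-r₁ * s) := by
    rw [← Real.exp_add]; ring_nf
  rw [h1, h2, h3, mul_comm s, ENNReal.ofReal_mul (by positivity),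
    ENNReal.ofReal_mul (Real.exp_pos _).le]
  ring

theorem lintegral_gap (hσ : σ (Set.Iio 0) = 0) :
    ∫⁻ e, ENNReal.ofReal e.1.1 ∂(stepLaw r₁ r₂ σ) = ENNReal.ofReal (1 / r₁) := by
  rw [← lintegral_map (f := fun a : ℝ × ℝ => ENNReal.ofReal a.1) (by fun_prop) measurable_fst,
    map_fst_stepLaw hσ, lintegral_prod _ (by fun_prop)]
  simpa using lintegral_ofReal_expMeasure

open scoped Classical in
theorem lintegral_busy (hσ : σ (Set.Iio 0) = 0) :
    ∫⁻ e, (if e.2 then ENNReal.ofReal e.1.2 else ENNReal.ofReal e.1.1) ∂(stepLaw r₁ r₂ σ) =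
      ENNReal.ofReal ((1 - laplaceL σ (r₁ + r₂)) / r₁) := by
  have hr := add_pos hr₁.out hr₂.out
  have hL := laplaceL_pos (σ := σ) hσ hr
  have hL' := laplaceL'_nonneg (σ := σ) hσ (r := r₁ + r₂)
  have hr1 := hr₁.out
  have hd : MeasurableSet {e : (ℝ × ℝ) × Prop | e.2} := measurableSet_deliveredSet
  -- Pointwise, busy + gap·1_delivered = gap + service·1_delivered, and three of the four
  -- expectations are known. The identity is kept additive until a finite term can be subtracted in
  -- `ENNReal`.
  have h1 : ∫⁻ e, (if e.2 then ENNReal.ofReal e.1.2 else ENNReal.ofReal e.1.1) ∂(stepLaw r₁ r₂ σ) +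
      ENNReal.ofReal (laplaceL' σ (r₁ + r₂) + laplaceL σ (r₁ + r₂) / r₁) =
      ENNReal.ofReal (1 / r₁) + ENNReal.ofReal (laplaceL' σ (r₁ + r₂)) := by
    rw [← lintegral_gap_delivered hσ, ← lintegral_gap (r₂ := r₂) hσ,
      ← lintegral_service_delivered hσ, ← lintegral_add_left, ← lintegral_add_left (by fun_prop)]
    · refine lintegral_congr fun e => ?_
      split_ifs
      · rw [add_comm]
      · simp
    · exact Measurable.ite hd (by fun_prop) (by fun_prop)
  rw [ENNReal.eq_sub_of_add_eq ENNReal.ofReal_ne_top h1,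
    ← ENNReal.ofReal_add (by positivity) hL', ← ENNReal.ofReal_sub _ (by positivity)]
  congr 1
  field_simp
  ring

theorem ae_stepLaw (hσ : σ (Set.Iio 0) = 0) :
    ∀ᵐ e ∂(stepLaw r₁ r₂ σ), 0 < e.1.1 ∧ 0 ≤ e.1.2 ∧ (e.2 → e.1.2 < e.1.1) := by
  have hm : MeasurableSet {e : (ℝ × ℝ) × Prop | 0 < e.1.1 ∧ 0 ≤ e.1.2 ∧ (e.2 → e.1.2 < e.1.1)} := by
    have h1 : MeasurableSet {e : (ℝ × ℝ) × Prop | 0 < e.1.1} :=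
      measurableSet_lt measurable_const measurable_fst.fst
    have h2 : MeasurableSet {e : (ℝ × ℝ) × Prop | 0 ≤ e.1.2} :=
      measurableSet_le measurable_const measurable_fst.snd
    have h3 : MeasurableSet {e : (ℝ × ℝ) × Prop | e.1.2 < e.1.1} :=
      measurableSet_lt measurable_fst.snd measurable_fst.fst
    exact h1.inter (h2.inter (measurableSet_deliveredSet.imp h3))
  rw [stepLaw, ae_map_iff (measurable_step 0).aemeasurable hm]
  filter_upwards [ae_goodSeq_fst hσ] with ω hω
  exact ⟨(hω.1 1).1, (hω.1 0).2, fun hd => ((delivered_iff hω 0).1 hd).1⟩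

open scoped Classical in
/-- The part of a step during which the AoI does not profit from the packet of the step. -/
noncomputable def busy (e : (ℝ × ℝ) × Prop) : ℝ := if e.2 then e.1.2 else e.1.1

theorem measurable_busy : Measurable busy :=
  Measurable.ite measurableSet_deliveredSet (by fun_prop) (by fun_prop)

theorem integral_busy (hσ : σ (Set.Iio 0) = 0) :
    ∫ e, busy e ∂(stepLaw r₁ r₂ σ) = (1 - laplaceL σ (r₁ + r₂)) / r₁ := by
  refine (integrable_and_integral_eq measurable_busy.aemeasurable ?_ ?_ ?_).2
  · filter_upwards [ae_stepLaw hσ] with e he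
    rw [busy]; split_ifs; exacts [he.2.1, he.1.le]
  · exact div_nonneg (sub_nonneg.2 (laplaceL_le_one hσ (add_pos hr₁.out hr₂.out))) hr₁.out.le
  · rw [← lintegral_busy hσ]
    exact lintegral_congr fun e => by rw [busy]; split_ifs <;> rfl

theorem memLp_gap (hσ : σ (Set.Iio 0) = 0) :
    MemLp (fun e : (ℝ × ℝ) × Prop => e.1.1) 2 (stepLaw r₁ r₂ σ) := by
  have h1 : MemLp (fun a : ℝ × ℝ => a.1) 2 ((expMeasure r₁).prod σ) :=
    memLp_two_expMeasure.comp_measurePreserving measurePreserving_fst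
  rw [← map_fst_stepLaw (r₁ := r₁) (r₂ := r₂) hσ] at h1
  exact h1.comp_of_map measurable_fst.aemeasurable

/-- A delivered service time is shorter than the gap, so the gap dominates and S needs no second
moment. -/
theorem memLp_busy (hσ : σ (Set.Iio 0) = 0) : MemLp busy 2 (stepLaw r₁ r₂ σ) := by
  refine (memLp_gap hσ).mono measurable_busy.aestronglyMeasurable ?_
  filter_upwards [ae_stepLaw hσ] with e he
  rw [busy, Real.norm_eq_abs, Real.norm_eq_abs, abs_of_pos he.1]
  split_ifs with h
  · rw [abs_of_nonneg he.2.1]; exact (he.2.2 h).le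
  · rw [abs_of_pos he.1]

theorem integral_gap_pow (hσ : σ (Set.Iio 0) = 0) (k : ℕ) :
    ∫ e, e.1.1 ^ k ∂(stepLaw r₁ r₂ σ) = k.factorial / r₁ ^ k := by
  have h := integral_map (μ := stepLaw r₁ r₂ σ) measurable_fst.aemeasurable
    (f := fun a : ℝ × ℝ => a.1 ^ k) (by fun_prop)
  rw [← h, map_fst_stepLaw hσ, integral_fun_fst (fun x => x ^ k), integral_pow_expMeasure]
  simp

theorem integral_gap (hσ : σ (Set.Iio 0) = 0) :
    ∫ e, e.1.1 ∂(stepLaw r₁ r₂ σ) = 1 / r₁ := by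
  simpa using integral_gap_pow (r₁ := r₁) (r₂ := r₂) hσ 1

open scoped Classical in
theorem integral_service_delivered (hσ : σ (Set.Iio 0) = 0) :
    Integrable (fun e : (ℝ × ℝ) × Prop => if e.2 then e.1.2 else 0) (stepLaw r₁ r₂ σ) ∧
    ∫ e, (if e.2 then e.1.2 else 0) ∂(stepLaw r₁ r₂ σ) = laplaceL' σ (r₁ + r₂) := by
  refine integrable_and_integral_eq (Measurable.ite measurableSet_deliveredSet (by fun_prop)
    measurable_const).aemeasurable ?_ (laplaceL'_nonneg hσ) ?_
  · filter_upwards [ae_stepLaw hσ] with e he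
    split_ifs; exacts [he.2.1, le_rfl]
  · rw [← lintegral_service_delivered hσ]
    exact lintegral_congr fun e => by split_ifs <;> simp

end StepMoments

/-! ### Means of the first delivery time and of the peaks. -/

section Expectations

variable {r₁ r₂ : ℝ} [hr₁ : Fact (0 < r₁)] [hr₂ : Fact (0 < r₂)] {σ : Measure ℝ}
  [IsProbabilityMeasure σ]

theorem stepLaw_real_deliveredSet_pos (hσ : σ (Set.Iio 0) = 0) :
    0 < (stepLaw r₁ r₂ σ).real deliveredSet := by
  rw [stepLaw_real_deliveredSet hσ]
  exact laplaceL_pos hσ (add_pos hr₁.out hr₂.out)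

theorem ae_infinite_delivered (hσ : σ (Set.Iio 0) = 0) :
    ∀ᵐ ω ∂(pathLaw r₁ r₂ σ), {n | Delivered (gap ω) (svc ω) 0 n}.Infinite :=
  ae_infinite_visits measurable_step (iIndepFun_step hσ) (map_step hσ) measurableSet_deliveredSet
    (stepLaw_real_deliveredSet_pos hσ)

theorem ae_regular (hσ : σ (Set.Iio 0) = 0) :
    ∀ᵐ ω ∂(pathLaw r₁ r₂ σ), Regular (gap ω) (svc ω) 0 := by
  filter_upwards [ae_goodSeq_fst hσ, ae_infinite_delivered hσ] with ω h1 h2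
  exact ⟨fun n => (h1.1 n).1, fun n => (h1.1 n).2, h1.2, h2⟩

/-- Quantities defined through `Nat.nth` inherit measurability from the series representing their
`ENNReal.ofReal`. -/
theorem aemeasurable_of_ofReal {α : Type*} [MeasurableSpace α] {μ : Measure α} {f : α → ℝ}
    (h0 : ∀ᵐ ω ∂μ, 0 ≤ f ω) (h : AEMeasurable (fun ω => ENNReal.ofReal (f ω)) μ) :
    AEMeasurable f μ :=
  h.ennreal_toReal.congr (by filter_upwards [h0] with ω hω using ENNReal.toReal_ofReal hω)

open scoped Classical in
theorem measurable_tsum_count {F : (ℝ × ℝ) × Prop → ENNReal} (hF : Measurable F) (j : ℕ) :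
    Measurable fun ω : Path => ∑' n,
      (if Nat.count (fun k => step (gap ω) (svc ω) 0 k ∈ deliveredSet) n = j
        then F (step (gap ω) (svc ω) 0 n) else 0) := by
  refine Measurable.tsum fun n => ?_
  have h1 : Measurable fun ω : Path =>
      Nat.count (fun k => step (gap ω) (svc ω) 0 k ∈ deliveredSet) n :=
    (measurable_count_past (W := fun n (ω : Path) => step (gap ω) (svc ω) 0 n)
      measurableSet_deliveredSet n).mono (past_le measurable_step n) le_rfl
  exact Measurable.ite (h1 (measurableSet_singleton j)) (hF.comp (measurable_step n))
    measurable_const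

open scoped Classical in
theorem measurable_ofReal_busy : Measurable fun e : (ℝ × ℝ) × Prop =>
    (if e.2 then ENNReal.ofReal e.1.2 else ENNReal.ofReal e.1.1) :=
  Measurable.ite measurableSet_deliveredSet (by fun_prop) (by fun_prop)

open scoped Classical in
theorem measurable_ofReal_gap_delivered : Measurable fun e : (ℝ × ℝ) × Prop =>
    (if e.2 then ENNReal.ofReal e.1.1 else 0) :=
  Measurable.ite measurableSet_deliveredSet (by fun_prop) measurable_const

theorem aemeasurable_deliveryTime_one (hσ : σ (Set.Iio 0) = 0) :
    AEMeasurable (fun ω : Path => deliveryTime (gap ω) (svc ω) 0 1) (pathLaw r₁ r₂ σ) := by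
  classical
  refine aemeasurable_of_ofReal ?_ ?_
  · filter_upwards [ae_regular hσ] with ω hω
    exact ((hω.lt_deliveryTime_one_iff 0).2 fun n _ => by
      linarith [hω.strictMono.monotone n.zero_le, hω.pos 0, hω.nonneg n,
        arrivalTime_zero (x := gap ω) (c := 0)]).le
  · refine Measurable.aemeasurable ?_ |>.congr (EventuallyEq.symm (by
      filter_upwards [ae_regular hσ] with ω hω using hω.ofReal_deliveryTime_one))
    refine Measurable.add ?_ (measurable_tsum_count measurable_ofReal_busy 0)
    simp only [gap_zero]
    fun_prop

theorem deliveryTime_one_nonneg (hσ : σ (Set.Iio 0) = 0) :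
    ∀ᵐ ω ∂(pathLaw r₁ r₂ σ), 0 ≤ deliveryTime (gap ω) (svc ω) 0 1 := by
  filter_upwards [ae_regular hσ] with ω hω
  exact ((hω.lt_deliveryTime_one_iff 0).2 fun n _ => by
    linarith [hω.strictMono.monotone n.zero_le, hω.pos 0, hω.nonneg n,
      arrivalTime_zero (x := gap ω) (c := 0)]).le

theorem integral_deliveryTime_one (hσ : σ (Set.Iio 0) = 0) :
    Integrable (fun ω : Path => deliveryTime (gap ω) (svc ω) 0 1) (pathLaw r₁ r₂ σ) ∧
    ∫ ω, deliveryTime (gap ω) (svc ω) 0 1 ∂(pathLaw r₁ r₂ σ) =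
      1 / (r₁ * laplaceL σ (r₁ + r₂)) := by
  classical
  have hr := add_pos hr₁.out hr₂.out
  have hL := laplaceL_pos (σ := σ) hσ hr
  have hL1 := laplaceL_le_one (σ := σ) hσ hr
  have hr1 := hr₁.out
  refine integrable_and_integral_eq (aemeasurable_deliveryTime_one hσ)
    (deliveryTime_one_nonneg hσ) (by positivity) ?_
  have h1 : ∫⁻ ω, ENNReal.ofReal (deliveryTime (gap ω) (svc ω) 0 1) ∂(pathLaw r₁ r₂ σ) =
      ∫⁻ ω, (ENNReal.ofReal (gap ω 0 0) + ∑' n,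
        (if Nat.count (fun k => step (gap ω) (svc ω) 0 k ∈ deliveredSet) n = 0 then
          (if (step (gap ω) (svc ω) 0 n).2 then ENNReal.ofReal (step (gap ω) (svc ω) 0 n).1.2
          else ENNReal.ofReal (step (gap ω) (svc ω) 0 n).1.1) else 0)) ∂(pathLaw r₁ r₂ σ) := by
    refine lintegral_congr_ae ?_
    filter_upwards [ae_regular hσ] with ω hω using hω.ofReal_deliveryTime_one
  have h2 : ∫⁻ ω, ENNReal.ofReal (gap ω 0 0) ∂(pathLaw r₁ r₂ σ) = ENNReal.ofReal (1 / r₁) := by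
    have hmp : MeasurePreserving (fun ω : Path => ω.1 0) (pathLaw r₁ r₂ σ)
        ((expMeasure r₁).prod σ) :=
      (measurePreserving_eval_infinitePi (fun _ : ℕ => (expMeasure r₁).prod σ) 0).comp
        measurePreserving_fst
    have h3 := hmp.lintegral_comp (f := fun a : ℝ × ℝ => ENNReal.ofReal a.1) (by fun_prop)
    rw [lintegral_prod _ (by fun_prop)] at h3
    simpa [gap_zero, lintegral_ofReal_expMeasure] using h3
  rw [h1, lintegral_add_left (by simp only [gap_zero]; fun_prop), h2,
    lintegral_tsum_count measurable_step (iIndepFun_step hσ) (map_step hσ)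
      measurableSet_deliveredSet (stepLaw_real_deliveredSet_pos hσ) measurable_ofReal_busy,
    lintegral_busy hσ, stepLaw_deliveredSet hσ, ← ENNReal.ofReal_div_of_pos hL,
    ← ENNReal.ofReal_add (by positivity)]
  · congr 1
    field_simp
    ring
  · exact div_nonneg (div_nonneg (by linarith) hr1.le) hL.le

theorem integral_peakAoI (hσ : σ (Set.Iio 0) = 0) (j : ℕ) :
    Integrable (fun ω : Path => peakAoI (gap ω) (svc ω) 0 (j + 2)) (pathLaw r₁ r₂ σ) ∧
    ∫ ω, peakAoI (gap ω) (svc ω) 0 (j + 2) ∂(pathLaw r₁ r₂ σ) =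
      (1 + r₁ * laplaceL' σ (r₁ + r₂)) / (r₁ * laplaceL σ (r₁ + r₂)) := by
  classical
  have hr := add_pos hr₁.out hr₂.out
  have hL := laplaceL_pos (σ := σ) hσ hr
  have hL1 := laplaceL_le_one (σ := σ) hσ hr
  have hL' := laplaceL'_nonneg (σ := σ) hσ (r := r₁ + r₂)
  have hr1 := hr₁.out
  have hae : ∀ᵐ ω ∂(pathLaw r₁ r₂ σ), 0 ≤ peakAoI (gap ω) (svc ω) 0 (j + 2) := by
    filter_upwards [ae_regular hσ] with ω hω
    rw [hω.peakAoI_eq]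
    have h1 := hω.strictMono.monotone ((Nat.nth_strictMono hω.infinite).monotone j.le_succ)
    have h2 := hω.nonneg (Nat.nth (Delivered (gap ω) (svc ω) 0) (j + 1))
    change _ ≤ arrivalTime (gap ω) 0 (Nat.nth (Delivered (gap ω) (svc ω) 0) (j + 1)) at h1
    change arrivalTime (gap ω) 0 (Nat.nth (Delivered (gap ω) (svc ω) 0) j) ≤ _ at h1
    linarith
  have hm1 := measurable_tsum_count measurable_ofReal_gap_delivered j
  have hm2 := measurable_tsum_count measurable_ofReal_busy (j + 1)
  have hcongr : (fun ω : Path => ENNReal.ofReal (peakAoI (gap ω) (svc ω) 0 (j + 2)))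
      =ᵐ[pathLaw r₁ r₂ σ] fun ω => (∑' n,
        (if Nat.count (fun k => step (gap ω) (svc ω) 0 k ∈ deliveredSet) n = j then
          (if (step (gap ω) (svc ω) 0 n).2 then ENNReal.ofReal (step (gap ω) (svc ω) 0 n).1.1
          else 0) else 0)) + ∑' n,
        (if Nat.count (fun k => step (gap ω) (svc ω) 0 k ∈ deliveredSet) n = j + 1 then
          (if (step (gap ω) (svc ω) 0 n).2 then ENNReal.ofReal (step (gap ω) (svc ω) 0 n).1.2
          else ENNReal.ofReal (step (gap ω) (svc ω) 0 n).1.1) else 0) := by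
    filter_upwards [ae_regular hσ] with ω hω using hω.ofReal_peakAoI j
  refine integrable_and_integral_eq (aemeasurable_of_ofReal hae
    ((hm1.add hm2).aemeasurable.congr hcongr.symm)) hae (by positivity) ?_
  rw [lintegral_congr_ae hcongr, lintegral_add_left hm1,
    lintegral_tsum_count measurable_step (iIndepFun_step hσ) (map_step hσ)
      measurableSet_deliveredSet (stepLaw_real_deliveredSet_pos hσ) measurable_ofReal_busy,
    lintegral_tsum_count measurable_step (iIndepFun_step hσ) (map_step hσ)
      measurableSet_deliveredSet (stepLaw_real_deliveredSet_pos hσ)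
      measurable_ofReal_gap_delivered,
    lintegral_busy hσ, lintegral_gap_delivered hσ, stepLaw_deliveredSet hσ,
    ← ENNReal.ofReal_div_of_pos hL, ← ENNReal.ofReal_div_of_pos hL,
    ← ENNReal.ofReal_add (by positivity)]
  · congr 1
    field_simp
    ring
  · exact div_nonneg (div_nonneg (by linarith) hr1.le) hL.le

end Expectations

/-! ### Almost sure averages. -/

section Averages

theorem tendsto_succ_div_self : Tendsto (fun N : ℕ => ((N : ℝ) + 1) / N) atTop (𝓝 1) := by
  have h := (tendsto_one_div_atTop_nhds_zero_nat (𝕜 := ℝ)).const_add 1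
  rw [add_zero] at h
  refine h.congr' ?_
  filter_upwards [eventually_gt_atTop 0] with N hN
  field_simp

theorem tendsto_shift_div {f : ℕ → ℝ} {a : ℝ}
    (h : Tendsto (fun N : ℕ => f N / N) atTop (𝓝 a)) :
    Tendsto (fun N : ℕ => f (N + 1) / N) atTop (𝓝 a) := by
  have h1 := ((tendsto_add_atTop_iff_nat 1).2 h).mul tendsto_succ_div_self
  rw [mul_one] at h1
  refine h1.congr fun N => ?_
  push_cast
  have : (N : ℝ) + 1 ≠ 0 := by positivity
  field_simp

/-- The average of a monotone function can be computed along a sequence of linear growth. -/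
theorem tendsto_div_of_tendsto_along {G : ℝ → ℝ} {T : ℕ → ℝ} {t g : ℝ}
    (hG : MonotoneOn G (Set.Ici 0)) (hG0 : ∀ τ, 0 ≤ τ → 0 ≤ G τ) (hT0 : ∀ n, 0 < T n)
    (hT : Tendsto T atTop atTop) (ht : 0 < t)
    (hTt : Tendsto (fun N : ℕ => T N / N) atTop (𝓝 t))
    (hGg : Tendsto (fun N : ℕ => G (T N) / N) atTop (𝓝 g)) :
    Tendsto (fun τ => G τ / τ) atTop (𝓝 (g / t)) := by
  classical
  have hex : ∀ τ : ℝ, ∃ n, τ < T n := fun τ => (hT.eventually_gt_atTop τ).exists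
  set M : ℝ → ℕ := fun τ => Nat.find (hex τ) with hM
  have hM1 : ∀ τ, τ < T (M τ) := fun τ => Nat.find_spec (hex τ)
  have hM2 : ∀ τ k, k < M τ → T k ≤ τ := fun τ k hk => not_lt.1 (Nat.find_min (hex τ) hk)
  have hMt : Tendsto M atTop atTop := by
    refine tendsto_atTop.2 fun b => ?_
    filter_upwards [eventually_ge_atTop (∑ k ∈ Finset.range b, T k)] with τ hτ
    by_contra hlt
    have h1 := Finset.single_le_sum (f := T) (s := Finset.range b) (fun k _ => (hT0 k).le)
      (Finset.mem_range.2 (not_le.1 hlt))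
    linarith [hM1 τ]
  -- With N = M τ - 1 one has T N ≤ τ < T (N+1), whence G(T N)/T(N+1) ≤ G(τ)/τ ≤ G(T(N+1))/T N.
  have hNt : Tendsto (fun τ => M τ - 1) atTop atTop := (tendsto_sub_atTop_nat 1).comp hMt
  have hlo : Tendsto (fun N : ℕ => G (T N) / T (N + 1)) atTop (𝓝 (g / t)) := by
    refine (hGg.div (tendsto_shift_div hTt) ht.ne').congr' ?_
    filter_upwards [eventually_gt_atTop 0] with N hN
    have := hT0 (N + 1)
    simp only [Pi.div_apply]
    field_simp
  have hhi : Tendsto (fun N : ℕ => G (T (N + 1)) / T N) atTop (𝓝 (g / t)) := by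
    refine ((tendsto_shift_div (f := fun N => G (T N)) hGg).div hTt ht.ne').congr' ?_
    filter_upwards [eventually_gt_atTop 0] with N hN
    have := hT0 N
    simp only [Pi.div_apply]
    field_simp
  have hev : ∀ᶠ τ in atTop, 1 ≤ M τ := hMt.eventually_ge_atTop 1
  refine tendsto_of_tendsto_of_tendsto_of_le_of_le' (hlo.comp hNt) (hhi.comp hNt) ?_ ?_
  · filter_upwards [hev] with τ h1
    have h2 := hM2 τ (M τ - 1) (by omega)
    have h3 := hT0 (M τ - 1)
    simp only [Function.comp_apply, Nat.sub_add_cancel h1]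
    exact div_le_div₀ (hG0 _ (h3.le.trans h2)) (hG h3.le (h3.le.trans h2) h2) (h3.trans_le h2)
      (hM1 τ).le
  · filter_upwards [hev] with τ h1
    have h2 := hM2 τ (M τ - 1) (by omega)
    have h3 := hT0 (M τ - 1)
    simp only [Function.comp_apply, Nat.sub_add_cancel h1]
    exact div_le_div₀ (hG0 _ (hT0 _).le) (hG (h3.le.trans h2) (hT0 _).le (hM1 τ).le) h3 h2

namespace Regular

variable {ι : Type*} {x s : ι → ℕ → ℝ} {c : ι} (h : Regular x s c)
include h

theorem arrivalTime_pos (n : ℕ) : 0 < arrivalTime x c n := by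
  have := h.strictMono.monotone n.zero_le
  rw [arrivalTime_zero] at this
  exact (h.pos 0).trans_le this

/-- The time average of the AoI is determined by its areas between the generations of packets. -/
theorem tendsto_integral_aoi_div (u₀ : ℝ) {t g : ℝ} (ht : 0 < t)
    (hT : Tendsto (fun N : ℕ => arrivalTime x c N / N) atTop (𝓝 t))
    (hg : Tendsto (fun N : ℕ => (∑ n ∈ Finset.range N,
      (resetSum deliveredSet (fun e => e.1.1) (step x s c) n * busy (step x s c n) +
        (step x s c n).1.1 ^ 2 / 2)) / (N : ℝ)) atTop (𝓝 g)) :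
    Tendsto (fun τ : ℝ => (∫ w in (0 : ℝ)..τ, aoi x s u₀ c w) / τ) atTop (𝓝 (g / t)) := by
  classical
  set a : ℕ → ℝ := fun n =>
    resetSum deliveredSet (fun e => e.1.1) (step x s c) n * busy (step x s c n) +
      (step x s c n).1.1 ^ 2 / 2 with ha
  have hint := h.intervalIntegrable_aoi u₀
  obtain ⟨N₀, hN₀⟩ := h.infinite.nonempty
  have hstep : ∀ N, N₀ < N → ∫ w in arrivalTime x c N..arrivalTime x c (N + 1), aoi x s u₀ c w =
      a N := by
    intro N hN
    rw [h.integral_aoi_step u₀ ⟨N₀, hN, hN₀⟩]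
    rfl
  -- The area formula needs an earlier delivery. The steps up to N₀ add only a constant, which
  -- vanishes in the average and with it the influence of u₀.
  have hsum : ∀ N, N₀ + 1 ≤ N → ∫ w in (0 : ℝ)..arrivalTime x c N, aoi x s u₀ c w =
      ((∫ w in (0 : ℝ)..arrivalTime x c (N₀ + 1), aoi x s u₀ c w) -
        ∑ n ∈ Finset.range (N₀ + 1), a n) + ∑ n ∈ Finset.range N, a n := by
    intro N hN
    induction N, hN using Nat.le_induction with
    | base => ring
    | succ N hN ih =>
      rw [← intervalIntegral.integral_add_adjacent_intervals (hint _ (arrivalTime x c N))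
        (hint _ _), ih, hstep N hN, Finset.sum_range_succ _ N]
      ring
  have hlim : Tendsto (fun N : ℕ => (∫ w in (0 : ℝ)..arrivalTime x c N, aoi x s u₀ c w) / N) atTop
      (𝓝 g) := by
    have h1 := (tendsto_const_div_atTop_nhds_zero_nat
      ((∫ w in (0 : ℝ)..arrivalTime x c (N₀ + 1), aoi x s u₀ c w) -
        ∑ n ∈ Finset.range (N₀ + 1), a n)).add hg
    rw [zero_add] at h1
    refine h1.congr' ?_
    filter_upwards [eventually_ge_atTop (N₀ + 1)] with N hN
    rw [hsum N hN, add_div]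
  -- The age may be negative when u₀ > 0; adding |u₀| makes the integrand nonnegative on [0, ∞) and
  -- G monotone there. The added term is subtracted again at the end.
  set G : ℝ → ℝ := fun τ => ∫ w in (0 : ℝ)..τ, (aoi x s u₀ c w + |u₀|) with hG
  have hint' : ∀ p q, IntervalIntegrable (fun w => aoi x s u₀ c w + |u₀|) volume p q :=
    fun p q => (hint p q).add (by simp)
  have hGe : ∀ τ, G τ = (∫ w in (0 : ℝ)..τ, aoi x s u₀ c w) + τ * |u₀| := by
    intro τ
    rw [hG]
    simp only
    rw [intervalIntegral.integral_add (hint _ _) (by simp), intervalIntegral.integral_const,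
      smul_eq_mul, sub_zero]
  have hnn : ∀ p q, 0 ≤ p → p ≤ q → 0 ≤ ∫ w in p..q, (aoi x s u₀ c w + |u₀|) := by
    intro p q hp hpq
    exact intervalIntegral.integral_nonneg hpq fun w hw => by
      linarith [h.neg_abs_le_aoi u₀ (hp.trans hw.1)]
  have hmono : MonotoneOn G (Set.Ici 0) := by
    intro p hp q hq hpq
    have := intervalIntegral.integral_add_adjacent_intervals (hint' 0 p) (hint' p q)
    have h2 := hnn p q hp hpq
    simp only [hG]
    linarith
  have hGlim : Tendsto (fun N : ℕ => G (arrivalTime x c N) / N) atTop (𝓝 (g + t * |u₀|)) := by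
    refine (hlim.add (hT.mul_const |u₀|)).congr fun N => ?_
    rw [hGe]
    ring
  have hfin := (tendsto_div_of_tendsto_along hmono (fun τ hτ => hnn 0 τ le_rfl hτ)
    h.arrivalTime_pos h.tendsto ht hT hGlim).sub_const |u₀|
  have he : (g + t * |u₀|) / t - |u₀| = g / t := by field_simp; ring
  rw [he] at hfin
  refine hfin.congr' ?_
  filter_upwards [eventually_gt_atTop 0] with τ hτ
  rw [hGe]
  field_simp
  ring

open scoped Classical in
-- The n-th delivered index grows like n/p, so averages per packet become averages per delivery on
-- dividing by p.
theorem tendsto_sum_peakAoI_div {p t a : ℝ} (hp : 0 < p)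
    (hD : Tendsto (fun N : ℕ => (Nat.count (Delivered x s c) N : ℝ) / N) atTop (𝓝 p))
    (hT : Tendsto (fun N : ℕ => arrivalTime x c N / N) atTop (𝓝 t))
    (hs : Tendsto (fun N : ℕ => (∑ k ∈ Finset.range N, if Delivered x s c k then s c k else 0) / N)
      atTop (𝓝 a)) :
    Tendsto (fun n : ℕ => (∑ i ∈ Finset.range n, peakAoI x s c (i + 2)) / n) atTop
      (𝓝 ((t + a) / p)) := by
  have hnth : Tendsto (Nat.nth (Delivered x s c)) atTop atTop :=
    (Nat.nth_strictMono h.infinite).tendsto_atTop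
  have h1 : Tendsto (fun n : ℕ => (Nat.nth (Delivered x s c) n : ℝ) / n) atTop (𝓝 p⁻¹) := by
    refine ((hD.comp hnth).inv₀ hp.ne').congr fun n => ?_
    simp only [Function.comp_apply]
    rw [Nat.count_nth_of_infinite h.infinite, inv_div]
  have key : ∀ (f : ℕ → ℝ) (b : ℝ), Tendsto (fun N : ℕ => f N / N) atTop (𝓝 b) →
      Tendsto (fun n : ℕ => f (Nat.nth (Delivered x s c) n) / n) atTop (𝓝 (b * p⁻¹)) := by
    intro f b hf
    refine ((hf.comp hnth).mul h1).congr' ?_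
    filter_upwards [hnth.eventually_gt_atTop 0] with n hn
    have : (Nat.nth (Delivered x s c) n : ℝ) ≠ 0 := by exact_mod_cast hn.ne'
    simp only [Function.comp_apply]
    field_simp
  have h2 := ((key _ t hT).add (tendsto_shift_div (key _ a hs))).sub
    (tendsto_const_div_atTop_nhds_zero_nat (arrivalTime x c (Nat.nth (Delivered x s c) 0) +
      s c (Nat.nth (Delivered x s c) 0)))
  have he : t * p⁻¹ + a * p⁻¹ - 0 = (t + a) / p := by ring
  rw [he] at h2
  refine h2.congr fun n => ?_
  rw [h.sum_peakAoI]
  ring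

end Regular

variable {r₁ r₂ : ℝ} [hr₁ : Fact (0 < r₁)] [hr₂ : Fact (0 < r₂)] {σ : Measure ℝ}
  [IsProbabilityMeasure σ]

theorem ae_tendsto_arrivalTime_div :
    ∀ᵐ ω ∂(pathLaw r₁ r₂ σ),
      Tendsto (fun N : ℕ => arrivalTime (gap ω) 0 N / N) atTop (𝓝 (1 / r₁)) := by
  have h := (Measure.quasiMeasurePreserving_fst (μ := seqLaw r₁ σ) (ν := seqLaw r₂ σ)).ae
    (ae_tendsto_pointTime_div (r := r₁) (σ := σ))
  filter_upwards [h] with ω hω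
  exact tendsto_shift_div (f := fun N => ∑ n ∈ Finset.range N, (ω.1 n).1) hω

theorem ae_tendsto_integral_aoi_div (hσ : σ (Set.Iio 0) = 0) :
    ∀ᵐ ω ∂(pathLaw r₁ r₂ σ), ∀ u₀ : ℝ,
      Tendsto (fun τ : ℝ => (∫ w in (0 : ℝ)..τ, aoi (gap ω) (svc ω) u₀ 0 w) / τ) atTop
        (𝓝 (1 / (r₁ * laplaceL σ (r₁ + r₂)))) := by
  have hL := laplaceL_pos (σ := σ) hσ (add_pos hr₁.out hr₂.out)
  have hr1 := hr₁.out
  have h1 := ae_tendsto_avg_resetSum_mul measurable_step (iIndepFun_step hσ)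
    (map_step (r₁ := r₁) (r₂ := r₂) hσ) measurableSet_deliveredSet
    (stepLaw_real_deliveredSet_pos hσ) measurable_fst.fst (memLp_gap hσ) measurable_busy
    (memLp_busy hσ)
  have h2 := ae_tendsto_avg_of_iid measurable_step (iIndepFun_step hσ)
    (map_step (r₁ := r₁) (r₂ := r₂) hσ) (f := fun e => e.1.1 ^ 2) (by fun_prop)
    (memLp_gap hσ).integrable_sq
  filter_upwards [h1, h2, ae_regular hσ, ae_tendsto_arrivalTime_div] with ω h1 h2 h3 h4 u₀
  rw [integral_busy hσ, integral_gap hσ, stepLaw_real_deliveredSet hσ] at h1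
  rw [integral_gap_pow hσ 2] at h2
  have h5 := h3.tendsto_integral_aoi_div u₀ (by positivity) h4
    (g := (1 - laplaceL σ (r₁ + r₂)) / r₁ * (1 / r₁) / laplaceL σ (r₁ + r₂) +
      ((2 : ℕ).factorial / r₁ ^ 2) / 2) (by
      refine (h1.add (h2.div_const 2)).congr fun N => ?_
      rw [Finset.sum_add_distrib, add_div, ← Finset.sum_div]
      congr 1
      ring)
  convert h5 using 2
  simp only [Nat.factorial]
  push_cast
  field_simp
  ring

theorem ae_tendsto_sum_peakAoI_div (hσ : σ (Set.Iio 0) = 0) :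
    ∀ᵐ ω ∂(pathLaw r₁ r₂ σ),
      Tendsto (fun n : ℕ => (∑ i ∈ Finset.range n, peakAoI (gap ω) (svc ω) 0 (i + 2)) / n) atTop
        (𝓝 ((1 + r₁ * laplaceL' σ (r₁ + r₂)) / (r₁ * laplaceL σ (r₁ + r₂)))) := by
  classical
  have hL := laplaceL_pos (σ := σ) hσ (add_pos hr₁.out hr₂.out)
  have hr1 := hr₁.out
  have h1 := ae_tendsto_count measurable_step (iIndepFun_step hσ)
    (map_step (r₁ := r₁) (r₂ := r₂) hσ) measurableSet_deliveredSet
  have h2 := ae_tendsto_avg_of_iid measurable_step (iIndepFun_step hσ)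
    (map_step (r₁ := r₁) (r₂ := r₂) hσ) (f := fun e => if e.2 then e.1.2 else 0)
    (Measurable.ite measurableSet_deliveredSet measurable_fst.snd measurable_const)
    (integral_service_delivered hσ).1
  filter_upwards [h1, h2, ae_regular hσ, ae_tendsto_arrivalTime_div] with ω h1 h2 h3 h4
  rw [stepLaw_real_deliveredSet hσ] at h1
  rw [(integral_service_delivered hσ).2] at h2
  have h5 := h3.tendsto_sum_peakAoI_div hL h1 h4 h2
  convert h5 using 2
  field_simp

end Averages

/-! ### The input observed from a later time. -/

section Shift

/-- The canonical input, observed from the time `w` on. -/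
noncomputable def shiftPath (w : ℝ) (ω : Path) : Path := (shiftSeq w ω.1, shiftSeq w ω.2)

variable {r₁ r₂ : ℝ} [hr₁ : Fact (0 < r₁)] [hr₂ : Fact (0 < r₂)] {σ : Measure ℝ}
  [IsProbabilityMeasure σ]

theorem measurePreserving_shiftPath (hσ : σ (Set.Iio 0) = 0) {w : ℝ} (hw : 0 ≤ w) :
    MeasurePreserving (shiftPath w) (pathLaw r₁ r₂ σ) (pathLaw r₁ r₂ σ) :=
  (measurePreserving_shiftSeq hσ hw).prod (measurePreserving_shiftSeq hσ hw)

/-- Whether a packet is delivered depends only on its service time and on later arrivals, so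
removing all points up to w and moving the origin to w changes nothing for the remaining packets. -/
theorem delivered_shiftPath {ω : Path} {w : ℝ} {M K : ℕ} (hM : Cross w M ω.1)
    (hK : Cross w K ω.2) (hω : GoodSeq ω.1) (k : ℕ) :
    Delivered (gap (shiftPath w ω)) (svc (shiftPath w ω)) 0 k ↔
      Delivered (gap ω) (svc ω) 0 (M + k) := by
  have hk : w < pointTime ω.1 (M + k) :=
    hM.2.trans_le (hω.strictMono.monotone (Nat.le_add_right M k))
  simp only [Delivered, Fin.forall_fin_two, arrivalTime_gap_zero, arrivalTime_gap_one, svc_zero,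
    shiftPath, hM.shiftSeq_eq, hK.shiftSeq_eq, pointTime_residual, residual_snd]
  have key : ∀ (y : ℕ → ℝ × ℝ) (L : ℕ), Cross w L y →
      ((∀ m, pointTime ω.1 (M + k) - w < pointTime y (L + m) - w →
        pointTime ω.1 (M + k) - w + (ω.1 (M + k)).2 < pointTime y (L + m) - w) ↔
      ∀ m, pointTime ω.1 (M + k) < pointTime y m →
        pointTime ω.1 (M + k) + (ω.1 (M + k)).2 < pointTime y m) := by
    intro y L hL
    refine ⟨fun h m hm => ?_, fun h m hm => by linarith [h (L + m) (by linarith)]⟩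
    rcases lt_or_ge m L with h1 | h1
    · linarith [hL.1 m h1]
    · obtain ⟨j, rfl⟩ := Nat.exists_eq_add_of_le h1
      linarith [h j (by linarith)]
  exact and_congr (key ω.1 M hM) (key ω.2 K hK)

/-- Both sides say that no packet generated after w is delivered by time w + y; on the right the
clock is started at w. -/
theorem le_aoi_iff_lt_deliveryTime_shiftPath {ω : Path} {w y u₀ : ℝ} (hu : u₀ ≤ w)
    (h1 : GoodSeq ω.1) (h2 : GoodSeq ω.2) (hω : Regular (gap ω) (svc ω) 0)
    (hω' : Regular (gap (shiftPath w ω)) (svc (shiftPath w ω)) 0) :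
    y ≤ aoi (gap ω) (svc ω) u₀ 0 (w + y) ↔
      y < deliveryTime (gap (shiftPath w ω)) (svc (shiftPath w ω)) 0 1 := by
  obtain ⟨M, hM⟩ := h1.exists_cross w
  obtain ⟨K, hK⟩ := h2.exists_cross w
  rw [hω.le_aoi_iff (by linarith), hω'.lt_deliveryTime_one_iff]
  simp only [delivered_shiftPath hM hK h1]
  simp only [arrivalTime_gap_zero, svc_zero, shiftPath, hM.shiftSeq_eq, pointTime_residual,
    residual_snd]
  refine ⟨fun h k hk => ?_, fun h n hn hle => ?_⟩
  · by_contra hlt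
    have h3 := h (M + k) hk (by linarith)
    linarith [hM.2.trans_le (h1.strictMono.monotone (Nat.le_add_right M k))]
  · rcases lt_or_ge n M with h3 | h3
    · linarith [hM.1 n h3]
    · obtain ⟨j, rfl⟩ := Nat.exists_eq_add_of_le h3
      linarith [h j hn]

end Shift

/-! ### The exact tail of the AoI at a fixed time. -/

section Limit

variable {r₁ r₂ : ℝ} [hr₁ : Fact (0 < r₁)] [hr₂ : Fact (0 < r₂)] {σ : Measure ℝ}
  [IsProbabilityMeasure σ]

theorem measurableSet_not_received (t : ℝ) (n : ℕ) : MeasurableSet {ω : Path |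
    Delivered (gap ω) (svc ω) 0 n → t < arrivalTime (gap ω) 0 n + svc ω 0 n} :=
  (measurableSet_delivered n).imp (measurableSet_lt measurable_const
    ((measurable_arrivalTime_gap 0 n).add (measurable_svc_zero n)))

theorem aemeasurable_aoi (hσ : σ (Set.Iio 0) = 0) (u₀ t : ℝ) :
    AEMeasurable (fun ω : Path => aoi (gap ω) (svc ω) u₀ 0 t) (pathLaw r₁ r₂ σ) := by
  -- On regular paths, preimages split according to the last received packet, if any. This gives a
  -- measurable set almost everywhere equal to the preimage.
  refine NullMeasurable.aemeasurable fun B hB => ?_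
  set N : Set Path := {ω | ∀ n, Delivered (gap ω) (svc ω) 0 n →
    t < arrivalTime (gap ω) 0 n + svc ω 0 n} with hN
  set E : ℕ → Set Path := fun n => {ω | Delivered (gap ω) (svc ω) 0 n ∧
    arrivalTime (gap ω) 0 n + svc ω 0 n ≤ t ∧ ∀ m, n < m → Delivered (gap ω) (svc ω) 0 m →
      t < arrivalTime (gap ω) 0 m + svc ω 0 m} with hE
  have hNm : MeasurableSet N := by
    rw [hN, Set.ofPred_forall]
    exact .iInter fun n => measurableSet_not_received t n
  have hEm : ∀ n, MeasurableSet (E n) := fun n => by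
    have hl : MeasurableSet {ω : Path | ∀ m, n < m → Delivered (gap ω) (svc ω) 0 m →
        t < arrivalTime (gap ω) 0 m + svc ω 0 m} := by
      simp only [Set.ofPred_forall]
      exact .iInter fun m => .iInter fun _ => measurableSet_not_received t m
    exact (measurableSet_delivered n).inter (MeasurableSet.inter (measurableSet_le
      ((measurable_arrivalTime_gap 0 n).add (measurable_svc_zero n)) measurable_const) hl)
  have hm : MeasurableSet ((N ∩ {_ω | t - u₀ ∈ B}) ∪
      ⋃ n, E n ∩ {ω | t - arrivalTime (gap ω) 0 n ∈ B}) := by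
    refine (hNm.inter (MeasurableSet.const _)).union (.iUnion fun n => (hEm n).inter ?_)
    exact (measurable_const.sub (measurable_arrivalTime_gap 0 n)) hB
  refine hm.nullMeasurableSet.congr ?_
  filter_upwards [ae_regular hσ] with ω hω
  refine propext ⟨?_, fun h => ?_⟩
  · rintro (⟨h1, h2⟩ | h1)
    · change aoi (gap ω) (svc ω) u₀ 0 t ∈ B
      rwa [hω.aoi_eq_of_none u₀ h1]
    · obtain ⟨n, h1, h2⟩ := Set.mem_iUnion.1 h1
      change aoi (gap ω) (svc ω) u₀ 0 t ∈ B
      rwa [hω.aoi_eq_of_last u₀ h1.1 h1.2.1 h1.2.2]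
  · change aoi (gap ω) (svc ω) u₀ 0 t ∈ B at h
    rcases hω.none_or_exists_last t with h1 | ⟨n, h1, h2, h3⟩
    · rw [hω.aoi_eq_of_none u₀ h1] at h
      exact Or.inl ⟨h1, h⟩
    · rw [hω.aoi_eq_of_last u₀ h1 h2 h3] at h
      exact Or.inr (Set.mem_iUnion.2 ⟨n, ⟨h1, h2, h3⟩, h⟩)

/-- The stationary distribution of the AoI, which is the law of the first delivery time. -/
noncomputable def stationaryLaw (r₁ r₂ : ℝ) (σ : Measure ℝ) : Measure ℝ :=
  (pathLaw r₁ r₂ σ).map fun ω => deliveryTime (gap ω) (svc ω) 0 1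

theorem isProbabilityMeasure_stationaryLaw (hσ : σ (Set.Iio 0) = 0) :
    IsProbabilityMeasure (stationaryLaw r₁ r₂ σ) :=
  Measure.isProbabilityMeasure_map (aemeasurable_deliveryTime_one hσ)

/-- Restarting at t - y preserves the law, so the tail identity is exact and not merely asymptotic.
-/
theorem map_aoi_Ici (hσ : σ (Set.Iio 0) = 0) {u₀ t y : ℝ} (hty : y ≤ t) (htu : y ≤ t - u₀) :
    (pathLaw r₁ r₂ σ).map (fun ω => aoi (gap ω) (svc ω) u₀ 0 t) (Set.Ici y) =
      stationaryLaw r₁ r₂ σ (Set.Ioi y) := by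
  rw [Measure.map_apply_of_aemeasurable (aemeasurable_aoi hσ u₀ t) measurableSet_Ici]
  have hmp := measurePreserving_shiftPath (r₁ := r₁) (r₂ := r₂) hσ (sub_nonneg.2 hty)
  have h1 : stationaryLaw r₁ r₂ σ = (pathLaw r₁ r₂ σ).map fun ω =>
      deliveryTime (gap (shiftPath (t - y) ω)) (svc (shiftPath (t - y) ω)) 0 1 := by
    have h2 : AEMeasurable (fun ω : Path => deliveryTime (gap ω) (svc ω) 0 1)
        ((pathLaw r₁ r₂ σ).map (shiftPath (t - y))) := by
      rw [hmp.map_eq]; exact aemeasurable_deliveryTime_one hσ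
    rw [stationaryLaw]
    conv_lhs => rw [← hmp.map_eq]
    rw [AEMeasurable.map_map_of_aemeasurable h2 hmp.measurable.aemeasurable]
    rfl
  have h3 : AEMeasurable (fun ω => deliveryTime (gap (shiftPath (t - y) ω))
      (svc (shiftPath (t - y) ω)) 0 1) (pathLaw r₁ r₂ σ) :=
    (aemeasurable_deliveryTime_one hσ).comp_quasiMeasurePreserving hmp.quasiMeasurePreserving
  rw [h1, Measure.map_apply_of_aemeasurable h3 measurableSet_Ioi]
  refine measure_congr ?_
  filter_upwards [ae_goodSeq_fst hσ, ae_goodSeq_snd hσ, ae_regular hσ,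
    hmp.quasiMeasurePreserving.ae (ae_regular hσ)] with ω h4 h5 h6 h7
  have h8 := le_aoi_iff_lt_deliveryTime_shiftPath (y := y) (u₀ := u₀) (by linarith) h4 h5 h6 h7
  rw [sub_add_cancel] at h8
  exact propext h8

end Limit

/-! ### Convergence in distribution and the mean of the limit. -/

section WeakLimit

/-- The tails of a measure determine its values on the open half-lines. -/
theorem measure_Ioi_eq_of_Ici {μ ν : Measure ℝ} {a b : ℝ} (hab : a < b)
    (h : ∀ y, y ≤ b → μ (Set.Ici y) = ν (Set.Ioi y)) : μ (Set.Ioi a) = ν (Set.Ioi a) := by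
  obtain ⟨u, hu1, hu2, hu3⟩ := exists_seq_strictAnti_tendsto' hab
  have h1 : Set.Ioi a = ⋃ n, Set.Ici (u n) := by
    ext z
    simp only [Set.mem_Ioi, Set.mem_iUnion, Set.mem_Ici]
    refine ⟨fun hz => ?_, fun ⟨n, hn⟩ => (hu2 n).1.trans_le hn⟩
    obtain ⟨n, hn⟩ := (hu3.eventually_lt_const hz).exists
    exact ⟨n, hn.le⟩
  have h2 : Set.Ioi a = ⋃ n, Set.Ioi (u n) := by
    ext z
    simp only [Set.mem_Ioi, Set.mem_iUnion]
    refine ⟨fun hz => ?_, fun ⟨n, hn⟩ => (hu2 n).1.trans hn⟩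
    exact (hu3.eventually_lt_const hz).exists
  have hm1 : Monotone fun n => Set.Ici (u n) := fun m n hmn =>
    Set.Ici_subset_Ici.2 (hu1.antitone hmn)
  have hm2 : Monotone fun n => Set.Ioi (u n) := fun m n hmn =>
    Set.Ioi_subset_Ioi (hu1.antitone hmn)
  conv_lhs => rw [h1]
  rw [h2, hm1.measure_iUnion, hm2.measure_iUnion]
  exact iSup_congr fun n => h _ (hu2 n).2.le

/-- Half-open intervals form a π-system containing arbitrarily small neighbourhoods of each point,
so convergence of their masses, here eventual equality, suffices for weak convergence. -/
theorem tendsto_probabilityMeasure_of_Ioi {ι : Type*} {l : Filter ι} [l.IsCountablyGenerated]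
    {μ : ι → ProbabilityMeasure ℝ} {ν : ProbabilityMeasure ℝ}
    (h : ∀ a, ∀ᶠ i in l, (μ i : Measure ℝ) (Set.Ioi a) = (ν : Measure ℝ) (Set.Ioi a)) :
    Tendsto μ l (𝓝 ν) := by
  have hS : IsPiSystem {s : Set ℝ | ∃ a b, s = Set.Ioc a b} := by
    rintro _ ⟨a, b, rfl⟩ _ ⟨a', b', rfl⟩ -
    exact ⟨_, _, Set.Ioc_inter_Ioc⟩
  refine hS.tendsto_probabilityMeasure_of_tendsto_of_mem ?_ ?_ ?_
  · rintro _ ⟨a, b, rfl⟩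
    exact measurableSet_Ioc
  · intro u hu x hx
    obtain ⟨ε, hε, hball⟩ := Metric.isOpen_iff.1 hu x hx
    refine ⟨Set.Ioc (x - ε / 2) (x + ε / 2), ⟨_, _, rfl⟩,
      Ioc_mem_nhds (by linarith) (by linarith), fun z hz => hball ?_⟩
    rw [Metric.mem_ball, Real.dist_eq, abs_lt]
    constructor <;> linarith [hz.1, hz.2]
  · rintro _ ⟨a, b, rfl⟩
    refine tendsto_const_nhds.congr' ?_
    filter_upwards [h a, h b] with i ha hb
    rcases le_or_gt b a with hab | hab
    · simp [Set.Ioc_eq_empty_of_le hab]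
    · have key : ∀ ρ : Measure ℝ, IsProbabilityMeasure ρ →
          ρ (Set.Ioc a b) = ρ (Set.Ioi a) - ρ (Set.Ioi b) := fun ρ _ => by
        rw [← measure_sdiff (Set.Ioi_subset_Ioi hab.le) measurableSet_Ioi.nullMeasurableSet
          (measure_ne_top _ _)]
        congr 1
        ext z
        simp
      rw [← ENNReal.coe_inj, ProbabilityMeasure.ennreal_coeFn_eq_coeFn_toMeasure,
        ProbabilityMeasure.ennreal_coeFn_eq_coeFn_toMeasure, key _ inferInstance,
        key _ inferInstance, ha, hb]

variable {r₁ r₂ : ℝ} [hr₁ : Fact (0 < r₁)] [hr₂ : Fact (0 < r₂)] {σ : Measure ℝ}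
  [IsProbabilityMeasure σ]

theorem eventually_map_aoi_Ioi (hσ : σ (Set.Iio 0) = 0) (u₀ a : ℝ) :
    ∀ᶠ t in atTop, (pathLaw r₁ r₂ σ).map (fun ω => aoi (gap ω) (svc ω) u₀ 0 t) (Set.Ioi a) =
      stationaryLaw r₁ r₂ σ (Set.Ioi a) := by
  -- The unit of room above a allows y ↓ a, which reconciles the closed half-lines of the age with
  -- the open ones of the delivery time.
  filter_upwards [eventually_ge_atTop (a + 1), eventually_ge_atTop (a + 1 + u₀)] with t h1 h2
  exact measure_Ioi_eq_of_Ici (lt_add_one a) fun y hy =>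
    map_aoi_Ici hσ (by linarith) (by linarith)

theorem integral_stationaryLaw (hσ : σ (Set.Iio 0) = 0) :
    Integrable (fun y : ℝ => y) (stationaryLaw r₁ r₂ σ) ∧
    ∫ y, y ∂(stationaryLaw r₁ r₂ σ) = 1 / (r₁ * laplaceL σ (r₁ + r₂)) := by
  have h := aemeasurable_deliveryTime_one (r₁ := r₁) (r₂ := r₂) hσ
  have h1 := integral_deliveryTime_one (r₁ := r₁) (r₂ := r₂) hσ
  refine ⟨(integrable_map_measure aestronglyMeasurable_id h).2 h1.1, ?_⟩
  exact (integral_map h aestronglyMeasurable_id).trans h1.2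

end WeakLimit

/-! ### From an arbitrary input to the canonical space. -/

section Transfer

variable {Ω : Type*} [MeasurableSpace Ω] {P : Measure Ω} [IsProbabilityMeasure P]
  {σ : Measure ℝ} [IsProbabilityMeasure σ]

/-- The input of a two-source system as a random element of the canonical space. -/
def inputPath (X S : Fin 2 → ℕ → Ω → ℝ) (ω : Ω) : Path :=
  (fun n => (X 0 n ω, S 0 n ω), fun n => (X 1 n ω, S 1 n ω))

theorem gap_inputPath (X S : Fin 2 → ℕ → Ω → ℝ) (ω : Ω) :
    gap (inputPath X S ω) = fun c n => X c n ω := by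
  funext c n; fin_cases c <;> rfl

theorem svc_inputPath (X S : Fin 2 → ℕ → Ω → ℝ) (ω : Ω) :
    svc (inputPath X S ω) = fun c n => S c n ω := by
  funext c n; fin_cases c <;> rfl

theorem infinitePi_fin_two_map {α : Type} [MeasurableSpace α] (μ : Fin 2 → Measure α)
    [∀ i, IsProbabilityMeasure (μ i)] :
    (Measure.infinitePi μ).map (fun f => (f 0, f 1)) = (μ 0).prod (μ 1) := by
  rw [Measure.infinitePi_eq_pi]
  exact (measurePreserving_piFinTwo μ).map_eq

variable {rate : Fin 2 → ℝ} {X S : Fin 2 → ℕ → Ω → ℝ}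

theorem IsInput.aemeasurable_inputPath (h : IsInput P rate σ X S) :
    AEMeasurable (inputPath X S) P := by
  refine AEMeasurable.prodMk ?_ ?_ <;>
    exact aemeasurable_pi_iff.2 fun n =>
      (h.interarrival _ n).aemeasurable.prodMk (h.service _ n).aemeasurable

/-- Joint independence makes the law of the flat family a product measure. Grouping the factors
first by packet (gap and service), then by source, gives the canonical law. -/
theorem IsInput.map_inputPath (h : IsInput P rate σ X S) :
    P.map (inputPath X S) = pathLaw (rate 0) (rate 1) σ := by
  have hprob : ∀ c, IsProbabilityMeasure (expMeasure (rate c)) := fun c =>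
    isProbabilityMeasure_expMeasure (h.rate_pos c)
  set V : (Fin 2 × ℕ) × Fin 2 → Ω → ℝ := fun q => ![X q.1.1 q.1.2, S q.1.1 q.1.2] q.2 with hV
  set ρ : Fin 2 × ℕ → Fin 2 → Measure ℝ := fun p => ![expMeasure (rate p.1), σ] with hρ
  have hρp : ∀ p b, IsProbabilityMeasure (ρ p b) := fun p => Fin.forall_fin_two.2
    ⟨hprob p.1, inferInstanceAs (IsProbabilityMeasure σ)⟩
  set e : (Fin 2 × ℕ) × Fin 2 → (Fin 2 × ℕ) ⊕ (Fin 2 × ℕ) := fun q =>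
    if q.2 = 0 then Sum.inl q.1 else Sum.inr q.1 with he
  have hinj : Function.Injective e := by
    rintro ⟨p, b⟩ ⟨p', b'⟩ hb
    fin_cases b <;> fin_cases b' <;> simp [he] at hb ⊢ <;> exact hb
  have hlaw : ∀ q, HasLaw (V q) (ρ q.1 q.2) P := by
    rintro ⟨⟨c, n⟩, b⟩
    fin_cases b
    exacts [h.interarrival c n, h.service c n]
  have hind : iIndepFun V P := by
    have h1 := h.indep.precomp hinj
    convert h1 using 1
    funext ⟨⟨c, n⟩, b⟩
    fin_cases b <;> rfl
  have hVm : AEMeasurable (fun ω q => V q ω) P := aemeasurable_pi_iff.2 fun q => (hlaw q).aemeasurable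
  have h1 : P.map (fun ω q => V q ω) = Measure.infinitePi fun q => ρ q.1 q.2 :=
    (hind.hasLaw_infinitePi hlaw hVm).map_eq
  set pair : ((Fin 2 × ℕ) × Fin 2 → ℝ) → Fin 2 × ℕ → ℝ × ℝ :=
    fun v p => (v (p, 0), v (p, 1)) with hpair
  have h2 : (Measure.infinitePi fun q : (Fin 2 × ℕ) × Fin 2 => ρ q.1 q.2).map pair =
      Measure.infinitePi fun p : Fin 2 × ℕ => (expMeasure (rate p.1)).prod σ := by
    -- Currying the flat product isolates, for each packet, a product over two indices, which is
    -- then read as a law on pairs.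
    have h3 := Measure.infinitePi_map_pi (μ := fun p => Measure.infinitePi (ρ p))
      (f := fun _ (g : Fin 2 → ℝ) => (g 0, g 1)) fun _ => by fun_prop
    simp only [infinitePi_fin_two_map] at h3
    rw [← Measure.infinitePi_map_curry, Measure.map_map (by fun_prop)
      (MeasurableEquiv.measurable _)] at h3
    exact h3
  have h4 := Measure.infinitePi_map_curry (fun (c : Fin 2) (_ : ℕ) => (expMeasure (rate c)).prod σ)
  have h5 := infinitePi_fin_two_map
    fun c : Fin 2 => Measure.infinitePi fun _ : ℕ => (expMeasure (rate c)).prod σ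
  have hpm : Measurable pair := by fun_prop
  rw [← h4, ← h2, ← h1, AEMeasurable.map_map_of_aemeasurable hpm.aemeasurable hVm,
    AEMeasurable.map_map_of_aemeasurable (MeasurableEquiv.measurable _).aemeasurable
      (hpm.comp_aemeasurable hVm),
    AEMeasurable.map_map_of_aemeasurable (by fun_prop)
      ((MeasurableEquiv.measurable _).comp_aemeasurable (hpm.comp_aemeasurable hVm))] at h5
  exact h5

end Transfer

end MG11

theorem corollary2 {Ω : Type*} [MeasurableSpace Ω] (P : Measure Ω) [IsProbabilityMeasure P]
    (lam₁ lam₂ : ℝ) (σ : Measure ℝ) [IsProbabilityMeasure σ] (X S : Fin 2 → ℕ → Ω → ℝ)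
    (h : MG11.IsInput P ![lam₁, lam₂] σ X S) :
    MG11.IsAverageAoI P X S 0 (1 / (lam₁ * MG11.laplaceL σ (lam₁ + lam₂))) ∧
    MG11.IsAveragePeakAoI P X S 0
      ((1 + lam₁ * MG11.laplaceL' σ (lam₁ + lam₂)) / (lam₁ * MG11.laplaceL σ (lam₁ + lam₂))) := by
  open MG11 in
  have : Fact (0 < lam₁) := ⟨h.rate_pos 0⟩
  have : Fact (0 < lam₂) := ⟨h.rate_pos 1⟩
  have hσ := h.service_nonneg
  have hG := h.aemeasurable_inputPath
  have hmap : P.map (inputPath X S) = pathLaw lam₁ lam₂ σ := h.map_inputPath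
  have hae : ∀ {p : Path → Prop}, (∀ᵐ ω ∂(pathLaw lam₁ lam₂ σ), p ω) →
      ∀ᵐ ω ∂P, p (inputPath X S ω) := fun hp => ae_of_ae_map hG (hmap ▸ hp)
  have hreg := hae (ae_regular hσ)
  have haoi : ∀ u₀ t ω, aoi (fun c n => X c n ω) (fun c n => S c n ω) u₀ 0 t =
      aoi (gap (inputPath X S ω)) (svc (inputPath X S ω)) u₀ 0 t := fun u₀ t ω => by
    rw [gap_inputPath, svc_inputPath]
  have hpeak : ∀ i ω, peakAoI (fun c n => X c n ω) (fun c n => S c n ω) 0 i =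
      peakAoI (gap (inputPath X S ω)) (svc (inputPath X S ω)) 0 i := fun i ω => by
    rw [gap_inputPath, svc_inputPath]
  refine ⟨fun u₀ => ⟨?_, ?_⟩, ?_, fun i hi => ?_, ?_⟩
  · have hm : ∀ t : ℝ, AEMeasurable (fun ω : Path => aoi (gap ω) (svc ω) u₀ 0 t)
        (P.map (inputPath X S)) := fun t => by
      rw [hmap]; exact aemeasurable_aoi hσ u₀ t
    obtain ⟨ν, hν⟩ : ∃ ν : ProbabilityMeasure ℝ, (ν : Measure ℝ) = stationaryLaw lam₁ lam₂ σ :=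
      ⟨⟨_, isProbabilityMeasure_stationaryLaw hσ⟩, rfl⟩
    have hmean := integral_stationaryLaw (r₁ := lam₁) (r₂ := lam₂) hσ
    rw [← hν] at hmean
    simp only [haoi]
    refine ⟨ν, ⟨fun t => (hm t).comp_aemeasurable hG, aemeasurable_id, ?_⟩, hmean⟩
    -- For each a the tails beyond a coincide from some time on, so the convergence needs no
    -- estimate.
    refine tendsto_probabilityMeasure_of_Ioi fun a => ?_
    filter_upwards [eventually_map_aoi_Ioi (r₁ := lam₁) (r₂ := lam₂) hσ u₀ a] with t ht
    change P.map _ _ = Measure.map id _ _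
    rw [Measure.map_id, hν, ← ht, ← hmap, AEMeasurable.map_map_of_aemeasurable (hm t) hG]
    rfl
  · filter_upwards [hreg, hae (ae_tendsto_integral_aoi_div hσ)] with ω h1 h2
    simp only [haoi]
    exact ⟨fun τ _ => h1.intervalIntegrable_aoi u₀ 0 τ, h2 u₀⟩
  · filter_upwards [hreg] with ω h1
    have h2 := h1.infinite
    rwa [gap_inputPath, svc_inputPath] at h2
  · obtain ⟨j, rfl⟩ := Nat.exists_eq_add_of_le' hi
    simp only [hpeak]
    have h1 := integral_peakAoI (r₁ := lam₁) (r₂ := lam₂) hσ j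
    rw [← hmap] at h1
    refine ⟨h1.1.comp_aemeasurable hG, ?_⟩
    rw [← h1.2, integral_map hG h1.1.aestronglyMeasurable]
  · filter_upwards [hae (ae_tendsto_sum_peakAoI_div hσ)] with ω h1
    simp only [hpeak]
    exact h1
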